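/- Let $\gamma\subset\mathbb R^3$ be a smooth, compact, connected surface without boundary, the boundary of a bounded open set (its interior). Let $d$ be its signed distance function ($d<0$ in the interior), $\nu=\nabla d$, $p(x)=x-d(x)\nu(x)$ the closest point projection onto $\gamma$. Fix a sufficiently small $\delta>0$, depending only on $\gamma$, such that $d$ is smooth and $p$ is well defined on the tube $U=\{x:\operatorname{dist}(x,\gamma)\le\delta\}$. Let $\Gamma_h\subset U$ be a polyhedral surface with a conforming triangulation $\mathcal T_h$ into planar triangles, $h=\max_{K\in\mathcal T_h}\operatorname{diam}K$, and constant unit normals $\nu_h|_K=\nu_K$. Assume, with constants $M,c>0$: $p:\Gamma_h\to\gamma$ is a bijection; $|d|\le Mh^2$, $|\nu\circ p-\nu_h|\le Mh$ and $\nu\cdot\nu_h\ge c$ on $\Gamma_h$; for each $K\in\mathcal T_h$ the circumradius is at most $M$ times the inradius, and $h\le M\operatorname{diam}K$. For a surface piece $S$ with unit normal $n$ and $\Pi=I-n\otimes n$, let $H^1_T(S)$ be the space of tangential fields in $L_2(S)^3$ whose components have weak surface gradients in $L_2(S)$; write $\nabla v\,\Pi$ for the matrix whose $i$-th row is the weak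 surface gradient of $v_i$, $\nabla_S v=\Pi(\nabla v\,\Pi)$ for the covariant derivative, and ${\rm Def}_S v=\frac12(\nabla_S v+(\nabla_S v)^{\intercal})$. Let $\mu_h$ be the area ratio, $\mu_h\,d\sigma_h=d\sigma\circ p$, where $\sigma_h,\sigma$ are the surface measures of $\Gamma_h,\gamma$. Define the Piola transform $\mathcal P_p v$ by $(\mathcal P_p v)\circ p=\mu_h^{-1}\,Dp\,v$. Then there is a constant $C>0$, depending only on $\gamma$, $\delta$, $M$, $c$ (in particular not on $h$, $\Gamma_h$, $K$ or $v$), such that for every such $\Gamma_h$, every $K\in\mathcal T_h$ with image $K^\gamma=p(K)$, and every $v\in H^1_T(K)$, the field $\hat v=\mathcal P_p v$ belongs to $H^1_T(K^\gamma)$ and, almost everywhere on $K^\gamma$, $$\big|{\rm Def}_\gamma \hat v-({\rm Def}_{\Gamma_h}v)\circ p^{-1}\big|\le C\,h\,\big(|(\nabla_{\Gamma_h}v)\circ p^{-1}|+|v\circ p^{-1}|\big).$$ Consequently, $$\|{\rm Def}_\gamma\hat v\|_{L_2(K^\gamma)}\le C\Big(\|{\rm Def}_{\Gamma_h}v\|_{L_2(K)}+h\big(\|\nabla_{\Gamma_h}v\|_{L_2(K)}+\|v\|_{L_2(K)}\big)\Big).$$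 -/

import Mathlib

open MeasureTheory Set
open scoped ContDiff Topology RealInnerProductSpace

noncomputable section

/-- Three-dimensional Euclidean space. -/
abbrev E3 : Type := EuclideanSpace ℝ (Fin 3)

/-- Matrices act as linear maps of Euclidean space, `|A|` is the operator norm. -/
abbrev Mat3 : Type := E3 →L[ℝ] E3

/-! ### The smooth surface, its signed distance function and the closest point projection -/

/-- The surface `γ = frontier Ω` is a smooth, compact, connected surface without boundary in `ℝ³`
and `Ω` is its interior: near each of its points, `Ω` is the set where a smooth function with
nonvanishing differential is negative. -/
structure BoundsSmoothSurface (Ω : Set E3) : Prop where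
  isOpen : IsOpen Ω
  isBounded : Bornology.IsBounded Ω
  isConnected : IsConnected (frontier Ω)
  smooth : ∀ x ∈ frontier Ω, ∃ f : E3 → ℝ, ContDiff ℝ ∞ f ∧ fderiv ℝ f x ≠ 0 ∧
    ∀ᶠ y in 𝓝 x, (y ∈ Ω ↔ f y < 0)

open Classical in
/-- The signed distance function `d` of `γ = frontier Ω`, negative in the interior `Ω`. -/
def sdist (Ω : Set E3) (x : E3) : ℝ :=
  if x ∈ Ω then -Metric.infDist x (frontier Ω) else Metric.infDist x (frontier Ω)

/-- The field `ν = ∇ d`; on `γ` it is the outward unit normal. -/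
def nu (Ω : Set E3) (x : E3) : E3 := gradient (sdist Ω) x

/-- The closest point projection `p(x) = x - d(x) ν(x)`. -/
def proj (Ω : Set E3) (x : E3) : E3 := x - sdist Ω x • nu Ω x

/-- The closed tubular region `U = {x : dist(x, γ) ≤ δ}`. -/
def tube (Ω : Set E3) (δ : ℝ) : Set E3 := {x | Metric.infDist x (frontier Ω) ≤ δ}

/-- The width `δ` is so small that on the tubular region `U` the signed distance function is smooth
and the closest point projection is well defined. -/
structure IsTubularWidth (Ω : Set E3) (δ : ℝ) : Prop where
  pos : 0 < δ
  smooth : ∀ x ∈ tube Ω δ, ContDiffAt ℝ ∞ (sdist Ω) x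
  proj_mem : ∀ x ∈ tube Ω δ, proj Ω x ∈ frontier Ω
  dist_proj : ∀ x ∈ tube Ω δ, dist x (proj Ω x) = Metric.infDist x (frontier Ω)
  unique : ∀ x ∈ tube Ω δ, ∀ y ∈ frontier Ω,
    dist x y = Metric.infDist x (frontier Ω) → y = proj Ω x

/-! ### Polyhedral surfaces -/

/-- A finite conforming collection of (nondegenerate) triangles in `ℝ³`, each with a choice of a
unit normal vector. -/
structure PolyhedralSurface where
  numFaces : ℕ
  face : Fin numFaces → Affine.Triangle ℝ E3
  /-- Different faces have different vertex sets. -/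
  distinct : ∀ i j, range (face i).points = range (face j).points → i = j
  /-- Two faces meet exactly in the convex hull of their common vertices: a common edge, a common
  vertex or nothing. -/
  conforming : ∀ i j, (face i).closedInterior ∩ (face j).closedInterior =
    convexHull ℝ (range (face i).points ∩ range (face j).points)
  normal : Fin numFaces → E3
  norm_normal : ∀ i, ‖normal i‖ = 1
  normal_orth : ∀ i j k, ⟪normal i, (face i).points j - (face i).points k⟫ = 0

namespace PolyhedralSurface

/-- The union `Γ_h` of the closed faces. -/
def carrier (Γ : PolyhedralSurface) : Set E3 := ⋃ i, (Γ.face i).closedInterior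

/-- The mesh size `h`, the largest diameter of a face. -/
def meshSize (Γ : PolyhedralSurface) : ℝ := ⨆ i, Metric.diam (Γ.face i).closedInterior

end PolyhedralSurface

/-- The standing assumptions on the polyhedral approximation `Γ` of `γ = frontier Ω`, with the
constants in them made explicit. The closest point projection maps `Γ` one-to-one onto `γ`, which
makes `Γ` a closed surface; `le_inner_normal` orients the normals of `Γ` outwards. -/
structure IsPolyhedralApprox (Ω : Set E3) (δ M c : ℝ) (Γ : PolyhedralSurface) : Prop where
  subset_tube : Γ.carrier ⊆ tube Ω δ
  bijOn_proj : BijOn (proj Ω) Γ.carrier (frontier Ω)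
  abs_sdist_le : ∀ x ∈ Γ.carrier, |sdist Ω x| ≤ M * Γ.meshSize ^ 2
  normal_close : ∀ i, ∀ x ∈ (Γ.face i).closedInterior,
    ‖nu Ω (proj Ω x) - Γ.normal i‖ ≤ M * Γ.meshSize
  le_inner_normal : ∀ i, ∀ x ∈ (Γ.face i).closedInterior, c ≤ ⟪nu Ω x, Γ.normal i⟫
  shape_regular : ∀ i, (Γ.face i).circumradius ≤ M * (Γ.face i).inradius
  quasi_uniform : ∀ i, Γ.meshSize ≤ M * Metric.diam (Γ.face i).closedInterior

/-! ### Piola transform -/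

/-- The area ratio `μ` with `μ dσ₀ = dσ₁` of a bijection `Φ : S₀ → S₁` with inverse `Ψ`: the density
with respect to the surface measure of `S₀` of the surface measure of `S₁` carried over to `S₀`
by `Ψ`. -/
def areaRatio (S₀ S₁ : Set E3) (Ψ : E3 → E3) (x : E3) : ℝ :=
  ((Measure.map Ψ (μHE[2].restrict S₁)).rnDeriv (μHE[2].restrict S₀) x).toReal

/-- The Piola transform with respect to `Φ : S₀ → S₁` with inverse `Ψ` of a tangential field `v`:
`(𝒫 v)(Φ x) = μ(x)⁻¹ DΦ(x) v(x)`. -/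
def piola (S₀ S₁ : Set E3) (Φ Ψ : E3 → E3) (v : E3 → E3) (y : E3) : E3 :=
  (areaRatio S₀ S₁ Ψ (Ψ y))⁻¹ • fderiv ℝ Φ (Ψ y) (v (Ψ y))

/-- The inverse `p⁻¹ : γ → Γ_h` of the closest point projection restricted to `Γ_h`. -/
def projInv (Ω : Set E3) (Γ : PolyhedralSurface) : E3 → E3 :=
  Function.invFunOn (proj Ω) Γ.carrier

/-- The Piola transform `𝒫_p v` of a field on `Γ_h` to `γ`. -/
def liftPiola (Ω : Set E3) (Γ : PolyhedralSurface) (v : E3 → E3) : E3 → E3 :=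
  piola Γ.carrier (frontier Ω) (proj Ω) (projInv Ω Γ) v

/-! ### Surface derivatives

In this part `S` is a piece of a surface, relatively open in it, and `n` is a unit normal field
of the surface. -/

/-- The tangential projection `I - n ⊗ n`. -/
def tangProj (n : E3) : Mat3 :=
  ContinuousLinearMap.id ℝ E3 - (innerSL ℝ n).smulRight n

/-- The tangential surface gradient (covariant derivative) `Π A Π`, where `A` is a Jacobian. -/
def covGrad (n : E3 → E3) (A : E3 → Mat3) (x : E3) : Mat3 :=
  tangProj (n x) ∘L A x ∘L tangProj (n x)

/-- The deformation tensor, the symmetric part of the tangential surface gradient. -/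
def deform (n : E3 → E3) (A : E3 → Mat3) (x : E3) : Mat3 :=
  (1 / 2 : ℝ) • (covGrad n A x + ContinuousLinearMap.adjoint (covGrad n A x))

/-- The surface divergence `tr (Π Dφ Π)` of a smooth field. -/
def surfDiv (n : E3 → E3) (φ : E3 → E3) (x : E3) : ℝ :=
  LinearMap.trace ℝ E3 (covGrad n (fderiv ℝ φ) x).toLinearMap

/-- Smooth fields, tangential on `S`, whose restriction to `S` has compact support in `S`. -/
structure IsTestField (S : Set E3) (n : E3 → E3) (φ : E3 → E3) : Prop where
  smooth : ContDiff ℝ ∞ φ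
  compact : HasCompactSupport φ
  support : tsupport φ ∩ closure S ⊆ S
  tangential : ∀ x ∈ S, ⟪φ x, n x⟫ = 0

/-- The field `v` is in `H¹_T(S)` and the matrix field `A` is its weak surface Jacobian `∇v Π`, whose
`i`-th row is the weak surface gradient of the component `v_i`. That is, `v` and `A` are square
integrable, `v` is tangential, the rows of `A` are tangential, and
`∫_S v_i div_S φ = - ∫_S (∇_S v_i) ⬝ φ` for `i = 1, 2, 3` and all tangential test fields `φ`. -/
structure IsH1Tangential (S : Set E3) (n : E3 → E3) (v : E3 → E3) (A : E3 → Mat3) : Prop where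
  memLp : MemLp v 2 (μHE[2].restrict S)
  memLp_grad : MemLp A 2 (μHE[2].restrict S)
  tangential : ∀ᵐ x ∂(μHE[2].restrict S), ⟪v x, n x⟫ = 0
  grad_normal : ∀ᵐ x ∂(μHE[2].restrict S), A x (n x) = 0
  weak : ∀ φ : E3 → E3, IsTestField S n φ →
    ∫ x in S, surfDiv n φ x • v x ∂μHE[2] = - ∫ x in S, A x (φ x) ∂μHE[2]

end

/-! Write H = Dν. For w in the plane of a face, Dp w = w − ⟪ν, w⟫ ν − d H w, and both |d| and |⟪ν,
w⟫|/|w| are O(h). So on the face p is the identity up to O(h): the area ratio J is 1 + O(h), the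
Piola matrix F = J⁻¹ Dp is I + O(h) on vectors of the face, and the inverse R of Dp from the tangent
plane of γ to the face is the projection to the face up to O(h).

By the chain rule the Jacobian of the lifted field, pulled back to the face, is w ↦ F A R w + (DF)(R
w) v, where A is the Jacobian of v. The first term is A + O(h)|A|. The second is not small, because
the curvature of γ makes DF of order one. However, D²p(t, a) = −⟪H t, a⟫ ν + O(h), so the large part
is normal and the projection in the covariant derivative removes it
(`norm_tangProj_fderiv_fderiv_proj_le`). The derivative of J is O(h) for the same reason, since J
sees only tangential parts (`abs_fderiv_projJac_le`). On a flat face A equals its own covariant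
derivative (`covGrad_flat`), so already the full covariant derivatives differ by O(h)(|A| + |v|)
(`norm_covGrad_sub_le`); taking symmetric parts does not increase this difference. The L² bound
follows from a change of variables.

Since derivatives are weak, the chain rule must be justified by duality. The Piola identity
(`surfDiv_projCof`) says that the cofactor pull-back of a tangential field φ has divergence J (div
φ) ∘ p; together with a product rule for smooth matrix multipliers (`weak_mul`) it turns the weak
formulation on γ into the one on the face (`piola_h1`). Uniqueness of weak Jacobians (`unique`) then
extends the estimate to every weak Jacobian of the lift.

Two foundations remain. The area ratio is a Radon–Nikodym derivative of Hausdorff measures,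
identified with J through an area formula for parametrized surfaces (`area_formula`,
`areaRatio_eq`). Smoothness of d near γ comes from the inverse function theorem
(`eventually_contDiffAt_sdist`), and the properties of ν and p in a tube from following d along
segments to closest points (`tubeNbhd_thickening`). -/

noncomputable section

/-! ### Cross product and triple product in Euclidean space -/

theorem inner_e3 (a b : E3) : ⟪a, b⟫ = a 0 * b 0 + a 1 * b 1 + a 2 * b 2 := by
  simp [PiLp.inner_apply, Fin.sum_univ_three, mul_comm]

theorem norm_sq_e3 (a : E3) : ‖a‖ ^ 2 = a 0 ^ 2 + a 1 ^ 2 + a 2 ^ 2 := by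
  rw [← real_inner_self_eq_norm_sq, inner_e3]; ring

theorem ext_e3 {a b : E3} (h0 : a 0 = b 0) (h1 : a 1 = b 1) (h2 : a 2 = b 2) : a = b := by
  ext i; fin_cases i <;> assumption

/-- The cross product of `E3`. -/
def cr (a b : E3) : E3 :=
  !₂[a 1 * b 2 - a 2 * b 1, a 2 * b 0 - a 0 * b 2, a 0 * b 1 - a 1 * b 0]

@[simp] theorem cr_zero_coord (a b : E3) : cr a b 0 = a 1 * b 2 - a 2 * b 1 := rfl
@[simp] theorem cr_one_coord (a b : E3) : cr a b 1 = a 2 * b 0 - a 0 * b 2 := rfl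
@[simp] theorem cr_two_coord (a b : E3) : cr a b 2 = a 0 * b 1 - a 1 * b 0 := rfl

theorem norm_cr_le (a b : E3) : ‖cr a b‖ ≤ ‖a‖ * ‖b‖ := by
  refine abs_le_of_sq_le_sq' ?_ (by positivity) |>.2
  rw [mul_pow, norm_sq_e3, norm_sq_e3, norm_sq_e3]
  simp only [cr_zero_coord, cr_one_coord, cr_two_coord]
  nlinarith [sq_nonneg (a 0 * b 0 + a 1 * b 1 + a 2 * b 2)]

/-- The cross product as a continuous bilinear map. -/
def crL : E3 →L[ℝ] E3 →L[ℝ] E3 :=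
  LinearMap.mkContinuous₂
    (LinearMap.mk₂ ℝ cr (fun a b c => by apply ext_e3 <;> simp <;> ring)
      (fun r a b => by apply ext_e3 <;> simp <;> ring)
      (fun a b c => by apply ext_e3 <;> simp <;> ring)
      (fun r a b => by apply ext_e3 <;> simp <;> ring)) 1
    (fun a b => by simpa using norm_cr_le a b)

@[simp] theorem crL_apply (a b : E3) : crL a b = cr a b := rfl

theorem cr_self (a : E3) : cr a a = 0 := by apply ext_e3 <;> simp <;> ring

theorem cr_swap (a b : E3) : cr a b = -cr b a := by apply ext_e3 <;> simp <;> ring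

/-- The triple product (determinant). -/
def tri (a b c : E3) : ℝ := ⟪cr a b, c⟫

theorem tri_eq (a b c : E3) : tri a b c = (a 1 * b 2 - a 2 * b 1) * c 0 +
    (a 2 * b 0 - a 0 * b 2) * c 1 + (a 0 * b 1 - a 1 * b 0) * c 2 := by
  rw [tri, inner_e3]; simp

theorem tri_rot (a b c : E3) : tri a b c = tri b c a := by
  rw [tri_eq, tri_eq]; ring

theorem tri_swap (a b c : E3) : tri a b c = -tri b a c := by
  rw [tri_eq, tri_eq]; ring

theorem tri_sub_left (a a' b c : E3) : tri (a - a') b c = tri a b c - tri a' b c := by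
  simp only [tri_eq, PiLp.sub_apply]; ring

theorem tri_smul_left (r : ℝ) (a b c : E3) : tri (r • a) b c = r * tri a b c := by
  simp only [tri_eq, PiLp.smul_apply, smul_eq_mul]; ring

theorem tri_sub_mid (a b b' c : E3) : tri a (b - b') c = tri a b c - tri a b' c := by
  simp only [tri_eq, PiLp.sub_apply]; ring

theorem tri_smul_mid (r : ℝ) (a b c : E3) : tri a (r • b) c = r * tri a b c := by
  simp only [tri_eq, PiLp.smul_apply, smul_eq_mul]; ring

@[simp] theorem tri_self_right (a b : E3) : tri a b b = 0 := by rw [tri_eq]; ring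
@[simp] theorem tri_self_outer (a b : E3) : tri a b a = 0 := by rw [tri_eq]; ring

theorem abs_tri_le (a b c : E3) : |tri a b c| ≤ ‖a‖ * ‖b‖ * ‖c‖ :=
  (abs_real_inner_le_norm _ _).trans (by gcongr; exact norm_cr_le a b)

theorem inner_cr_left (a b w : E3) : ⟪cr a b, w⟫ = tri w a b := by
  rw [← tri, tri_rot, tri_rot]

/-- Three vectors orthogonal to a nonzero vector are linearly dependent. -/
theorem tri_eq_zero_of_inner {a b c n : E3} (hn : n ≠ 0) (ha : ⟪a, n⟫ = 0) (hb : ⟪b, n⟫ = 0)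
    (hc : ⟪c, n⟫ = 0) : tri a b c = 0 := by
  rw [inner_e3] at ha hb hc
  -- Cramer's rule: det(a, b, c) n = ⟪a, n⟫ b×c + ⟪b, n⟫ c×a + ⟪c, n⟫ a×b, read coordinate by
  -- coordinate.
  have h : ∀ i, tri a b c * n i = 0 := by
    intro i
    rw [tri_eq]
    fin_cases i
    · simp only [Fin.zero_eta]
      linear_combination (b 1 * c 2 - b 2 * c 1) * ha + (a 2 * c 1 - a 1 * c 2) * hb +
        (a 1 * b 2 - a 2 * b 1) * hc
    · simp only [Fin.mk_one]
      linear_combination (b 2 * c 0 - b 0 * c 2) * ha + (a 0 * c 2 - a 2 * c 0) * hb +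
        (a 2 * b 0 - a 0 * b 2) * hc
    · simp only [Fin.reduceFinMk]
      linear_combination (b 0 * c 1 - b 1 * c 0) * ha + (a 1 * c 0 - a 0 * c 1) * hb +
        (a 0 * b 1 - a 1 * b 0) * hc
  by_contra h0
  exact hn (ext_e3 (by simpa [h0] using h 0) (by simpa [h0] using h 1) (by simpa [h0] using h 2))

theorem clm_coord (L : Mat3) (a : E3) (i : Fin 3) :
    L a i = a 0 * L (EuclideanSpace.single 0 1) i + a 1 * L (EuclideanSpace.single 1 1) i +
      a 2 * L (EuclideanSpace.single 2 1) i := by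
  have : a = a 0 • EuclideanSpace.single 0 1 + a 1 • EuclideanSpace.single 1 1 +
      a 2 • EuclideanSpace.single (2 : Fin 3) (1 : ℝ) := by
    apply ext_e3 <;> simp
  conv_lhs => rw [this]
  simp

theorem trace_e3 (L : Mat3) : LinearMap.trace ℝ E3 L.toLinearMap =
    L (EuclideanSpace.single 0 1) 0 + L (EuclideanSpace.single 1 1) 1 +
      L (EuclideanSpace.single 2 1) 2 := by
  rw [LinearMap.trace_eq_sum_inner _ (EuclideanSpace.basisFun (Fin 3) ℝ), Fin.sum_univ_three]
  simp [EuclideanSpace.inner_single_left]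

/-- The trace is the derivative of the determinant. -/
theorem tri_trace (L : Mat3) (a b c : E3) : tri (L a) b c + tri a (L b) c + tri a b (L c) =
    LinearMap.trace ℝ E3 L.toLinearMap * tri a b c := by
  rw [trace_e3]
  simp only [tri_eq, clm_coord L a, clm_coord L b, clm_coord L c]
  ring

/-- The determinant of `I - sL` as a polynomial in `s`, applied to a frame. -/
theorem tri_map_scale (L : Mat3) (a b c a' b' c' : E3) :
    tri (L a) (L b) (L c) * tri a' b' c' = tri (L a') (L b') (L c') * tri a b c := by
  simp only [tri_eq, clm_coord L a, clm_coord L b, clm_coord L c, clm_coord L a', clm_coord L b',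
    clm_coord L c']
  ring

/-! ### Tangential projections, tangential traces and orthonormal frames -/

theorem tangProj_apply (n w : E3) : tangProj n w = w - ⟪n, w⟫ • n := rfl

theorem inner_tangProj {n : E3} (hn : ‖n‖ = 1) (w : E3) : ⟪n, tangProj n w⟫ = 0 := by
  rw [tangProj_apply, inner_sub_right, inner_smul_right, real_inner_self_eq_norm_sq, hn]; ring

theorem tangProj_self {n : E3} (hn : ‖n‖ = 1) : tangProj n n = 0 := by
  rw [tangProj_apply, real_inner_self_eq_norm_sq, hn]; simp

theorem tangProj_of_inner {n w : E3} (h : ⟪n, w⟫ = 0) : tangProj n w = w := by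
  rw [tangProj_apply, h]; simp

theorem norm_tangProj_apply_le {n : E3} (hn : ‖n‖ = 1) (w : E3) : ‖tangProj n w‖ ≤ ‖w‖ := by
  refine abs_le_of_sq_le_sq' ?_ (by positivity) |>.2
  rw [tangProj_apply, norm_sub_sq_real, inner_smul_right, norm_smul, hn, mul_one,
    Real.norm_eq_abs, sq_abs, real_inner_comm]
  nlinarith [sq_nonneg ⟪n, w⟫]

/-- The trace of the tangential part of a matrix in terms of two tangent vectors. -/
theorem tri_trace_tang (L : Mat3) {a b n : E3} (hn : ‖n‖ = 1) (ha : ⟪n, a⟫ = 0) (hb : ⟪n, b⟫ = 0) :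
    tri (L a) b n + tri a (L b) n =
      LinearMap.trace ℝ E3 (tangProj n ∘L L ∘L tangProj n).toLinearMap * tri a b n := by
  -- In the frame a, b, n the term differentiating n drops because the projected matrix kills n. The
  -- normal corrections to L a and L b drop because n already occupies the third slot.
  rw [← tri_trace]
  simp only [ContinuousLinearMap.comp_apply, tangProj_self hn, tangProj_of_inner ha,
    tangProj_of_inner hb, map_zero]
  have h0 : ∀ x y : E3, tri x y 0 = 0 := fun x y => inner_zero_right _
  simp only [tangProj_apply, tri_sub_left, tri_smul_left, tri_sub_mid, tri_smul_mid,
    tri_self_outer, tri_self_right, h0, mul_zero, sub_zero, add_zero]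

/-- A positively oriented orthonormal frame. -/
structure IsFrame (e₁ e₂ m : E3) : Prop where
  n1 : ‖e₁‖ = 1
  n2 : ‖e₂‖ = 1
  n3 : ‖m‖ = 1
  i12 : ⟪e₁, e₂⟫ = 0
  i1 : ⟪m, e₁⟫ = 0
  i2 : ⟪m, e₂⟫ = 0
  cr_eq : cr e₁ e₂ = m

theorem cr_cr (a b c : E3) : cr a (cr b c) = ⟪a, c⟫ • b - ⟪a, b⟫ • c := by
  apply ext_e3 <;> simp [inner_e3] <;> ring

theorem norm_cr_sq (a b : E3) : ‖cr a b‖ ^ 2 = ‖a‖ ^ 2 * ‖b‖ ^ 2 - ⟪a, b⟫ ^ 2 := by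
  rw [norm_sq_e3, norm_sq_e3, norm_sq_e3, inner_e3]
  simp only [cr_zero_coord, cr_one_coord, cr_two_coord]
  ring

theorem exists_frame {m : E3} (hm : ‖m‖ = 1) : ∃ e₁ e₂, IsFrame e₁ e₂ m := by
  obtain ⟨w, hw⟩ : ∃ w : E3, tangProj m w ≠ 0 := by
    -- Otherwise each basis vector is a multiple of m, which gives m₀² = m₁² = 1 and m₀ m₁ = 0.
    by_contra! h
    have h1 : ∀ i : Fin 3, EuclideanSpace.single i (1 : ℝ) = m i • m := fun i => by
      have := h (EuclideanSpace.single i 1)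
      rw [tangProj_apply, sub_eq_zero, EuclideanSpace.inner_single_right] at this
      simpa using this
    have h00 := congrArg (fun z : E3 => z 0) (h1 0)
    have h01 := congrArg (fun z : E3 => z 1) (h1 0)
    have h11 := congrArg (fun z : E3 => z 1) (h1 1)
    simp at h00 h01 h11
    rcases h01 with h | h <;> simp [h] at h00 h11
  set e := tangProj m w with he
  have hme : ⟪m, e⟫ = 0 := inner_tangProj hm w
  have hne : ‖e‖ ≠ 0 := by simpa using hw
  set e₁ := ‖e‖⁻¹ • e with he1
  have h1 : ‖e₁‖ = 1 := by rw [he1, norm_smul, norm_inv, norm_norm, inv_mul_cancel₀ hne]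
  have hm1 : ⟪m, e₁⟫ = 0 := by rw [he1, inner_smul_right, hme, mul_zero]
  have hi : ⟪e₁, cr m e₁⟫ = 0 := by rw [real_inner_comm]; exact tri_self_right m e₁
  refine ⟨e₁, cr m e₁, h1, ?_, hm, hi, hm1, ?_, ?_⟩
  · have := norm_cr_sq m e₁
    rw [hm, h1, hm1] at this
    have h2 : ‖cr m e₁‖ ^ 2 = 1 := by rw [this]; norm_num
    nlinarith [norm_nonneg (cr m e₁)]
  · rw [real_inner_comm]; exact tri_self_outer m e₁
  · rw [cr_cr, real_inner_self_eq_norm_sq, h1, real_inner_comm, hm1]; simp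

namespace IsFrame

variable {e₁ e₂ m : E3} (hf : IsFrame e₁ e₂ m)
include hf

theorem tri_eq_one : tri e₁ e₂ m = 1 := by
  rw [tri, hf.cr_eq, real_inner_self_eq_norm_sq, hf.n3]; norm_num

theorem cr2 : cr e₂ m = e₁ := by
  rw [← hf.cr_eq, cr_cr, real_inner_self_eq_norm_sq, hf.n2, real_inner_comm, hf.i12]; simp

theorem cr1 : cr m e₁ = e₂ := by
  rw [cr_swap, ← hf.cr_eq, cr_cr, real_inner_self_eq_norm_sq, hf.n1, hf.i12]; simp

/-- Expansion of a vector in an orthonormal frame. -/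
theorem expand (w : E3) : w = ⟪e₁, w⟫ • e₁ + ⟪e₂, w⟫ • e₂ + ⟪m, w⟫ • m := by
  have h1 : cr e₁ (cr e₂ m) = 0 := by rw [hf.cr2, cr_self]
  have key : ∀ w : E3, tri e₁ e₂ m • w =
      tri w e₂ m • e₁ + tri e₁ w m • e₂ + tri e₁ e₂ w • m := by
    intro w
    apply ext_e3 <;> simp only [PiLp.add_apply, PiLp.smul_apply, smul_eq_mul, tri_eq] <;> ring
  have := key w
  rw [hf.tri_eq_one, one_smul] at this
  have e1 : tri w e₂ m = ⟪e₁, w⟫ := by rw [← inner_cr_left, hf.cr2]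
  have e2 : tri e₁ w m = ⟪e₂, w⟫ := by rw [tri_rot, ← inner_cr_left, hf.cr1]
  have e3 : tri e₁ e₂ w = ⟪m, w⟫ := by rw [tri, hf.cr_eq]
  rw [e1, e2, e3] at this
  exact this

theorem tangProj_eq (w : E3) : tangProj m w = ⟪e₁, w⟫ • e₁ + ⟪e₂, w⟫ • e₂ := by
  rw [tangProj_apply, sub_eq_iff_eq_add]; exact hf.expand w

theorem norm_sq (w : E3) : ‖w‖ ^ 2 = ⟪e₁, w⟫ ^ 2 + ⟪e₂, w⟫ ^ 2 + ⟪m, w⟫ ^ 2 := by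
  rw [← real_inner_self_eq_norm_sq]
  nth_rewrite 1 [hf.expand w]
  simp only [inner_add_left, real_inner_smul_left]
  ring

/-- The trace of the tangential part of a matrix in an orthonormal frame. -/
theorem trace_tang (L : Mat3) :
    LinearMap.trace ℝ E3 (tangProj m ∘L L ∘L tangProj m).toLinearMap =
      ⟪e₁, L e₁⟫ + ⟪e₂, L e₂⟫ := by
  have := tri_trace_tang L hf.n3 hf.i1 hf.i2
  rw [hf.tri_eq_one, mul_one] at this
  rw [← this]
  congr 1
  · rw [← inner_cr_left, hf.cr2]
  · rw [tri_rot, ← inner_cr_left, hf.cr1]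

end IsFrame

end

noncomputable section

/-! ### Smoothness of the signed distance function near the surface -/

theorem inner_gradient (f : E3 → ℝ) (x w : E3) : ⟪gradient f x, w⟫ = fderiv ℝ f x w := by
  rw [gradient, InnerProductSpace.toDual_symm_apply]

theorem ContDiffAt.gradient_e3 {f : E3 → ℝ} {x : E3} (hf : ContDiffAt ℝ ∞ f x) :
    ContDiffAt ℝ ∞ (gradient f) x :=
  ((InnerProductSpace.toDual ℝ E3).symm.toContinuousLinearEquiv.contDiff.contDiffAt).comp x
    (hf.fderiv_right (m := ∞) (by simp))

/-- A zero of f outside the closure of Ω would have f ≥ 0 around it, hence be a local minimum,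
contradicting the nonvanishing differential. -/
theorem frontier_iff_of_defining {Ω : Set E3} (hΩ : IsOpen Ω) {f : E3 → ℝ} {z : E3}
    (hf : ContinuousAt f z) (hdf : fderiv ℝ f z ≠ 0) (hloc : ∀ᶠ y in 𝓝 z, (y ∈ Ω ↔ f y < 0)) :
    z ∈ frontier Ω ↔ f z = 0 := by
  rw [hΩ.frontier_eq]
  constructor
  · rintro ⟨hc, hn⟩
    have h0 : 0 ≤ f z := by simpa [hloc.self_of_nhds] using hn
    refine le_antisymm (le_of_not_gt fun hlt => ?_) h0
    have h1 : ∀ᶠ y in 𝓝 z, y ∉ Ω := by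
      filter_upwards [hf.eventually (lt_mem_nhds hlt), hloc] with y hy hy'
      rw [hy']; exact not_lt.2 hy.le
    exact (mem_closure_iff_frequently.1 hc) h1
  · intro h0
    refine ⟨?_, by rw [hloc.self_of_nhds, h0]; exact lt_irrefl 0⟩
    by_contra hc
    rw [mem_closure_iff_frequently, Filter.not_frequently] at hc
    refine hdf (IsLocalMin.fderiv_eq_zero ?_)
    filter_upwards [hc, hloc] with y hy hy'
    rw [hy', not_lt] at hy
    rwa [h0]

/-- At a closest point the distance vector is normal to a level set. -/
theorem exists_multiplier {f : E3 → ℝ} {s : Set E3} {x z : E3} (hf : ContDiff ℝ ∞ f)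
    (hdf : fderiv ℝ f z ≠ 0) (hs : ∀ᶠ y in 𝓝 z, (y ∈ s ↔ f y = 0)) (hz : z ∈ s)
    (hmin : ∀ y ∈ s, ‖x - z‖ ≤ ‖x - y‖) : ∃ l : ℝ, x - z = l • gradient f z := by
  have hfz : f z = 0 := hs.self_of_nhds.1 hz
  have hextr : IsLocalExtrOn (fun y => ‖x - y‖ ^ 2) {y | f y = f z} z := by
    left
    have : ∀ᶠ y in 𝓝[{y | f y = f z}] z, (y ∈ s ↔ f y = 0) := nhdsWithin_le_nhds hs
    filter_upwards [this, self_mem_nhdsWithin] with y hy hy'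
    have : y ∈ s := hy.2 ((show f y = f z from hy').trans hfz)
    exact pow_le_pow_left₀ (norm_nonneg _) (hmin y this) 2
  have h1 : HasStrictFDerivAt f (fderiv ℝ f z) z :=
    hf.contDiffAt.hasStrictFDerivAt (by simp)
  have h2 : HasStrictFDerivAt (fun y => ‖x - y‖ ^ 2) _ z :=
    HasStrictFDerivAt.comp z (hasStrictFDerivAt_norm_sq (x - z))
      ((hasStrictFDerivAt_id z).const_sub x)
  obtain ⟨a, b, hab, h⟩ := hextr.exists_multipliers_of_hasStrictFDerivAt_1d h1 h2
  have h3 : ∀ w, a * ⟪gradient f z, w⟫ - 2 * b * ⟪x - z, w⟫ = 0 := by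
    intro w
    have := congrArg (fun L => L w) h
    simp at this
    rw [inner_gradient, inner_sub_left]
    linarith
  -- If the multiplier of the distance vanished, that of the constraint would not, and df would be
  -- zero.
  have hb : b ≠ 0 := by
    rintro rfl
    have ha : a ≠ 0 := by rintro rfl; exact hab rfl
    refine hdf (ContinuousLinearMap.ext fun w => ?_)
    have := h3 w
    rw [inner_gradient] at this
    simpa [ha] using this
  refine ⟨a / (2 * b), ?_⟩
  refine ext_inner_right ℝ fun w => ?_
  rw [real_inner_smul_left]
  field_simp
  linarith [h3 w]

/-- The map `(y, t) ↦ (y + t ∇f(y), f(y))`. -/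
def normalMap (f : E3 → ℝ) (q : E3 × ℝ) : E3 × ℝ := (q.1 + q.2 • gradient f q.1, f q.1)

theorem contDiff_normalMap {f : E3 → ℝ} (hf : ContDiff ℝ ∞ f) : ContDiff ℝ ∞ (normalMap f) := by
  have hg : ContDiff ℝ ∞ (gradient f) := contDiff_iff_contDiffAt.2 fun x =>
    hf.contDiffAt.gradient_e3
  unfold normalMap
  fun_prop

/-- At t = 0 the Hessian of f drops out and the derivative is (w, l) ↦ (w + l ∇f, df w). A kernel
vector has w = −l ∇f, so l |∇f|² = 0 and l = 0. The inverse function theorem then yields smooth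
coordinates (y, t) with x = y + t ∇f(y) and f(y) = 0. -/
theorem exists_equiv_normalMap {f : E3 → ℝ} {x : E3} (hf : ContDiff ℝ ∞ f)
    (hdf : fderiv ℝ f x ≠ 0) :
    ∃ e : (E3 × ℝ) ≃L[ℝ] (E3 × ℝ), (e : (E3 × ℝ) →L[ℝ] (E3 × ℝ)) = fderiv ℝ (normalMap f) (x, 0) := by
  have hg : ContDiff ℝ ∞ (gradient f) := contDiff_iff_contDiffAt.2 fun x =>
    hf.contDiffAt.gradient_e3
  have hgx : gradient f x ≠ 0 := by
    intro h
    refine hdf (ContinuousLinearMap.ext fun w => ?_)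
    rw [← inner_gradient, h]; simp
  have hd : HasFDerivAt (normalMap f)
      (((ContinuousLinearMap.fst ℝ E3 ℝ) + ((0 : ℝ) • ((fderiv ℝ (gradient f) x).comp
        (ContinuousLinearMap.fst ℝ E3 ℝ)) + (ContinuousLinearMap.snd ℝ E3 ℝ).smulRight
          (gradient f x))).prod ((fderiv ℝ f x).comp (ContinuousLinearMap.fst ℝ E3 ℝ))) (x, 0) := by
    have h1 : HasFDerivAt (fun q : E3 × ℝ => gradient f q.1) _ (x, (0 : ℝ)) :=
      HasFDerivAt.comp (g := gradient f) (x, (0 : ℝ)) (hg.differentiable (by simp) x).hasFDerivAt hasFDerivAt_fst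
    have h2 : HasFDerivAt (fun q : E3 × ℝ => f q.1) _ (x, (0 : ℝ)) :=
      HasFDerivAt.comp (x, (0 : ℝ)) (hf.differentiable (by simp) x).hasFDerivAt hasFDerivAt_fst
    exact (hasFDerivAt_fst.add (hasFDerivAt_snd.smul h1)).prodMk h2
  have hinj : Function.Injective (fderiv ℝ (normalMap f) (x, 0)) := by
    rw [hd.fderiv]
    rw [injective_iff_map_eq_zero]
    rintro ⟨w, l⟩ h
    simp only [ContinuousLinearMap.prod_apply, add_apply, Prod.mk_eq_zero,
      ContinuousLinearMap.coe_fst', smul_apply, zero_smul, zero_add,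
      ContinuousLinearMap.smulRight_apply, ContinuousLinearMap.coe_snd',
      ContinuousLinearMap.comp_apply] at h
    obtain ⟨h1, h2⟩ := h
    rw [← inner_gradient] at h2
    have h3 : w = -(l • gradient f x) := eq_neg_of_add_eq_zero_left h1
    rw [h3, inner_neg_right, real_inner_smul_right, neg_eq_zero, mul_eq_zero] at h2
    rcases h2 with h2 | h2
    · rw [h2] at h3; simp [h3, h2]
    · exact absurd (inner_self_eq_zero.1 h2) hgx
  refine ⟨(LinearEquiv.ofInjectiveEndo (fderiv ℝ (normalMap f) (x, 0)).toLinearMap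
    hinj).toContinuousLinearEquiv, ?_⟩
  ext w <;> rfl

theorem abs_sdist (Ω : Set E3) (x : E3) : |sdist Ω x| = Metric.infDist x (frontier Ω) := by
  unfold sdist
  split_ifs <;> simp [abs_of_nonneg Metric.infDist_nonneg]

theorem BoundsSmoothSurface.isCompact_frontier {Ω : Set E3} (h : BoundsSmoothSurface Ω) :
    IsCompact (frontier Ω) :=
  Metric.isCompact_of_isClosed_isBounded isClosed_frontier
    (h.isBounded.closure.subset frontier_subset_closure)

/-- Applied with F = f(x), s = ⟪∇f(x₀), ∇f(y)⟫ and g = |∇f(y)|. The error is at most (5/16) a² |l|,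
less than the main term of size at least (3/4) a² |l|, so F and l have the same sign. -/
theorem sign_of_multiplier {a l s g F : ℝ} (ha : 0 < a) (hs : 3 / 4 * a ^ 2 ≤ s)
    (hg : g ≤ 5 / 4 * a) (hF : |F - l * s| ≤ a / 4 * (|l| * g)) :
    (F < 0 → l ≤ 0) ∧ (0 ≤ F → 0 ≤ l) := by
  have h1 : a / 4 * (|l| * g) ≤ |l| * (5 / 16 * a ^ 2) := by
    nlinarith [mul_le_mul_of_nonneg_left hg (mul_nonneg ha.le (abs_nonneg l))]
  obtain ⟨h2, h3⟩ := abs_le.1 (hF.trans h1)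
  refine ⟨fun h => ?_, fun h => ?_⟩ <;> by_contra hl <;> push Not at hl
  · rw [abs_of_pos hl] at h2
    nlinarith [mul_le_mul_of_nonneg_left hs hl.le, mul_pos hl (pow_pos ha 2)]
  · rw [abs_of_neg hl] at h3
    nlinarith [mul_le_mul_of_nonneg_left hs (neg_pos.2 hl).le, mul_pos (neg_pos.2 hl) (pow_pos ha 2)]

set_option maxHeartbeats 400000 in
/-- Every point of the surface has a neighbourhood in which the signed distance is smooth. -/
theorem eventually_contDiffAt_sdist {Ω : Set E3} (hΩ : BoundsSmoothSurface Ω) {x₀ : E3}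
    (hx₀ : x₀ ∈ frontier Ω) : ∀ᶠ x in 𝓝 x₀, ContDiffAt ℝ ∞ (sdist Ω) x := by
  obtain ⟨f, hf, hdf, hloc⟩ := hΩ.smooth x₀ hx₀
  have hg : ContDiff ℝ ∞ (gradient f) := contDiff_iff_contDiffAt.2 fun x =>
    hf.contDiffAt.gradient_e3
  have hgx : gradient f x₀ ≠ 0 := by
    intro h
    refine hdf (ContinuousLinearMap.ext fun w => ?_)
    rw [← inner_gradient, h]; simp
  set a := ‖gradient f x₀‖ with ha
  have hapos : 0 < a := norm_pos_iff.2 hgx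
  obtain ⟨e', he'⟩ := exists_equiv_normalMap hf hdf
  have hG := contDiff_normalMap hf
  have hG' : HasFDerivAt (normalMap f) (e' : (E3 × ℝ) →L[ℝ] (E3 × ℝ)) (x₀, 0) := by
    rw [he']; exact (hG.differentiable (by simp) _).hasFDerivAt
  set e := hG.contDiffAt.toOpenPartialHomeomorph (normalMap f) hG' (by simp) with he
  have hecoe : ∀ q, e q = normalMap f q := fun q => rfl
  have hsrc : (x₀, (0 : ℝ)) ∈ e.source :=
    ContDiffAt.mem_toOpenPartialHomeomorph_source _ hG' _
  have hfx₀ : f x₀ = 0 := (frontier_iff_of_defining hΩ.isOpen hf.continuous.continuousAt hdf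
    hloc).1 hx₀
  have hval : e (x₀, 0) = (x₀, 0) := by rw [hecoe]; simp [normalMap, hfx₀]
  have htgt : (x₀, (0 : ℝ)) ∈ e.target := by
    have := e.map_source hsrc
    rwa [hval] at this
  have hsymm0 : e.symm (x₀, 0) = (x₀, 0) := by
    have := e.left_inv hsrc
    rwa [hval] at this
  -- smoothness of the local inverse
  have hemb : Filter.Tendsto (fun x : E3 => (x, (0 : ℝ))) (𝓝 x₀) (𝓝 (x₀, 0)) :=
    (Continuous.tendsto (by fun_prop) x₀)
  have hsm : ∀ᶠ x in 𝓝 x₀, ContDiffAt ℝ ∞ e.symm (x, (0 : ℝ)) := by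
    have h1 : ∀ᶠ p in 𝓝 (x₀, (0 : ℝ)), fderiv ℝ (normalMap f) (e.symm p) ∈
        range ((↑) : ((E3 × ℝ) ≃L[ℝ] (E3 × ℝ)) → ((E3 × ℝ) →L[ℝ] (E3 × ℝ))) := by
      have hc : ContinuousAt (fun p => fderiv ℝ (normalMap f) (e.symm p)) (x₀, (0 : ℝ)) :=
        ContinuousAt.comp ((hG.continuous_fderiv (by simp)).continuousAt)
          (e.continuousAt_symm htgt)
      refine hc.eventually (ContinuousLinearEquiv.isOpen.mem_nhds ?_)
      exact ⟨e', by rw [he']; simp only [hsymm0]⟩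
    filter_upwards [hemb.eventually h1, hemb.eventually (e.open_target.mem_nhds htgt)]
      with x hx hx'
    obtain ⟨e'', he''⟩ := hx
    refine e.contDiffAt_symm (f₀' := e'') hx' ?_ hG.contDiffAt
    rw [he'']
    exact (hG.differentiable (by simp) _).hasFDerivAt
  -- The candidate for the signed distance: with (y, t) the local inverse at (x, 0), the
  -- displacement x − y = t ∇f(y) has signed length t |∇f(y)|.
  set h : E3 → ℝ := fun x => (e.symm (x, 0)).2 * ‖gradient f (e.symm (x, 0)).1‖ with hh
  have hsymmc : ContinuousAt (fun x : E3 => e.symm (x, (0 : ℝ))) x₀ :=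
    ContinuousAt.comp (e.continuousAt_symm htgt) (by fun_prop)
  have hhsm : ∀ᶠ x in 𝓝 x₀, ContDiffAt ℝ ∞ h x := by
    have hne : ∀ᶠ x in 𝓝 x₀, gradient f (e.symm (x, (0 : ℝ))).1 ≠ 0 := by
      have hc : ContinuousAt (fun x : E3 => gradient f (e.symm (x, (0 : ℝ))).1) x₀ :=
        ContinuousAt.comp (g := gradient f) hg.continuous.continuousAt
          (continuousAt_fst.comp hsymmc)
      exact hc.eventually_ne (by rw [hsymm0]; exact hgx)
    filter_upwards [hsm, hne] with x hx hne
    have h1 : ContDiffAt ℝ ∞ (fun x : E3 => e.symm (x, (0 : ℝ))) x :=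
      ContDiffAt.comp x hx (by fun_prop)
    exact h1.snd.mul (ContDiffAt.norm ℝ (hg.contDiffAt.comp x h1.fst) hne)
  -- a ball in which everything is under control
  have hst : HasStrictFDerivAt f (fderiv ℝ f x₀) x₀ := hf.contDiffAt.hasStrictFDerivAt (by simp)
  have hst' : ∀ᶠ p : E3 × E3 in 𝓝 (x₀, x₀),
      ‖f p.1 - f p.2 - fderiv ℝ f x₀ (p.1 - p.2)‖ ≤ a / 4 * ‖p.1 - p.2‖ :=
    hst.isLittleO.def (by positivity)
  have hgc : ∀ᶠ y in 𝓝 x₀, ‖gradient f y - gradient f x₀‖ < a / 4 := by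
    have := hg.continuous.continuousAt.eventually (Metric.ball_mem_nhds (gradient f x₀)
      (show (0 : ℝ) < a / 4 by positivity))
    simpa [dist_eq_norm] using this
  have hdfe : ∀ᶠ y in 𝓝 x₀, fderiv ℝ f y ≠ 0 :=
    (hf.continuous_fderiv (by simp)).continuousAt.eventually_ne hdf
  have hfr : ∀ᶠ z in 𝓝 x₀, ((z ∈ frontier Ω ↔ f z = 0) ∧ (z ∈ Ω ↔ f z < 0)) := by
    filter_upwards [hdfe, eventually_eventually_nhds.2 hloc] with z hz hz'
    exact ⟨frontier_iff_of_defining hΩ.isOpen hf.continuous.continuousAt hz hz',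
      hz'.self_of_nhds⟩
  rw [nhds_prod_eq] at hst'
  have hsrc' : ∀ᶠ q : E3 × ℝ in 𝓝 x₀ ×ˢ 𝓝 (0 : ℝ), q ∈ e.source := by
    rw [← nhds_prod_eq]; exact e.open_source.mem_nhds hsrc
  rw [(Metric.nhds_basis_ball.prod_self).eventually_iff] at hst'
  rw [(Metric.nhds_basis_ball.prod Metric.nhds_basis_ball).eventually_iff] at hsrc'
  obtain ⟨r₁, hr₁, hst'⟩ := hst'
  obtain ⟨⟨r₂, r₃⟩, ⟨hr₂, hr₃⟩, hsrc'⟩ := hsrc'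
  obtain ⟨r₄, hr₄, hr₄'⟩ := Metric.eventually_nhds_iff_ball.1 ((hgc.and hdfe).and
    (eventually_eventually_nhds.2 hfr))
  set r := min r₁ (min r₂ r₄) with hr
  have hrpos : 0 < r := by positivity
  have heq : ∀ᶠ x in 𝓝 x₀, sdist Ω x = h x := by
    -- The radius r/2 keeps a closest point y within r of x₀, as |x − y| ≤ |x − x₀|. The radius r₃
    -- a/2 forces |l| < r₃ below, since (3/4) a |l| ≤ |x − y|. Thus (y, l) lies where the local
    -- inverse is valid.
    filter_upwards [Metric.ball_mem_nhds x₀ (show 0 < min (r / 2) (r₃ * (a / 2)) by positivity)]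
      with x hx
    rw [Metric.mem_ball, lt_min_iff, dist_eq_norm] at hx
    obtain ⟨y, hy, hxy⟩ := hΩ.isCompact_frontier.exists_infDist_eq_dist hΩ.isConnected.nonempty x
    have hxy' : ‖x - y‖ ≤ ‖x - x₀‖ := by
      rw [← dist_eq_norm, ← dist_eq_norm, ← hxy]; exact Metric.infDist_le_dist_of_mem hx₀
    have hyr : y ∈ Metric.ball x₀ r := by
      rw [Metric.mem_ball, dist_eq_norm]
      calc ‖y - x₀‖ = ‖(x - x₀) - (x - y)‖ := by congr 1; abel
        _ ≤ ‖x - x₀‖ + ‖x - y‖ := norm_sub_le _ _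
        _ < r := by linarith
    have hxr : x ∈ Metric.ball x₀ r := by
      rw [Metric.mem_ball, dist_eq_norm]; linarith [hx.1, norm_nonneg (x - x₀)]
    have hsub1 : Metric.ball x₀ r ⊆ Metric.ball x₀ r₁ := Metric.ball_subset_ball (min_le_left _ _)
    have hsub2 : Metric.ball x₀ r ⊆ Metric.ball x₀ r₂ := Metric.ball_subset_ball
      ((min_le_right _ _).trans (min_le_left _ _))
    have hsub4 : Metric.ball x₀ r ⊆ Metric.ball x₀ r₄ := Metric.ball_subset_ball
      ((min_le_right _ _).trans (min_le_right _ _))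
    obtain ⟨⟨hgy, hdfy⟩, hfry⟩ := hr₄' y (hsub4 hyr)
    have hxΩ := (hr₄' x (hsub4 hxr)).2.self_of_nhds.2
    have hfy : f y = 0 := hfry.self_of_nhds.1.1 hy
    obtain ⟨l, hl⟩ := exists_multiplier hf hdfy (hfry.mono fun z hz => hz.1) hy (x := x)
      (fun z hz => by
        rw [← dist_eq_norm, ← dist_eq_norm, ← hxy]; exact Metric.infDist_le_dist_of_mem hz)
    have hgylow : 3 / 4 * a ≤ ‖gradient f y‖ := by
      have := norm_sub_norm_le (gradient f x₀) (gradient f y)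
      rw [norm_sub_rev] at this
      linarith
    have hgyup : ‖gradient f y‖ ≤ 5 / 4 * a := by
      have := norm_sub_norm_le (gradient f y) (gradient f x₀)
      linarith
    have hnl : ‖x - y‖ = |l| * ‖gradient f y‖ := by rw [hl, norm_smul, Real.norm_eq_abs]
    have hlr : |l| < r₃ := by
      by_contra hcon
      push Not at hcon
      have : r₃ * (3 / 4 * a) ≤ |l| * ‖gradient f y‖ := by gcongr
      rw [← hnl] at this
      nlinarith [hx.2]
    have hmem : (y, l) ∈ e.source := by
      refine hsrc' ⟨hsub2 hyr, ?_⟩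
      simpa [Real.norm_eq_abs] using hlr
    have hes : e.symm (x, 0) = (y, l) := by
      rw [← e.left_inv hmem, hecoe]
      congr 1
      simp only [normalMap, hfy, ← hl]
      simp
    have hhx : h x = l * ‖gradient f y‖ := by simp only [hh, hes]
    -- Since f(y) = 0 and x − y = l ∇f(y), strict differentiability at x₀ compares f(x) with l
    -- ⟪∇f(x₀), ∇f(y)⟫, which decides the sign of l by the side on which x lies.
    have hfx := @hst' (x, y) ⟨hsub1 hxr, hsub1 hyr⟩
    simp only [hfy, sub_zero, Real.norm_eq_abs] at hfx
    rw [← inner_gradient, hl, real_inner_smul_right, norm_smul, Real.norm_eq_abs] at hfx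
    have hinn : 3 / 4 * a ^ 2 ≤ ⟪gradient f x₀, gradient f y⟫ := by
      have h1 : ⟪gradient f x₀, gradient f y⟫ = a ^ 2 + ⟪gradient f x₀,
        gradient f y - gradient f x₀⟫ := by
        rw [inner_sub_right, real_inner_self_eq_norm_sq]; ring
      have h2 := abs_real_inner_le_norm (gradient f x₀) (gradient f y - gradient f x₀)
      have h3 := (abs_le.1 h2).1
      rw [h1]
      nlinarith
    obtain ⟨hs1, hs2⟩ := sign_of_multiplier hapos hinn hgyup hfx
    rw [hhx]
    unfold sdist
    split_ifs with hxo
    · have hneg := hxΩ.1 hxo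
      have hl0 := hs1 hneg
      rw [hxy, dist_eq_norm, hnl, abs_of_nonpos hl0]; ring
    · have hpos : 0 ≤ f x := not_lt.1 fun hc => hxo (hxΩ.2 hc)
      have hl0 := hs2 hpos
      rw [hxy, dist_eq_norm, hnl, abs_of_nonneg hl0]
  filter_upwards [hhsm, eventually_eventually_nhds.2 heq] with x hx hx'
  exact hx.congr_of_eventuallyEq hx'

end

noncomputable section

/-! ### The closest point projection on a tubular neighbourhood -/

theorem sdist_of_mem_frontier {Ω : Set E3} {x : E3} (hx : x ∈ frontier Ω) : sdist Ω x = 0 := by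
  have := abs_sdist Ω x
  rwa [Metric.infDist_zero_of_mem hx, abs_eq_zero] at this

theorem sdist_ne_zero {Ω : Set E3} (hne : (frontier Ω).Nonempty) {x : E3} (hx : x ∉ frontier Ω) :
    sdist Ω x ≠ 0 := by
  rw [← abs_ne_zero, abs_sdist]
  exact ((isClosed_frontier.notMem_iff_infDist_pos hne).1 hx).ne'

/-- Two triangle inequalities: y itself gives the upper bound, and the remaining distance from x to
the point of the segment gives the lower one. -/
theorem infDist_segment {Ω : Set E3} {x y : E3} (hy : y ∈ frontier Ω)
    (hxy : dist x y = Metric.infDist x (frontier Ω)) {t : ℝ} (h0 : 0 ≤ t) (h1 : t ≤ 1) :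
    Metric.infDist (y + t • (x - y)) (frontier Ω) = t * Metric.infDist x (frontier Ω) := by
  have e1 : dist (y + t • (x - y)) y = t * dist x y := by
    rw [dist_eq_norm, dist_eq_norm, add_sub_cancel_left, norm_smul, Real.norm_eq_abs,
      abs_of_nonneg h0]
  have e2 : dist x (y + t • (x - y)) = (1 - t) * dist x y := by
    have : x - (y + t • (x - y)) = (1 - t) • (x - y) := by module
    rw [dist_eq_norm, dist_eq_norm, this, norm_smul, Real.norm_eq_abs,
      abs_of_nonneg (sub_nonneg.2 h1)]
  have h2 := Metric.infDist_le_dist_of_mem (x := y + t • (x - y)) hy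
  have h3 := Metric.infDist_le_infDist_add_dist (s := frontier Ω) (x := x)
    (y := y + t • (x - y))
  rw [e1] at h2
  rw [e2] at h3
  rw [hxy] at h2 h3
  linarith

/-- The signed distance is linear on the segment from the closest point. -/
theorem sdist_segment {Ω : Set E3} (hΩ : IsOpen Ω) {x y : E3} (hx : x ∉ frontier Ω)
    (hy : y ∈ frontier Ω) (hxy : dist x y = Metric.infDist x (frontier Ω)) {t : ℝ} (h0 : 0 < t)
    (h1 : t ≤ 1) : sdist Ω (y + t • (x - y)) = t * sdist Ω x := by
  have hpos : 0 < Metric.infDist x (frontier Ω) :=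
    (isClosed_frontier.notMem_iff_infDist_pos ⟨y, hy⟩).1 hx
  set S : Set E3 := (fun s : ℝ => y + s • (x - y)) '' Icc t 1 with hS
  have hpre : IsPreconnected S := (isPreconnected_Icc).image _ (by fun_prop)
  have hxS : x ∈ S := ⟨1, ⟨h1, le_rfl⟩, by simp⟩
  have hzS : y + t • (x - y) ∈ S := ⟨t, ⟨le_rfl, h1⟩, rfl⟩
  -- The distance to γ is positive on this part of the segment, so a connected set that avoids γ
  -- stays on one side of it.
  have hnf : closure Ω ∩ S ⊆ Ω := by
    rintro z ⟨hz, s, ⟨hs1, hs2⟩, rfl⟩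
    by_contra hcon
    have hf : y + s • (x - y) ∈ frontier Ω := by rw [hΩ.frontier_eq]; exact ⟨hz, hcon⟩
    have h2 := infDist_segment hy hxy (h0.le.trans hs1) hs2
    rw [Metric.infDist_zero_of_mem hf] at h2
    have : 0 < s * Metric.infDist x (frontier Ω) := mul_pos (h0.trans_le hs1) hpos
    linarith
  have hside : y + t • (x - y) ∈ Ω ↔ x ∈ Ω :=
    ⟨fun h => hpre.subset_of_closure_inter_subset hΩ ⟨_, hzS, h⟩ hnf hxS,
      fun h => hpre.subset_of_closure_inter_subset hΩ ⟨_, hxS, h⟩ hnf hzS⟩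
  unfold sdist
  rw [infDist_segment hy hxy h0.le h1]
  by_cases hxo : x ∈ Ω
  · rw [if_pos (hside.2 hxo), if_pos hxo]; ring
  · rw [if_neg (mt hside.1 hxo), if_neg hxo]

/-- Off γ the sign is locally constant, so the signed distance inherits the Lipschitz constant 1 of
the distance. -/
theorem norm_nu_le {Ω : Set E3} (hΩ : IsOpen Ω) {x : E3} (hx : x ∉ frontier Ω) : ‖nu Ω x‖ ≤ 1 := by
  have hlip : ∀ᶠ z in 𝓝 x, ‖sdist Ω z - sdist Ω x‖ ≤ 1 * ‖z - x‖ := by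
    have hI : ∀ z : E3, |Metric.infDist z (frontier Ω) - Metric.infDist x (frontier Ω)| ≤ ‖z - x‖ := by
      intro z
      have := (Metric.lipschitz_infDist_pt (frontier Ω)).dist_le_mul z x
      simpa [dist_eq_norm] using this
    by_cases hxΩ : x ∈ Ω
    · filter_upwards [hΩ.mem_nhds hxΩ] with z hz
      simp only [sdist, hz, hxΩ, if_true, Real.norm_eq_abs, one_mul]
      rw [← abs_neg]
      convert hI z using 2
      ring
    · have hxc : x ∉ closure Ω := fun h => hx (by rw [hΩ.frontier_eq]; exact ⟨h, hxΩ⟩)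
      filter_upwards [isClosed_closure.isOpen_compl.mem_nhds hxc] with z hz
      have hz' : z ∉ Ω := fun h => hz (subset_closure h)
      simp only [sdist, hz', hxΩ, if_false, Real.norm_eq_abs, one_mul]
      exact hI z
  have h := norm_fderiv_le_of_lip' ℝ (by norm_num) hlip
  unfold nu gradient
  rwa [LinearIsometryEquiv.norm_map]

/-- The eikonal equation, and the closest point in terms of the gradient of the distance. -/
theorem sub_eq_sdist_smul_nu {Ω : Set E3} (hΩ : IsOpen Ω) {x y : E3} (hx : x ∉ frontier Ω)
    (hy : y ∈ frontier Ω) (hxy : dist x y = Metric.infDist x (frontier Ω))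
    (hd : DifferentiableAt ℝ (sdist Ω) x) : x - y = sdist Ω x • nu Ω x ∧ ‖nu Ω x‖ = 1 := by
  -- The derivative of d along the segment is computed by the chain rule and by linearity on the
  -- segment. Linearity is known only for t ≤ 1, hence the one-sided derivative in `h2`.
  have h1 : HasDerivAt (fun t : ℝ => sdist Ω (y + t • (x - y))) (⟪nu Ω x, x - y⟫) 1 := by
    have hl : HasDerivAt (fun t : ℝ => y + t • (x - y)) (x - y) 1 := by
      simpa using ((hasDerivAt_id (1 : ℝ)).smul_const (x - y)).const_add y
    have hd' : HasFDerivAt (sdist Ω) (fderiv ℝ (sdist Ω) x) (y + (1 : ℝ) • (x - y)) := by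
      simpa using hd.hasFDerivAt
    have := hd'.comp_hasDerivAt (1 : ℝ) hl
    unfold nu
    rwa [inner_gradient]
  have h2 : HasDerivWithinAt (fun t : ℝ => sdist Ω (y + t • (x - y))) (sdist Ω x) (Iic 1) 1 := by
    have hl : HasDerivWithinAt (fun t : ℝ => t * sdist Ω x) (sdist Ω x) (Iic 1) 1 := by
      simpa using ((hasDerivAt_id (1 : ℝ)).mul_const (sdist Ω x)).hasDerivWithinAt
    refine hl.congr_of_eventuallyEq ?_ (sdist_segment hΩ hx hy hxy one_pos le_rfl)
    have : ∀ᶠ t : ℝ in 𝓝[Iic 1] 1, 0 < t := nhdsWithin_le_nhds (lt_mem_nhds one_pos)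
    filter_upwards [this, self_mem_nhdsWithin] with t ht ht'
    exact sdist_segment hΩ hx hy hxy ht ht'
  have h3 : ⟪nu Ω x, x - y⟫ = sdist Ω x :=
    (uniqueDiffWithinAt_Iic (1 : ℝ)).eq_deriv _ h1.hasDerivWithinAt h2
  have h4 : ‖x - y‖ ^ 2 = sdist Ω x ^ 2 := by
    rw [← dist_eq_norm, hxy, ← abs_sdist, sq_abs]
  have h5 := norm_nu_le hΩ hx
  -- Expanding the square, |x − y − d ν|² = d² (|ν|² − 1) ≤ 0.
  have h6 : x - y = sdist Ω x • nu Ω x := by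
    rw [← sub_eq_zero, ← norm_eq_zero, ← sq_eq_zero_iff]
    refine le_antisymm ?_ (sq_nonneg _)
    rw [norm_sub_sq_real, real_inner_smul_right, real_inner_comm, h3, h4, norm_smul,
      Real.norm_eq_abs, mul_pow, sq_abs]
    nlinarith [sq_nonneg (sdist Ω x), norm_nonneg (nu Ω x), mul_nonneg (sq_nonneg (sdist Ω x))
      (show 0 ≤ 1 - ‖nu Ω x‖ ^ 2 by nlinarith [norm_nonneg (nu Ω x)])]
  refine ⟨h6, ?_⟩
  have h7 : sdist Ω x ≠ 0 := sdist_ne_zero ⟨y, hy⟩ hx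
  rw [h6, norm_smul, mul_pow, Real.norm_eq_abs, sq_abs] at h4
  have h8 : ‖nu Ω x‖ ^ 2 = 1 := mul_left_cancel₀ (pow_ne_zero 2 h7) (by rw [h4, mul_one])
  nlinarith [norm_nonneg (nu Ω x)]

theorem proj_of_mem_frontier {Ω : Set E3} {x : E3} (hx : x ∈ frontier Ω) : proj Ω x = x := by
  simp [proj, sdist_of_mem_frontier hx]

theorem eq_proj_of_closest {Ω : Set E3} (hΩ : IsOpen Ω) {x y : E3} (hy : y ∈ frontier Ω)
    (hxy : dist x y = Metric.infDist x (frontier Ω)) (hd : DifferentiableAt ℝ (sdist Ω) x) :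
    y = proj Ω x := by
  by_cases hx : x ∈ frontier Ω
  · rw [Metric.infDist_zero_of_mem hx, dist_eq_zero] at hxy
    rw [proj_of_mem_frontier hx, hxy]
  · rw [proj, ← (sub_eq_sdist_smul_nu hΩ hx hy hxy hd).1, sub_sub_cancel]

/-- An open neighbourhood of the surface on which the signed distance function is smooth and has
its characteristic properties. -/
structure TubeNbhd (Ω N : Set E3) : Prop where
  isOpen : IsOpen N
  frontier_subset : frontier Ω ⊆ N
  smooth : ∀ x ∈ N, ContDiffAt ℝ ∞ (sdist Ω) x
  norm_nu : ∀ x ∈ N, ‖nu Ω x‖ = 1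
  proj_mem : ∀ x ∈ N, proj Ω x ∈ frontier Ω
  dist_proj : ∀ x ∈ N, dist x (proj Ω x) = Metric.infDist x (frontier Ω)
  unique : ∀ x ∈ N, ∀ y ∈ frontier Ω,
    dist x y = Metric.infDist x (frontier Ω) → y = proj Ω x
  nu_proj : ∀ x ∈ N, nu Ω (proj Ω x) = nu Ω x

/-- Smoothness of d alone forces the rest: off γ, following d along the segment to a closest point
gives the eikonal equation and uniqueness of that point; continuity of ν carries the statements to
γ. -/
theorem tubeNbhd_thickening {Ω : Set E3} (hΩ : BoundsSmoothSurface Ω) {δ : ℝ} (hδ : 0 < δ)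
    (hs : ∀ x ∈ Metric.thickening δ (frontier Ω), ContDiffAt ℝ ∞ (sdist Ω) x) :
    TubeNbhd Ω (Metric.thickening δ (frontier Ω)) := by
  have hne := hΩ.isConnected.nonempty
  have hsub : frontier Ω ⊆ Metric.thickening δ (frontier Ω) := Metric.self_subset_thickening hδ _
  have hdiff : ∀ x ∈ Metric.thickening δ (frontier Ω), DifferentiableAt ℝ (sdist Ω) x :=
    fun x hx => (hs x hx).differentiableAt (by simp)
  have hcont : ∀ x ∈ Metric.thickening δ (frontier Ω), ContinuousAt (nu Ω) x :=
    fun x hx => (hs x hx).gradient_e3.continuousAt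
  have hclosest : ∀ x, ∃ y ∈ frontier Ω, dist x y = Metric.infDist x (frontier Ω) := fun x => by
    obtain ⟨y, hy, hxy⟩ := hΩ.isCompact_frontier.exists_infDist_eq_dist hne x
    exact ⟨y, hy, hxy.symm⟩
  have hnorm' : ∀ x ∈ Metric.thickening δ (frontier Ω), x ∉ frontier Ω → ‖nu Ω x‖ = 1 := by
    intro x hx hxf
    obtain ⟨y, hy, hxy⟩ := hclosest x
    exact (sub_eq_sdist_smul_nu hΩ.isOpen hxf hy hxy (hdiff x hx)).2
  refine ⟨Metric.isOpen_thickening, hsub, hs, ?_, ?_, ?_, ?_, ?_⟩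
  · intro x hx
    by_cases hxf : x ∈ frontier Ω
    -- A point of γ is a limit of points of Ω in the tube, where |ν| = 1 is already known.
    · have hcl : x ∈ closure (Metric.thickening δ (frontier Ω) ∩ Ω) :=
        Metric.isOpen_thickening.inter_closure ⟨hx, frontier_subset_closure hxf⟩
      have hfr : ∃ᶠ z in 𝓝 x, ‖nu Ω z‖ = 1 := by
        refine (mem_closure_iff_frequently.1 hcl).mono fun z hz => hnorm' z hz.1 fun hzf => ?_
        rw [hΩ.isOpen.frontier_eq] at hzf
        exact hzf.2 hz.2
      by_contra hcon
      exact hfr ((hcont x hx).norm.eventually_ne hcon)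
    · exact hnorm' x hx hxf
  · intro x hx
    obtain ⟨y, hy, hxy⟩ := hclosest x
    rwa [← eq_proj_of_closest hΩ.isOpen hy hxy (hdiff x hx)]
  · intro x hx
    obtain ⟨y, hy, hxy⟩ := hclosest x
    rwa [← eq_proj_of_closest hΩ.isOpen hy hxy (hdiff x hx)]
  · intro x hx y hy hxy
    exact eq_proj_of_closest hΩ.isOpen hy hxy (hdiff x hx)
  · intro x hx
    by_cases hxf : x ∈ frontier Ω
    · rw [proj_of_mem_frontier hxf]
    obtain ⟨y, hy, hxy⟩ := hclosest x
    rw [← eq_proj_of_closest hΩ.isOpen hy hxy (hdiff x hx)]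
    -- All points of the half-open segment from y (excluded) to x have closest point y, so ν has the
    -- same direction and sign there. Letting t tend to 0 gives the value at y.
    have hconst : ∀ t : ℝ, 0 < t → t ≤ 1 → nu Ω (y + t • (x - y)) = nu Ω x := by
      intro t h0 h1
      have hI := infDist_segment hy hxy h0.le h1
      have hsd := sdist_segment hΩ.isOpen hxf hy hxy h0 h1
      have hd0 := sdist_ne_zero hne hxf
      have hz : y + t • (x - y) ∈ Metric.thickening δ (frontier Ω) := by
        rw [Metric.mem_thickening_iff_infDist_lt hne] at hx ⊢
        rw [hI]
        nlinarith [Metric.infDist_nonneg (x := x) (s := frontier Ω)]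
      have hzf : y + t • (x - y) ∉ frontier Ω := fun h => by
        rw [sdist_of_mem_frontier h] at hsd
        exact mul_ne_zero h0.ne' hd0 hsd.symm
      have hzy : dist (y + t • (x - y)) y = Metric.infDist (y + t • (x - y)) (frontier Ω) := by
        rw [hI, ← hxy, dist_eq_norm, dist_eq_norm, add_sub_cancel_left, norm_smul,
          Real.norm_eq_abs, abs_of_pos h0]
      have e1 := (sub_eq_sdist_smul_nu hΩ.isOpen hzf hy hzy (hdiff _ hz)).1
      have e2 := (sub_eq_sdist_smul_nu hΩ.isOpen hxf hy hxy (hdiff _ hx)).1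
      rw [add_sub_cancel_left, hsd, mul_smul] at e1
      have e3 := smul_right_injective _ h0.ne' e1
      rw [e2] at e3
      have e4 := smul_right_injective _ hd0 e3
      rw [e4, e2]
    have hlim : Filter.Tendsto (fun t : ℝ => nu Ω (y + t • (x - y))) (𝓝[>] 0) (𝓝 (nu Ω y)) := by
      have h1 : ContinuousAt (fun t : ℝ => y + t • (x - y)) 0 := by fun_prop
      have h2 : ContinuousAt (nu Ω) (y + (0 : ℝ) • (x - y)) := by
        simpa using hcont y (hsub hy)
      have h3 : ContinuousAt (fun t : ℝ => nu Ω (y + t • (x - y))) 0 :=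
        ContinuousAt.comp (g := nu Ω) h2 h1
      have h4 := h3.tendsto
      simp only [zero_smul, add_zero] at h4
      exact h4.mono_left nhdsWithin_le_nhds
    have hlim2 : Filter.Tendsto (fun t : ℝ => nu Ω (y + t • (x - y))) (𝓝[>] 0) (𝓝 (nu Ω x)) := by
      refine tendsto_const_nhds.congr' ?_
      filter_upwards [Ioc_mem_nhdsGT (show (0 : ℝ) < 1 by norm_num)] with t ht
      exact (hconst t ht.1 ht.2).symm
    exact tendsto_nhds_unique hlim hlim2

/-! ### Derivatives of the normal field and of the closest point projection -/

namespace TubeNbhd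

variable {Ω N : Set E3} (hN : TubeNbhd Ω N) {x : E3}
include hN

theorem mono_tube {δ : ℝ} (hδ : 0 < δ) (h : tube Ω δ ⊆ N) : IsTubularWidth Ω δ where
  pos := hδ
  smooth x hx := hN.smooth x (h hx)
  proj_mem x hx := hN.proj_mem x (h hx)
  dist_proj x hx := hN.dist_proj x (h hx)
  unique x hx := hN.unique x (h hx)

theorem contDiffAt_nu (hx : x ∈ N) : ContDiffAt ℝ ∞ (nu Ω) x := (hN.smooth x hx).gradient_e3

theorem contDiffAt_proj (hx : x ∈ N) : ContDiffAt ℝ ∞ (proj Ω) x :=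
  contDiffAt_id.sub ((hN.smooth x hx).smul (hN.contDiffAt_nu hx))

theorem mem_nhds (hx : x ∈ N) : ∀ᶠ z in 𝓝 x, z ∈ N := hN.isOpen.mem_nhds hx

theorem hasFDerivAt_nu (hx : x ∈ N) : HasFDerivAt (nu Ω) (fderiv ℝ (nu Ω) x) x :=
  ((hN.contDiffAt_nu hx).differentiableAt (by simp)).hasFDerivAt

theorem hasFDerivAt_sdist (hx : x ∈ N) : HasFDerivAt (sdist Ω) (innerSL ℝ (nu Ω x)) x := by
  have h := ((hN.smooth x hx).differentiableAt (by simp)).hasFDerivAt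
  have e : innerSL ℝ (nu Ω x) = fderiv ℝ (sdist Ω) x :=
    ContinuousLinearMap.ext fun w => inner_gradient _ _ _
  rwa [e]

/-- Differentiate |ν|² = 1. -/
theorem inner_nu_fderiv_nu (hx : x ∈ N) (w : E3) : ⟪nu Ω x, fderiv ℝ (nu Ω) x w⟫ = 0 := by
  have h1 : HasFDerivAt (fun z => ‖nu Ω z‖ ^ 2) _ x := (hN.hasFDerivAt_nu hx).norm_sq
  have h2 : HasFDerivAt (fun z => ‖nu Ω z‖ ^ 2) (0 : E3 →L[ℝ] ℝ) x := by
    refine (hasFDerivAt_const (1 : ℝ) x).congr_of_eventuallyEq ?_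
    filter_upwards [hN.mem_nhds hx] with z hz
    rw [hN.norm_nu z hz, one_pow]
  have := congrArg (fun L => L w) (h1.unique h2)
  simpa using this

/-- Dν is the Hessian of d. -/
theorem fderiv_nu_symm (hx : x ∈ N) (a b : E3) :
    ⟪fderiv ℝ (nu Ω) x a, b⟫ = ⟪a, fderiv ℝ (nu Ω) x b⟫ := by
  have hsymm : IsSymmSndFDerivAt ℝ (sdist Ω) x := (hN.smooth x hx).isSymmSndFDerivAt (by
    rw [minSmoothness_of_isRCLikeNormedField]
    exact WithTop.coe_le_coe.2 (le_top : (2 : ℕ∞) ≤ ⊤))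
  have key : ∀ a b : E3, fderiv ℝ (fderiv ℝ (sdist Ω)) x a b = ⟪fderiv ℝ (nu Ω) x a, b⟫ := by
    intro a b
    have h1 : HasFDerivAt (fun z => fderiv ℝ (sdist Ω) z b)
        ((ContinuousLinearMap.apply ℝ ℝ b).comp (fderiv ℝ (fderiv ℝ (sdist Ω)) x)) x := by
      have hd : DifferentiableAt ℝ (fderiv ℝ (sdist Ω)) x :=
        ((hN.smooth x hx).fderiv_right (m := 1) (by norm_cast)).differentiableAt (by simp)
      exact (ContinuousLinearMap.apply ℝ ℝ b).hasFDerivAt.comp x hd.hasFDerivAt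
    have h2 : HasFDerivAt (fun z => ⟪nu Ω z, b⟫)
        ((innerSL ℝ b).comp (fderiv ℝ (nu Ω) x)) x := by
      have := (innerSL ℝ b).hasFDerivAt.comp x (hN.hasFDerivAt_nu hx)
      refine this.congr_of_eventuallyEq (Filter.Eventually.of_forall fun z => ?_)
      simp [real_inner_comm]
    have e : (fun z => fderiv ℝ (sdist Ω) z b) = fun z => ⟪nu Ω z, b⟫ := by
      ext z; exact (inner_gradient _ _ _).symm
    rw [e] at h1
    have := congrArg (fun L => L a) (h1.unique h2)
    simp only [ContinuousLinearMap.comp_apply, ContinuousLinearMap.apply_apply,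
      innerSL_apply_apply] at this
    rw [this, real_inner_comm]
  rw [← key, hsymm.eq a b, key, real_inner_comm]

theorem fderiv_nu_nu (hx : x ∈ N) : fderiv ℝ (nu Ω) x (nu Ω x) = 0 :=
  ext_inner_right ℝ fun w => by
    rw [hN.fderiv_nu_symm hx, hN.inner_nu_fderiv_nu hx, inner_zero_left]

theorem hasFDerivAt_proj (hx : x ∈ N) : HasFDerivAt (proj Ω)
    (ContinuousLinearMap.id ℝ E3 - (sdist Ω x • fderiv ℝ (nu Ω) x +
      (innerSL ℝ (nu Ω x)).smulRight (nu Ω x))) x :=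
  (hasFDerivAt_id x).sub ((hN.hasFDerivAt_sdist hx).smul (hN.hasFDerivAt_nu hx))

theorem fderiv_proj_apply (hx : x ∈ N) (w : E3) : fderiv ℝ (proj Ω) x w =
    tangProj (nu Ω x) w - sdist Ω x • fderiv ℝ (nu Ω) x w := by
  rw [(hN.hasFDerivAt_proj hx).fderiv, tangProj_apply]
  simp
  abel

theorem inner_nu_fderiv_proj (hx : x ∈ N) (w : E3) : ⟪nu Ω x, fderiv ℝ (proj Ω) x w⟫ = 0 := by
  rw [hN.fderiv_proj_apply hx, inner_sub_right, inner_tangProj (hN.norm_nu x hx),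
    real_inner_smul_right, hN.inner_nu_fderiv_nu hx]
  ring

end TubeNbhd

/-! ### The endomorphism I − d H and the choice of the tube -/

/-- The endomorphism `I - d H`. -/
def shapeMap (Ω : Set E3) (x : E3) : Mat3 :=
  ContinuousLinearMap.id ℝ E3 - sdist Ω x • fderiv ℝ (nu Ω) x

/-- The determinant of `I - d H`. -/
def shapeDet (Ω : Set E3) (x : E3) : ℝ :=
  tri (shapeMap Ω x (EuclideanSpace.single 0 1)) (shapeMap Ω x (EuclideanSpace.single 1 1))
    (shapeMap Ω x (EuclideanSpace.single 2 1))

theorem tri_basis : tri (EuclideanSpace.single 0 1) (EuclideanSpace.single 1 1)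
    (EuclideanSpace.single 2 1) = 1 := by
  simp [tri_eq]

theorem tri_shapeMap (Ω : Set E3) (x a b c : E3) : tri (shapeMap Ω x a) (shapeMap Ω x b)
    (shapeMap Ω x c) = shapeDet Ω x * tri a b c := by
  have := tri_map_scale (shapeMap Ω x) a b c (EuclideanSpace.single 0 1)
    (EuclideanSpace.single 1 1) (EuclideanSpace.single 2 1)
  rwa [tri_basis, mul_one] at this

theorem contDiffAt_tri {f g h : E3 → E3} {x : E3} {n : WithTop ℕ∞} (hf : ContDiffAt ℝ n f x)
    (hg : ContDiffAt ℝ n g x) (hh : ContDiffAt ℝ n h x) :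
    ContDiffAt ℝ n (fun z => tri (f z) (g z) (h z)) x := by
  have : ContDiffAt ℝ n (fun z => crL (f z) (g z)) x :=
    (crL.contDiff.contDiffAt.comp x hf).clm_apply hg
  exact this.inner ℝ hh

theorem TubeNbhd.contDiffAt_fderiv_nu {Ω N : Set E3} (hN : TubeNbhd Ω N) {x : E3} (hx : x ∈ N) :
    ContDiffAt ℝ ∞ (fderiv ℝ (nu Ω)) x :=
  (hN.contDiffAt_nu hx).fderiv_right (m := ∞) (by simp)

theorem TubeNbhd.contDiffAt_fderiv_proj {Ω N : Set E3} (hN : TubeNbhd Ω N) {x : E3} (hx : x ∈ N) :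
    ContDiffAt ℝ ∞ (fderiv ℝ (proj Ω)) x :=
  (hN.contDiffAt_proj hx).fderiv_right (m := ∞) (by simp)

theorem TubeNbhd.contDiffAt_shapeMap {Ω N : Set E3} (hN : TubeNbhd Ω N) {x : E3} (hx : x ∈ N) :
    ContDiffAt ℝ ∞ (shapeMap Ω) x :=
  contDiffAt_const.sub ((hN.smooth x hx).smul (hN.contDiffAt_fderiv_nu hx))

theorem TubeNbhd.contDiffAt_shapeDet {Ω N : Set E3} (hN : TubeNbhd Ω N) {x : E3} (hx : x ∈ N) :
    ContDiffAt ℝ ∞ (shapeDet Ω) x :=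
  contDiffAt_tri ((hN.contDiffAt_shapeMap hx).clm_apply contDiffAt_const)
    ((hN.contDiffAt_shapeMap hx).clm_apply contDiffAt_const)
    ((hN.contDiffAt_shapeMap hx).clm_apply contDiffAt_const)

/-- The surface has an open tubular neighbourhood in which `det (I - d H) > 1/2`. -/
theorem exists_tubeNbhd {Ω : Set E3} (hΩ : BoundsSmoothSurface Ω) :
    ∃ N δ, TubeNbhd Ω N ∧ 0 < δ ∧ tube Ω δ ⊆ N ∧ ∀ x ∈ N, 1 / 2 < shapeDet Ω x := by
  have hne := hΩ.isConnected.nonempty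
  have hO : IsOpen {x | ∀ᶠ z in 𝓝 x, ContDiffAt ℝ ∞ (sdist Ω) z} := isOpen_setOfPred_eventually_nhds
  obtain ⟨δ₀, hδ₀, hsub₀⟩ := hΩ.isCompact_frontier.exists_thickening_subset_open hO
    fun x hx => eventually_contDiffAt_sdist hΩ hx
  have hN₀ := tubeNbhd_thickening hΩ hδ₀ fun x hx => (hsub₀ hx).self_of_nhds
  have hO' : IsOpen (Metric.thickening δ₀ (frontier Ω) ∩ shapeDet Ω ⁻¹' (Ioi (1 / 2))) :=
    ContinuousOn.isOpen_inter_preimage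
      (fun x hx => (hN₀.contDiffAt_shapeDet hx).continuousAt.continuousWithinAt) hN₀.isOpen isOpen_Ioi
  obtain ⟨δ₁, hδ₁, hsub₁⟩ := hΩ.isCompact_frontier.exists_thickening_subset_open hO' (by
    -- On γ one has d = 0, so I − d H is the identity and its determinant is 1.
    intro x hx
    refine ⟨hN₀.frontier_subset hx, ?_⟩
    have : shapeMap Ω x = ContinuousLinearMap.id ℝ E3 := by
      ext1 w
      rw [shapeMap, sdist_of_mem_frontier hx, sub_apply, smul_apply, zero_smul, sub_zero]
    rw [mem_preimage, shapeDet, this]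
    simp only [ContinuousLinearMap.id_apply, tri_basis]
    norm_num)
  -- Halving the width puts the closed tube inside the open thickening.
  refine ⟨_, δ₁ / 2, tubeNbhd_thickening hΩ hδ₁ fun x hx => hN₀.smooth x (hsub₁ hx).1,
    half_pos hδ₁, ?_, fun x hx => (hsub₁ hx).2⟩
  intro x hx
  rw [Metric.mem_thickening_iff_infDist_lt hne]
  exact lt_of_le_of_lt hx (half_lt_self hδ₁)

theorem isCompact_tube {Ω : Set E3} (hΩ : BoundsSmoothSurface Ω) (δ : ℝ) : IsCompact (tube Ω δ) := by
  refine Metric.isCompact_of_isClosed_isBounded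
    (isClosed_le (Metric.continuous_infDist_pt _) continuous_const) ?_
  refine (hΩ.isCompact_frontier.isBounded.thickening (δ := δ + 1)).subset fun x hx => ?_
  rw [Metric.mem_thickening_iff_infDist_lt hΩ.isConnected.nonempty]
  exact lt_of_le_of_lt hx (lt_add_one _)

end

noncomputable section

/-! ### The area formula for parametrized surfaces -/

/-- The Euclidean plane. -/
abbrev E2 : Type := EuclideanSpace ℝ (Fin 2)

/-- The standard basis of the plane. -/
def bas (i : Fin 2) : E2 := EuclideanSpace.single i 1

theorem LipschitzOnWith.euclideanHausdorffMeasure_image_le {X Y : Type*} [MetricSpace X]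
    [MeasurableSpace X] [BorelSpace X] [MetricSpace Y] [MeasurableSpace Y] [BorelSpace Y]
    {K : NNReal} {f : X → Y} {s : Set X} (h : LipschitzOnWith K f s) (d : ℕ) :
    μHE[d] (f '' s) ≤ (K : ENNReal) ^ d * μHE[d] s := by
  simp_rw [Measure.euclideanHausdorffMeasure_def, Measure.smul_apply, ENNReal.smul_def, smul_eq_mul]
  have := h.hausdorffMeasure_image_le (d := d) (by positivity)
  rw [ENNReal.rpow_natCast] at this
  calc _ ≤ _ * ((K : ENNReal) ^ d * μH[d] s) := by gcongr
    _ = _ := by ring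

/-- Coordinates in the plane spanned by two vectors. -/
def planeCoord (f₁ f₂ : E3) : E3 →L[ℝ] E2 :=
  (innerSL ℝ f₁).smulRight (bas 0) + (innerSL ℝ f₂).smulRight (bas 1)

theorem planeCoord_apply_zero (f₁ f₂ y : E3) : planeCoord f₁ f₂ y 0 = ⟪f₁, y⟫ := by
  simp [planeCoord, bas]

theorem planeCoord_apply_one (f₁ f₂ y : E3) : planeCoord f₁ f₂ y 1 = ⟪f₂, y⟫ := by
  simp [planeCoord, bas]

theorem norm_sq_planeCoord (f₁ f₂ y : E3) :
    ‖planeCoord f₁ f₂ y‖ ^ 2 = ⟪f₁, y⟫ ^ 2 + ⟪f₂, y⟫ ^ 2 := by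
  rw [EuclideanSpace.norm_sq_eq, Fin.sum_univ_two, planeCoord_apply_zero, planeCoord_apply_one]
  simp

theorem IsFrame.norm_planeCoord_le {f₁ f₂ n : E3} (hf : IsFrame f₁ f₂ n) (y : E3) :
    ‖planeCoord f₁ f₂ y‖ ≤ ‖y‖ := by
  refine abs_le_of_sq_le_sq' ?_ (by positivity) |>.2
  rw [norm_sq_planeCoord, hf.norm_sq y]
  nlinarith [sq_nonneg ⟪n, y⟫]

theorem IsFrame.norm_le_planeCoord {f₁ f₂ n : E3} (hf : IsFrame f₁ f₂ n) (y : E3) :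
    ‖y‖ ≤ ‖planeCoord f₁ f₂ y‖ + |⟪n, y⟫| := by
  refine abs_le_of_sq_le_sq' ?_ (by positivity) |>.2
  rw [hf.norm_sq y, add_sq, norm_sq_planeCoord, sq_abs]
  have : 0 ≤ 2 * ‖planeCoord f₁ f₂ y‖ * |⟪n, y⟫| := by positivity
  linarith

/-- The identity ⟪f₁, a⟫⟪f₂, b⟫ − ⟪f₁, b⟫⟪f₂, a⟫ = ⟪a×b, f₁×f₂⟫ with f₁×f₂ = n. -/
theorem IsFrame.det_planeCoord {f₁ f₂ n : E3} (hf : IsFrame f₁ f₂ n) (L : E2 →L[ℝ] E3) :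
    (planeCoord f₁ f₂ ∘L L).det = tri (L (bas 0)) (L (bas 1)) n := by
  rw [ContinuousLinearMap.det, ← LinearMap.det_toMatrix (EuclideanSpace.basisFun (Fin 2) ℝ).toBasis,
    Matrix.det_fin_two]
  simp only [LinearMap.toMatrix_apply]
  simp only [OrthonormalBasis.coe_toBasis, OrthonormalBasis.coe_toBasis_repr_apply,
    EuclideanSpace.basisFun_apply, EuclideanSpace.basisFun_repr, ContinuousLinearMap.coe_coe,
    ContinuousLinearMap.comp_apply, planeCoord_apply_zero, planeCoord_apply_one]
  rw [← bas, ← bas, ← hf.cr_eq]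
  simp only [inner_e3, tri_eq, cr_zero_coord, cr_one_coord, cr_two_coord]
  ring

/-- Near a point the surface is almost isometric to its projection to the tangent plane. -/
theorem eventually_norm_le_planeCoord {X : E2 → E3} {s₀ : E2} {f₁ f₂ n : E3} (hf : IsFrame f₁ f₂ n)
    {L : E2 →L[ℝ] E3} (hX : HasStrictFDerivAt X L s₀) (horth : ∀ u, ⟪n, L u⟫ = 0)
    (hJ : tri (L (bas 0)) (L (bas 1)) n ≠ 0) {K : ℝ} (hK : 1 < K) :
    ∃ V, IsOpen V ∧ s₀ ∈ V ∧ ∀ s ∈ V, ∀ s' ∈ V,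
      ‖X s - X s'‖ ≤ K * ‖planeCoord f₁ f₂ (X s - X s')‖ := by
  have hinj : Function.Injective L := by
    have hdet : (planeCoord f₁ f₂ ∘L L).det ≠ 0 := by rwa [hf.det_planeCoord]
    have h1 : Function.Injective (planeCoord f₁ f₂ ∘L L) :=
      (LinearMap.equivOfDetNeZero (planeCoord f₁ f₂ ∘L L).toLinearMap hdet).injective
    exact fun a b hab => h1 (by simp [hab])
  obtain ⟨c, hc, hanti⟩ := L.toLinearMap.exists_antilipschitzWith (LinearMap.ker_eq_bot.2 hinj)
  have hlow : ∀ u, ‖u‖ ≤ c * ‖L u‖ := fun u => by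
    simpa [dist_eq_norm] using hanti.le_mul_dist u 0
  have hc' : (0 : ℝ) < c := hc
  -- The aim is |Δ| ≤ |PΔ| + ε |Δ|, which is the claim because 1 − ε = 1/K. The normal part of Δ
  -- comes only from the linearization error, at most η |s − s'|. The choice η c (1 + ε) = ε bounds
  -- that error by ε |Δ|.
  set ε : ℝ := 1 - 1 / K with hε
  have hε0 : 0 < ε := by
    have : 1 / K < 1 := by rw [div_lt_one (by linarith)]; exact hK
    linarith
  set η : ℝ := ε / (c * (1 + ε)) with hη
  have hη0 : 0 < η := by positivity
  have hst : ∀ᶠ p : E2 × E2 in 𝓝 (s₀, s₀), ‖X p.1 - X p.2 - L (p.1 - p.2)‖ ≤ η * ‖p.1 - p.2‖ :=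
    hX.isLittleO.def hη0
  rw [nhds_prod_eq, (nhds_basis_opens s₀).prod_self.eventually_iff] at hst
  obtain ⟨V, ⟨hsV, hV⟩, hst⟩ := hst
  refine ⟨V, hV, hsV, fun s hs s' hs' => ?_⟩
  have h1 := @hst (s, s') ⟨hs, hs'⟩
  simp only at h1
  set Δ := X s - X s' with hΔ
  have h2 := hlow (s - s')
  have h3 : ‖L (s - s')‖ ≤ ‖Δ‖ + ‖Δ - L (s - s')‖ := by
    have := norm_sub_le Δ (Δ - L (s - s'))
    rwa [sub_sub_cancel] at this
  have h4 : |⟪n, Δ⟫| ≤ ‖Δ - L (s - s')‖ := by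
    have : ⟪n, Δ⟫ = ⟪n, Δ - L (s - s')⟫ := by
      rw [inner_sub_right n Δ, horth, sub_zero]
    rw [this]
    simpa [hf.n3] using abs_real_inner_le_norm n (Δ - L (s - s'))
  have h5 := hf.norm_le_planeCoord Δ
  set u := ‖s - s'‖
  set D := ‖Δ‖
  set q := ‖Δ - L (s - s')‖
  have h6 : u ≤ c * (D + η * u) := h2.trans (by gcongr; linarith)
  have h7 : η * c * (1 + ε) = ε := by rw [hη]; field_simp
  have h8 : η * u ≤ ε * D := by
    have : η * u * (1 + ε) ≤ ε * (D + η * u) := by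
      calc η * u * (1 + ε) ≤ η * (c * (D + η * u)) * (1 + ε) := by gcongr
        _ = (η * c * (1 + ε)) * (D + η * u) := by ring
        _ = _ := by rw [h7]
    nlinarith
  have h9 : D ≤ ‖planeCoord f₁ f₂ Δ‖ + ε * D := by linarith
  have h10 : D * (1 / K) ≤ ‖planeCoord f₁ f₂ Δ‖ := by rw [hε] at h9; linarith
  have hK0 : 0 < K := by linarith
  calc D = K * (D * (1 / K)) := by field_simp
    _ ≤ _ := by gcongr

/-- The area element of a parametrized surface with unit normal `n`. -/
def areaElem (X n : E2 → E3) (s : E2) : ℝ :=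
  tri (fderiv ℝ X s (bas 0)) (fderiv ℝ X s (bas 1)) (n s)

/-- A regular injective parametrization of a surface, with a continuous unit normal. -/
structure IsRegularParam (X n : E2 → E3) (T : Set E2) : Prop where
  contDiffAt : ∀ s ∈ T, ContDiffAt ℝ 1 X s
  injOn : InjOn X T
  norm_n : ∀ s ∈ T, ‖n s‖ = 1
  cont_n : ContinuousOn n T
  orth : ∀ s ∈ T, ∀ u, ⟪n s, fderiv ℝ X s u⟫ = 0
  pos : ∀ s ∈ T, 0 < areaElem X n s

theorem IsRegularParam.continuousOn {X n : E2 → E3} {T : Set E2} (h : IsRegularParam X n T) :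
    ContinuousOn X T := fun s hs => (h.contDiffAt s hs).continuousAt.continuousWithinAt

theorem continuousWithinAt_tri {f g h : E2 → E3} {T : Set E2} {s : E2}
    (hf : ContinuousWithinAt f T s) (hg : ContinuousWithinAt g T s)
    (hh : ContinuousWithinAt h T s) :
    ContinuousWithinAt (fun z => tri (f z) (g z) (h z)) T s := by
  have : ContinuousWithinAt (fun z => crL (f z) (g z)) T s :=
    (crL.continuous.continuousAt.comp_continuousWithinAt hf).clm_apply hg
  exact this.inner hh

/-- Near the point, projection of the surface to its tangent plane is 1-Lipschitz with K-Lipschitz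
inverse, which costs K² in area. The composition with X is a planar map, governed by the usual
change of variables with Jacobian `D₀`. By continuity `D₀` agrees with the area element up to
another factor K. -/
theorem IsRegularParam.area_local {X n : E2 → E3} {T : Set E2} (h : IsRegularParam X n T)
    {s₀ : E2} (hs₀ : s₀ ∈ T) {K : NNReal} (hK : 1 < K) :
    ∃ V, IsOpen V ∧ s₀ ∈ V ∧ ∀ A ⊆ T ∩ V, MeasurableSet A →
      μHE[2] (X '' A) ≤ (K : ENNReal) ^ 3 * ∫⁻ s in A, ENNReal.ofReal (areaElem X n s) ∧
      ∫⁻ s in A, ENNReal.ofReal (areaElem X n s) ≤ (K : ENNReal) ^ 3 * μHE[2] (X '' A) := by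
  obtain ⟨f₁, f₂, hf⟩ := exists_frame (h.norm_n s₀ hs₀)
  have hst := (h.contDiffAt s₀ hs₀).hasStrictFDerivAt (by simp)
  have hK' : (1 : ℝ) < K := hK
  have hK0 : (0 : ℝ) < K := by linarith
  obtain ⟨V₁, hV₁, hsV₁, hbil⟩ := eventually_norm_le_planeCoord hf hst (h.orth s₀ hs₀)
    (h.pos s₀ hs₀).ne' hK'
  set D₀ : E2 → ℝ := areaElem X (fun _ => n s₀) with hD₀
  have hc0 : ∀ i, ContinuousWithinAt (fun s => fderiv ℝ X s (bas i)) T s₀ := fun i =>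
    (((h.contDiffAt s₀ hs₀).fderiv_right (m := 0) (by simp)).continuousAt.clm_apply
      continuousAt_const).continuousWithinAt
  have hcD : ContinuousWithinAt D₀ T s₀ :=
    continuousWithinAt_tri (hc0 0) (hc0 1) continuousWithinAt_const
  have hcJ : ContinuousWithinAt (areaElem X n) T s₀ :=
    continuousWithinAt_tri (hc0 0) (hc0 1) (h.cont_n s₀ hs₀)
  have hpos := h.pos s₀ hs₀
  have hev : ∀ᶠ s in 𝓝[T] s₀, areaElem X n s ≤ K * D₀ s ∧ D₀ s ≤ K * areaElem X n s := by
    have h1 : areaElem X n s₀ < K * D₀ s₀ := by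
      change areaElem X n s₀ < K * areaElem X n s₀; nlinarith
    have h2 : D₀ s₀ < K * areaElem X n s₀ := h1
    filter_upwards [hcJ.tendsto.eventually_lt (hcD.const_mul (K : ℝ)).tendsto h1,
      hcD.tendsto.eventually_lt (hcJ.const_mul (K : ℝ)).tendsto h2] with s ha hb
    exact ⟨ha.le, hb.le⟩
  obtain ⟨V₂, hV₂, hsV₂, hV₂'⟩ := mem_nhdsWithin.1 hev
  refine ⟨V₁ ∩ V₂, hV₁.inter hV₂, ⟨hsV₁, hsV₂⟩, fun A hA hAm => ?_⟩
  have hAT : A ⊆ T := fun s hs => (hA hs).1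
  have hAV : A ⊆ V₁ := fun s hs => (hA hs).2.1
  have hAJ : ∀ s ∈ A, areaElem X n s ≤ K * D₀ s ∧ D₀ s ≤ K * areaElem X n s :=
    fun s hs => hV₂' ⟨(hA hs).2.2, hAT hs⟩
  set P := planeCoord f₁ f₂ with hP
  set g : E2 → E2 := fun s => P (X s) with hg
  have hdiffX : ∀ s ∈ A, DifferentiableAt ℝ X s := fun s hs =>
    (h.contDiffAt s (hAT hs)).differentiableAt (by simp)
  have hgd : ∀ s ∈ A, HasFDerivWithinAt g (P ∘L fderiv ℝ X s) A s := fun s hs =>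
    (P.hasFDerivAt.comp s (hdiffX s hs).hasFDerivAt).hasFDerivWithinAt
  have hXle : ∀ s ∈ A, ∀ s' ∈ A, ‖X s - X s'‖ ≤ K * ‖g s - g s'‖ := fun s hs s' hs' => by
    have := hbil s (hAV hs) s' (hAV hs')
    rwa [map_sub] at this
  have hginj : InjOn g A := by
    intro s hs s' hs' hss
    have := hXle s hs s' hs'
    rw [hss, sub_self, norm_zero, mul_zero] at this
    exact h.injOn (hAT hs) (hAT hs') (sub_eq_zero.1 (norm_le_zero_iff.1 this))
  have harea := lintegral_abs_det_fderiv_eq_addHaar_image volume hAm hgd hginj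
  have hdet : ∀ s ∈ A, ENNReal.ofReal |(P ∘L fderiv ℝ X s).det| = ENNReal.ofReal (D₀ s) := by
    intro s hs
    rw [hf.det_planeCoord]
    have hp := h.pos s (hAT hs)
    have : 0 ≤ D₀ s := by nlinarith [(hAJ s hs).1]
    rw [← abs_of_nonneg this]
    rfl
  rw [setLIntegral_congr_fun hAm hdet, ← EuclideanSpace.euclideanHausdorffMeasure_eq_volume] at harea
  have hgA : g '' A = P '' (X '' A) := by rw [image_image]
  have hle1 : μHE[2] (g '' A) ≤ μHE[2] (X '' A) := by
    have hl : LipschitzOnWith 1 P (X '' A) := LipschitzOnWith.of_dist_le_mul fun a _ b _ => by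
      rw [dist_eq_norm, dist_eq_norm, ← map_sub, NNReal.coe_one, one_mul]
      exact hf.norm_planeCoord_le _
    have := hl.euclideanHausdorffMeasure_image_le 2
    rw [hgA]
    simpa using this
  have hle2 : μHE[2] (X '' A) ≤ (K : ENNReal) ^ 2 * μHE[2] (g '' A) := by
    have hl : LipschitzOnWith K (X ∘ Function.invFunOn g A) (g '' A) := by
      refine LipschitzOnWith.of_dist_le_mul fun a ha b hb => ?_
      have := hXle _ (Function.invFunOn_mem ha) _ (Function.invFunOn_mem hb)
      rwa [Function.invFunOn_eq ha, Function.invFunOn_eq hb] at this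
    have := hl.euclideanHausdorffMeasure_image_le 2
    rwa [image_comp, hginj.invFunOn_image Subset.rfl] at this
  have hmeas : ∫⁻ s in A, ENNReal.ofReal (D₀ s) ≤
      K * ∫⁻ s in A, ENNReal.ofReal (areaElem X n s) := by
    rw [← lintegral_const_mul' _ _ ENNReal.coe_ne_top]
    refine setLIntegral_mono' hAm fun s hs => ?_
    rw [← ENNReal.ofReal_coe_nnreal, ← ENNReal.ofReal_mul (NNReal.coe_nonneg K)]
    exact ENNReal.ofReal_le_ofReal (hAJ s hs).2
  have hmeas' : ∫⁻ s in A, ENNReal.ofReal (areaElem X n s) ≤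
      K * ∫⁻ s in A, ENNReal.ofReal (D₀ s) := by
    rw [← lintegral_const_mul' _ _ ENNReal.coe_ne_top]
    refine setLIntegral_mono' hAm fun s hs => ?_
    rw [← ENNReal.ofReal_coe_nnreal, ← ENNReal.ofReal_mul (NNReal.coe_nonneg K)]
    exact ENNReal.ofReal_le_ofReal (hAJ s hs).1
  have hKone : (1 : ENNReal) ≤ K := by exact_mod_cast hK.le
  constructor
  · calc μHE[2] (X '' A) ≤ (K : ENNReal) ^ 2 * μHE[2] (g '' A) := hle2
      _ ≤ (K : ENNReal) ^ 2 * (K * ∫⁻ s in A, ENNReal.ofReal (areaElem X n s)) := by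
        rw [← harea, EuclideanSpace.euclideanHausdorffMeasure_eq_volume]; gcongr
      _ = _ := by ring
  · calc ∫⁻ s in A, ENNReal.ofReal (areaElem X n s) ≤ K * μHE[2] (g '' A) := by
          rw [← harea, EuclideanSpace.euclideanHausdorffMeasure_eq_volume]; exact hmeas'
      _ ≤ (K : ENNReal) ^ 3 * μHE[2] (X '' A) := by
        gcongr
        calc (K : ENNReal) = K * 1 * 1 := by ring
          _ ≤ K * K * K := by gcongr
          _ = _ := by ring

/-- Countably many of the local neighbourhoods cover T. Made disjoint, they split both sides into
countable sums, the left one by injectivity of X. -/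
theorem IsRegularParam.area_approx {X n : E2 → E3} {T : Set E2} (h : IsRegularParam X n T)
    (hT : MeasurableSet T) {K : NNReal} (hK : 1 < K) :
    μHE[2] (X '' T) ≤ (K : ENNReal) ^ 3 * ∫⁻ s in T, ENNReal.ofReal (areaElem X n s) ∧
      ∫⁻ s in T, ENNReal.ofReal (areaElem X n s) ≤ (K : ENNReal) ^ 3 * μHE[2] (X '' T) := by
  rcases T.eq_empty_or_nonempty with rfl | hne
  · simp
  choose! V hVo hsV hV using fun s₀ (hs₀ : s₀ ∈ T) => h.area_local hs₀ hK
  obtain ⟨t, htT, htc, htcov⟩ := TopologicalSpace.countable_cover_nhdsWithin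
    (f := V) fun s hs => mem_nhdsWithin_of_mem_nhds ((hVo s hs).mem_nhds (hsV s hs))
  have htne : t.Nonempty := by
    by_contra hcon
    rw [not_nonempty_iff_eq_empty] at hcon
    obtain ⟨s, hs⟩ := hne
    simpa [hcon] using htcov hs
  obtain ⟨x, rfl⟩ := htc.exists_eq_range htne
  have hx : ∀ k, x k ∈ T := fun k => htT ⟨k, rfl⟩
  set A : ℕ → Set E2 := fun k => T ∩ disjointed (fun k => V (x k)) k with hA
  have hAm : ∀ k, MeasurableSet (A k) := fun k =>
    hT.inter (MeasurableSet.disjointed (fun k => (hVo _ (hx k)).measurableSet) k)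
  have hAd : Pairwise (Function.onFun Disjoint A) := fun i j hij =>
    ((disjoint_disjointed _ hij).mono inter_subset_right inter_subset_right)
  have hAU : T = ⋃ k, A k := by
    rw [← inter_iUnion, iUnion_disjointed, eq_comm, inter_eq_left]
    simpa using htcov
  have hAV : ∀ k, A k ⊆ T ∩ V (x k) := fun k =>
    inter_subset_inter_right _ (disjointed_subset _ k)
  have hAT : ∀ k, A k ⊆ T := fun k => inter_subset_left
  have e1 : ∫⁻ s in T, ENNReal.ofReal (areaElem X n s) =
      ∑' k, ∫⁻ s in A k, ENNReal.ofReal (areaElem X n s) := by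
    conv_lhs => rw [hAU]
    exact lintegral_iUnion hAm hAd _
  have e2 : μHE[2] (X '' T) = ∑' k, μHE[2] (X '' A k) := by
    conv_lhs => rw [hAU, image_iUnion]
    refine measure_iUnion (fun i j hij => ?_) fun k => ?_
    · refine disjoint_left.2 ?_
      rintro _ ⟨s, hs, rfl⟩ ⟨s', hs', hss⟩
      rw [h.injOn (hAT j hs') (hAT i hs) hss] at hs'
      exact disjoint_left.1 (hAd hij) hs hs'
    · exact (hAm k).image_of_continuousOn_injOn (h.continuousOn.mono (hAT k))
        (h.injOn.mono (hAT k))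
  rw [e1, e2, ← ENNReal.tsum_mul_left, ← ENNReal.tsum_mul_left]
  exact ⟨ENNReal.tsum_le_tsum fun k => (hV _ (hx k) _ (hAV k) (hAm k)).1,
    ENNReal.tsum_le_tsum fun k => (hV _ (hx k) _ (hAV k) (hAm k)).2⟩

theorem le_of_forall_one_lt_pow_mul {a b : ENNReal}
    (h : ∀ K : NNReal, 1 < K → a ≤ (K : ENNReal) ^ 3 * b) : a ≤ b := by
  have hlim : Filter.Tendsto (fun K : NNReal => (K : ENNReal) ^ 3 * b) (𝓝[>] 1) (𝓝 b) := by
    have h1 : Filter.Tendsto (fun K : NNReal => (K : ENNReal) ^ 3) (𝓝[>] 1) (𝓝 1) := by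
      have : Continuous fun K : NNReal => (K : ENNReal) ^ 3 := by
        simp_rw [← ENNReal.coe_pow]
        exact ENNReal.continuous_coe.comp (continuous_pow 3)
      have h2 := this.tendsto 1
      simp only [ENNReal.coe_one, one_pow] at h2
      exact h2.mono_left nhdsWithin_le_nhds
    simpa using ENNReal.Tendsto.mul_const h1 (Or.inl one_ne_zero)
  exact ge_of_tendsto hlim (Filter.eventually_of_mem self_mem_nhdsWithin fun K hK => h K hK)

/-- The area formula. -/
theorem IsRegularParam.area_formula {X n : E2 → E3} {T : Set E2} (h : IsRegularParam X n T)
    (hT : MeasurableSet T) :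
    μHE[2] (X '' T) = ∫⁻ s in T, ENNReal.ofReal (areaElem X n s) :=
  le_antisymm (le_of_forall_one_lt_pow_mul fun _ hK => (h.area_approx hT hK).1)
    (le_of_forall_one_lt_pow_mul fun _ hK => (h.area_approx hT hK).2)

end

noncomputable section

/-! ### Weak surface derivatives -/

/-! ### Integrability against compactly supported coefficients -/

section Integrability

variable {F G : Type*} [NormedAddCommGroup F] [NormedSpace ℝ F] [NormedAddCommGroup G]
  [NormedSpace ℝ G] {μ : Measure E3}

theorem integrable_clm_apply_left {C : E3 → F →L[ℝ] G} (hC : Continuous C)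
    (hCs : HasCompactSupport C) {v : E3 → F} (hv : Integrable v μ) :
    Integrable (fun x => C x (v x)) μ := by
  obtain ⟨K, hK⟩ := hC.bounded_above_of_compact_support hCs
  refine (hv.norm.const_mul K).mono' ?_ (Filter.Eventually.of_forall fun x => ?_)
  · exact (ContinuousLinearMap.id ℝ (F →L[ℝ] G)).aestronglyMeasurable_comp₂
      (hC.aestronglyMeasurable) hv.aestronglyMeasurable
  · exact ((C x).le_opNorm _).trans (by gcongr; exact hK x)

theorem integrable_clm_apply_right {A : E3 → F →L[ℝ] G} (hA : Integrable A μ) {ψ : E3 → F}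
    (hψ : Continuous ψ) (hψs : HasCompactSupport ψ) : Integrable (fun x => A x (ψ x)) μ := by
  obtain ⟨K, hK⟩ := hψ.bounded_above_of_compact_support hψs
  refine (hA.norm.mul_const K).mono' ?_ (Filter.Eventually.of_forall fun x => ?_)
  · exact (ContinuousLinearMap.id ℝ (F →L[ℝ] G)).aestronglyMeasurable_comp₂
      hA.aestronglyMeasurable (hψ.aestronglyMeasurable)
  · exact ((A x).le_opNorm _).trans (by gcongr; exact hK x)

theorem integrable_smul_left {c : E3 → ℝ} (hc : Continuous c)
    (hcs : HasCompactSupport c) {v : E3 → F} (hv : Integrable v μ) :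
    Integrable (fun x => c x • v x) μ := by
  obtain ⟨K, hK⟩ := hc.bounded_above_of_compact_support hcs
  refine (hv.norm.const_mul K).mono' ?_ (Filter.Eventually.of_forall fun x => ?_)
  · exact (hc.aestronglyMeasurable).smul hv.aestronglyMeasurable
  · rw [norm_smul]; gcongr; exact hK x

end Integrability

theorem tangProj_contDiffAt {n : E3 → E3} {x : E3} (hn : ContDiffAt ℝ ∞ n x) (w : E3) :
    ContDiffAt ℝ ∞ (fun z => tangProj (n z) w) x := by
  simp only [tangProj_apply]
  exact contDiffAt_const.sub ((hn.inner ℝ contDiffAt_const).smul hn)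

theorem contDiff_smul_of_tsupport {F : Type*} [NormedAddCommGroup F] [NormedSpace ℝ F]
    {g : E3 → ℝ} {f : E3 → F} (hg : ContDiff ℝ ∞ g)
    (hf : ∀ x ∈ tsupport g, ContDiffAt ℝ ∞ f x) : ContDiff ℝ ∞ (fun x => g x • f x) := by
  refine contDiff_iff_contDiffAt.2 fun x => ?_
  by_cases hx : x ∈ tsupport g
  · exact hg.contDiffAt.smul (hf x hx)
  · refine contDiffAt_const.congr_of_eventuallyEq (f := fun _ => (0 : F)) ?_
    filter_upwards [notMem_tsupport_iff_eventuallyEq.1 hx] with z hz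
    rw [hz]; simp

/-- A tangential matrix field that annihilates all test fields vanishes. -/
theorem ae_eq_zero_of_test {F : Type*} [NormedAddCommGroup F] [NormedSpace ℝ F] [CompleteSpace F]
    {S W : Set E3} {n : E3 → E3} (hSm : MeasurableSet S)
    (hW : IsOpen W) (hSW : S ⊆ W) (hWS : W ∩ closure S ⊆ S) (hn : ∀ x ∈ W, ContDiffAt ℝ ∞ n x)
    (hn1 : ∀ x ∈ S, ‖n x‖ = 1) {D : E3 → E3 →L[ℝ] F} (hD : Integrable D (μHE[2].restrict S))
    (hDn : ∀ᵐ x ∂(μHE[2].restrict S), D x (n x) = 0)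
    (h : ∀ φ : E3 → E3, IsTestField S n φ → ∫ x in S, D x (φ x) ∂μHE[2] = 0) :
    ∀ᵐ x ∂(μHE[2].restrict S), D x = 0 := by
  have key : ∀ e : E3, ∀ᵐ x ∂(μHE[2].restrict S), D x (tangProj (n x) e) = 0 := by
    intro e
    have hmeas : AEStronglyMeasurable (fun x => tangProj (n x) e) (μHE[2].restrict S) :=
      ContinuousOn.aestronglyMeasurable (fun x hx =>
        (tangProj_contDiffAt (hn x (hSW hx)) e).continuousAt.continuousWithinAt) hSm
    have hint : Integrable (fun x => D x (tangProj (n x) e)) (μHE[2].restrict S) := by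
      refine (hD.norm.mul_const ‖e‖).mono' ?_ ?_
      · exact (ContinuousLinearMap.id ℝ (E3 →L[ℝ] F)).aestronglyMeasurable_comp₂
          hD.aestronglyMeasurable hmeas
      · filter_upwards [ae_restrict_mem hSm] with x hx
        exact ((D x).le_opNorm _).trans (by gcongr; exact norm_tangProj_apply_le (hn1 x hx) e)
    have := hW.ae_eq_zero_of_integral_contDiff_smul_eq_zero
      (hint.locallyIntegrable.locallyIntegrableOn W) (fun g hg hgs hgW => ?_)
    · filter_upwards [this, ae_restrict_mem hSm] with x hx hxS
      exact hx (hSW hxS)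
    -- Multiplying the projection of a constant vector by a cutoff supported in W gives a test
    -- field, as S is relatively closed in W. The fundamental lemma then applies to one constant
    -- vector at a time.
    · have htest : IsTestField S n (fun x => g x • tangProj (n x) e) := by
        refine ⟨contDiff_smul_of_tsupport hg fun x hx => tangProj_contDiffAt (hn x (hgW hx)) e,
          hgs.smul_right, ?_, ?_⟩
        · exact fun x hx => hWS ⟨hgW (tsupport_smul_subset_left _ _ hx.1), hx.2⟩
        · intro x hx
          rw [real_inner_smul_left, real_inner_comm, inner_tangProj (hn1 x hx), mul_zero]
      simpa using h _ htest
  have hall := ae_all_iff.2 fun i : Fin 3 => key (EuclideanSpace.single i 1)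
  filter_upwards [hall, hDn] with x hx hxn
  have : ∀ i : Fin 3, D x (EuclideanSpace.single i 1) = 0 := fun i => by
    have h1 := hx i
    rw [tangProj_apply, map_sub, map_smul, hxn, smul_zero, sub_zero] at h1
    exact h1
  refine ContinuousLinearMap.ext fun w => ?_
  have hw : w = w 0 • EuclideanSpace.single 0 1 + w 1 • EuclideanSpace.single 1 1 +
      w 2 • EuclideanSpace.single (2 : Fin 3) (1 : ℝ) := by
    apply ext_e3 <;> simp
  rw [hw]
  simp [this]

/-! ### Uniqueness, flatness and the product rule for weak Jacobians -/

section Weak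

variable {S : Set E3} {n v : E3 → E3} {A : E3 → Mat3}

theorem IsH1Tangential.integrable (h : IsH1Tangential S n v A) (hfin : μHE[2] S ≠ ⊤) :
    Integrable v (μHE[2].restrict S) := by
  have : IsFiniteMeasure (μHE[2].restrict S : Measure E3) := ⟨by simpa using hfin.lt_top⟩
  exact h.memLp.integrable (by norm_num)

theorem IsH1Tangential.integrable_grad (h : IsH1Tangential S n v A) (hfin : μHE[2] S ≠ ⊤) :
    Integrable A (μHE[2].restrict S) := by
  have : IsFiniteMeasure (μHE[2].restrict S : Measure E3) := ⟨by simpa using hfin.lt_top⟩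
  exact h.memLp_grad.integrable (by norm_num)

/-- The weak surface Jacobian is unique. -/
theorem IsH1Tangential.unique {B : E3 → Mat3} {W : Set E3} (hA : IsH1Tangential S n v A)
    (hB : IsH1Tangential S n v B) (hfin : μHE[2] S ≠ ⊤) (hSm : MeasurableSet S)
    (hW : IsOpen W) (hSW : S ⊆ W) (hWS : W ∩ closure S ⊆ S) (hn : ∀ x ∈ W, ContDiffAt ℝ ∞ n x)
    (hn1 : ∀ x ∈ S, ‖n x‖ = 1) : ∀ᵐ x ∂(μHE[2].restrict S), A x = B x := by
  have hAi := hA.integrable_grad hfin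
  have hBi := hB.integrable_grad hfin
  have := ae_eq_zero_of_test hSm hW hSW hWS hn hn1 (D := fun x => A x - B x) (hAi.sub hBi)
    (by
      filter_upwards [hA.grad_normal, hB.grad_normal] with x h1 h2
      rw [sub_apply, h1, h2, sub_zero])
    (fun φ hφ => by
      have h1 := integrable_clm_apply_right hAi hφ.smooth.continuous hφ.compact
      have h2 := integrable_clm_apply_right hBi hφ.smooth.continuous hφ.compact
      simp only [sub_apply]
      rw [integral_sub h1 h2, sub_eq_zero, ← neg_inj, ← hA.weak φ hφ, ← hB.weak φ hφ])
  filter_upwards [this] with x hx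
  exact sub_eq_zero.1 hx

/-- On a flat piece the weak Jacobian of a tangential field has tangential columns. -/
theorem IsH1Tangential.covGrad_flat {m : E3} (hm : ‖m‖ = 1) {W : Set E3}
    (hA : IsH1Tangential S (fun _ => m) v A) (hfin : μHE[2] S ≠ ⊤) (hSm : MeasurableSet S)
    (hW : IsOpen W) (hSW : S ⊆ W) (hWS : W ∩ closure S ⊆ S) :
    ∀ᵐ x ∂(μHE[2].restrict S), covGrad (fun _ => m) A x = A x := by
  have hAi := hA.integrable_grad hfin
  have hvi := hA.integrable hfin
  -- The row m·A is the weak gradient of ⟪m, v⟫ = 0, because m is constant.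
  have key := ae_eq_zero_of_test hSm hW hSW hWS (n := fun _ => m) (fun x _ => contDiffAt_const)
    (fun x _ => hm) (D := fun x => innerSL ℝ m ∘L A x)
    (((ContinuousLinearMap.compL ℝ E3 E3 ℝ) (innerSL ℝ m)).integrable_comp hAi)
    (by
      filter_upwards [hA.grad_normal] with x h1
      rw [ContinuousLinearMap.comp_apply, h1, map_zero])
    (fun φ hφ => by
      have h1 := integrable_clm_apply_right hAi hφ.smooth.continuous hφ.compact
      simp only [ContinuousLinearMap.comp_apply]
      rw [(innerSL ℝ m).integral_comp_comm h1, ← neg_inj, ← map_neg, ← hA.weak φ hφ]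
      -- Only integrability lets m be moved inside the integral. Otherwise the integral is 0 by
      -- default, which is the value wanted.
      by_cases hs : Integrable (fun x => surfDiv (fun _ => m) φ x • v x) (μHE[2].restrict S)
      · rw [← (innerSL ℝ m).integral_comp_comm hs, neg_zero]
        refine integral_eq_zero_of_ae ?_
        filter_upwards [hA.tangential] with x hx
        rw [map_smul, innerSL_apply_apply, real_inner_comm, hx, smul_zero]; rfl
      · rw [integral_undef hs, map_zero, neg_zero])
  filter_upwards [key, hA.grad_normal] with x hx hxn
  refine ContinuousLinearMap.ext fun w => ?_
  have h1 : ∀ z, ⟪m, A x z⟫ = 0 := fun z => by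
    have := congrArg (fun L => L z) hx
    simpa using this
  rw [covGrad, ContinuousLinearMap.comp_apply, ContinuousLinearMap.comp_apply,
    tangProj_of_inner (h1 _), tangProj_apply, map_sub, map_smul, hxn, smul_zero, sub_zero]

/-- Because ψ is tangential at x, the full derivative of g along ψ equals its surface derivative,
and no projection appears. -/
theorem surfDiv_smul {m : E3} (hm : ‖m‖ = 1) {g : E3 → ℝ} {ψ : E3 → E3} {x : E3}
    (hg : DifferentiableAt ℝ g x) (hψ : DifferentiableAt ℝ ψ x) (hx : ⟪m, ψ x⟫ = 0) :
    surfDiv (fun _ => m) (fun z => g z • ψ z) x =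
      g x * surfDiv (fun _ => m) ψ x + fderiv ℝ g x (ψ x) := by
  obtain ⟨e₁, e₂, hf⟩ := exists_frame hm
  simp only [surfDiv, covGrad]
  rw [hf.trace_tang, hf.trace_tang, fderiv_fun_smul hg hψ]
  simp only [add_apply, smul_apply, ContinuousLinearMap.smulRight_apply, inner_add_right,
    real_inner_smul_right]
  conv_rhs => rw [hf.expand (ψ x), hx]
  simp
  ring

/-- The surface divergence with constant normal as a linear function of the derivative. -/
def flatDiv (m : E3) : Mat3 →ₗ[ℝ] ℝ where
  toFun L := LinearMap.trace ℝ E3 (tangProj m ∘L L ∘L tangProj m).toLinearMap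
  map_add' L L' := by
    rw [ContinuousLinearMap.add_comp, ContinuousLinearMap.comp_add]
    exact map_add _ _ _
  map_smul' r L := by
    rw [ContinuousLinearMap.smul_comp, ContinuousLinearMap.comp_smul]
    exact map_smul _ _ _

theorem continuous_surfDiv_flat (m : E3) {ψ : E3 → E3} (hψ : ContDiff ℝ ∞ ψ) :
    Continuous (surfDiv (fun _ => m) ψ) :=
  (LinearMap.continuous_of_finiteDimensional (flatDiv m)).comp (hψ.continuous_fderiv (by simp))

theorem hasCompactSupport_surfDiv_flat (m : E3) {ψ : E3 → E3} (hψ : HasCompactSupport ψ) :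
    HasCompactSupport (surfDiv (fun _ => m) ψ) :=
  (hψ.fderiv ℝ).comp_left (g := flatDiv m) (map_zero _)

/-- Serves to reduce matrix multipliers to scalar ones. -/
theorem exists_coordinates_mat3 : ∃ (N : ℕ) (b : Fin N → Mat3) (l : Fin N → (Mat3 →L[ℝ] ℝ)),
    ∀ L : Mat3, ∑ k, l k L • b k = L :=
  ⟨_, Module.finBasis ℝ Mat3,
    fun k => LinearMap.toContinuousLinearMap ((Module.finBasis ℝ Mat3).coord k),
    fun L => (Module.finBasis ℝ Mat3).sum_repr L⟩

section

variable {μ : Measure E3} {s : E3 → ℝ} {ψ : E3 → E3} {G : E3 → Mat3}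

theorem integrable_fderiv_apply (hG : ContDiff ℝ ∞ G) (hψ : Continuous ψ)
    (hψs : HasCompactSupport ψ) (hv : Integrable v μ) :
    Integrable (fun x => fderiv ℝ G x (ψ x) (v x)) μ := by
  have hdG : Continuous (fderiv ℝ G) := hG.continuous_fderiv (by simp)
  refine integrable_clm_apply_left (C := fun x => fderiv ℝ G x (ψ x)) (hdG.clm_apply hψ) ?_ hv
  refine hψs.mono' fun x hx => subset_tsupport _ fun h0 => hx ?_
  simp only [h0, map_zero]

theorem integrable_apply_apply (hG : ContDiff ℝ ∞ G) (hψ : Continuous ψ)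
    (hψs : HasCompactSupport ψ) (hA : Integrable A μ) :
    Integrable (fun x => G x (A x (ψ x))) μ := by
  obtain ⟨K, hK⟩ := (hG.continuous.norm.mul hψ.norm).bounded_above_of_compact_support
    (hψs.norm.mul_left (f := fun x => ‖G x‖))
  refine (hA.norm.const_mul K).mono' ?_ (Filter.Eventually.of_forall fun x => ?_)
  · exact (ContinuousLinearMap.id ℝ Mat3).aestronglyMeasurable_comp₂
      hG.continuous.aestronglyMeasurable
      ((ContinuousLinearMap.id ℝ Mat3).aestronglyMeasurable_comp₂ hA.aestronglyMeasurable
        hψ.aestronglyMeasurable)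
  · have h1 := hK x
    rw [Pi.mul_apply, norm_mul, norm_norm, norm_norm] at h1
    calc ‖G x (A x (ψ x))‖ ≤ ‖G x‖ * (‖A x‖ * ‖ψ x‖) :=
          ((G x).le_opNorm _).trans (by gcongr; exact (A x).le_opNorm _)
      _ = (‖G x‖ * ‖ψ x‖) * ‖A x‖ := by ring
      _ ≤ K * ‖A x‖ := by gcongr

theorem integrable_prod_rule (hs : Continuous s) (hss : HasCompactSupport s) (hψ : Continuous ψ)
    (hψs : HasCompactSupport ψ) (hv : Integrable v μ) {g : E3 → ℝ} (hg : ContDiff ℝ ∞ g) :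
    Integrable (fun x => (g x * s x + fderiv ℝ g x (ψ x)) • v x) μ := by
  have hdg : Continuous (fderiv ℝ g) := hg.continuous_fderiv (by simp)
  refine integrable_smul_left ((hg.continuous.mul hs).add (hdg.clm_apply hψ))
    (hss.mul_left.add ?_) hv
  refine hψs.mono' fun x hx => subset_tsupport _ fun h0 => hx ?_
  simp only [h0, map_zero]

/-- From scalar multipliers to matrix multipliers in an integration by parts formula. -/
theorem integral_matrix_mul (hs : Continuous s) (hss : HasCompactSupport s) (hψ : Continuous ψ)
    (hψs : HasCompactSupport ψ) (hv : Integrable v μ) (hA : Integrable A μ)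
    (hG : ContDiff ℝ ∞ G) (h : ∀ g : E3 → ℝ, ContDiff ℝ ∞ g →
      ∫ x, (g x * s x + fderiv ℝ g x (ψ x)) • v x ∂μ = -∫ x, g x • A x (ψ x) ∂μ) :
    ∫ x, (s x • G x (v x) + fderiv ℝ G x (ψ x) (v x)) ∂μ = -∫ x, G x (A x (ψ x)) ∂μ := by
  obtain ⟨N, b, l, hl⟩ := exists_coordinates_mat3
  have hg : ∀ k, ContDiff ℝ ∞ (fun x => l k (G x)) := fun k => (l k).contDiff.comp hG
  have hgd : ∀ k x, fderiv ℝ (fun x => l k (G x)) x = (l k).comp (fderiv ℝ G x) := fun k x =>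
    ((l k).hasFDerivAt.comp x (hG.differentiable (by simp) x).hasFDerivAt).fderiv
  have hcint := fun k => integrable_prod_rule hs hss hψ hψs hv (hg k)
  have hAint : ∀ k, Integrable (fun x => l k (G x) • A x (ψ x)) μ := fun k => by
    have := integrable_clm_apply_right hA ((hg k).continuous.smul hψ) hψs.smul_left
    simpa using this
  have hweak := fun k => h _ (hg k)
  simp only [hgd, ContinuousLinearMap.comp_apply] at hcint hweak
  -- G is a combination of constant matrices with smooth scalar coefficients. The scalar formula
  -- applies to each coefficient, and constant matrices commute with the integral.
  have e1 : ∀ x, s x • G x (v x) + fderiv ℝ G x (ψ x) (v x) =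
      ∑ k, b k ((l k (G x) * s x + l k (fderiv ℝ G x (ψ x))) • v x) := by
    intro x
    conv_lhs => rw [← hl (G x), ← hl (fderiv ℝ G x (ψ x))]
    rw [sum_apply, sum_apply, Finset.smul_sum,
      ← Finset.sum_add_distrib]
    refine Finset.sum_congr rfl fun k _ => ?_
    simp only [smul_apply, map_smul]
    module
  have e2 : ∀ x, G x (A x (ψ x)) = ∑ k, b k (l k (G x) • A x (ψ x)) := by
    intro x
    conv_lhs => rw [← hl (G x)]
    rw [sum_apply]
    refine Finset.sum_congr rfl fun k _ => ?_
    simp only [smul_apply, map_smul]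
  simp_rw [e1, e2]
  rw [integral_finsetSum _ fun k _ => (b k).integrable_comp (hcint k),
    integral_finsetSum _ fun k _ => (b k).integrable_comp (hAint k), ← Finset.sum_neg_distrib]
  refine Finset.sum_congr rfl fun k _ => ?_
  rw [(b k).integral_comp_comm (hcint k), (b k).integral_comp_comm (hAint k), hweak k, map_neg]

end

theorem IsTestField.smul {ψ : E3 → E3} (hψ : IsTestField S n ψ) {g : E3 → ℝ}
    (hg : ContDiff ℝ ∞ g) : IsTestField S n (fun x => g x • ψ x) := by
  have hsupp : Function.support (fun x => g x • ψ x) ⊆ Function.support ψ := fun x hx h0 =>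
    hx (by simp only [h0, smul_zero])
  refine ⟨hg.smul hψ.smooth, hψ.compact.mono hsupp,
    fun x hx => hψ.support ⟨closure_mono hsupp hx.1, hx.2⟩, fun x hx => ?_⟩
  rw [real_inner_smul_left, hψ.tangential x hx, mul_zero]

/-- The product rule for weak derivatives on a flat piece. -/
theorem IsH1Tangential.weak_mul {m : E3} (hm : ‖m‖ = 1) (hSm : MeasurableSet S)
    (hA : IsH1Tangential S (fun _ => m) v A) (hfin : μHE[2] S ≠ ⊤) {ψ : E3 → E3}
    (hψ : IsTestField S (fun _ => m) ψ) {G : E3 → Mat3} (hG : ContDiff ℝ ∞ G) :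
    ∫ x in S, surfDiv (fun _ => m) ψ x • G x (v x) ∂μHE[2] =
      -∫ x in S, (G x (A x (ψ x)) + fderiv ℝ G x (ψ x) (v x)) ∂μHE[2] := by
  have hAi := hA.integrable_grad hfin
  have hvi := hA.integrable hfin
  have hψc := hψ.smooth.continuous
  have hsc := continuous_surfDiv_flat m hψ.smooth
  have hss := hasCompactSupport_surfDiv_flat m hψ.compact
  -- For a scalar multiplier g the formula is the weak formulation tested with g ψ, expanded by
  -- `surfDiv_smul`.
  have hsum := integral_matrix_mul hsc hss hψc hψ.compact hvi hAi hG fun g hg => by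
    have := hA.weak _ (hψ.smul hg)
    simp only [map_smul] at this
    rw [← this]
    refine setIntegral_congr_fun hSm fun x hx => ?_
    rw [surfDiv_smul hm (hg.differentiable (by simp) x) (hψ.smooth.differentiable (by simp) x)
      (by rw [real_inner_comm]; exact hψ.tangential x hx)]
  have hi1 : Integrable (fun x => surfDiv (fun _ => m) ψ x • G x (v x)) (μHE[2].restrict S) :=
    integrable_clm_apply_left (C := fun x => surfDiv (fun _ => m) ψ x • G x)
      (hsc.smul hG.continuous) hss.smul_right hvi
  have hi2 := integrable_fderiv_apply hG hψc hψ.compact hvi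
  have hi3 := integrable_apply_apply hG hψc hψ.compact hAi
  rw [integral_add hi1 hi2] at hsum
  rw [integral_add hi3 hi2, neg_add, ← hsum]
  abel

end Weak

end

noncomputable section

/-! ### The Piola transform of a flat piece -/

/-- The area element of the closest point projection with respect to tangent vectors `e₁`, `e₂`. -/
def projJac (Ω : Set E3) (e₁ e₂ x : E3) : ℝ :=
  tri (fderiv ℝ (proj Ω) x e₁) (fderiv ℝ (proj Ω) x e₂) (nu Ω x)

/-- The cofactor matrix of `Dp` from the tangent plane of the surface to the span of `e₁`, `e₂`. -/
def projCof (Ω : Set E3) (e₁ e₂ x : E3) : Mat3 :=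
  (innerSL ℝ (cr (fderiv ℝ (proj Ω) x e₂) (nu Ω x))).smulRight e₁ +
    (innerSL ℝ (cr (nu Ω x) (fderiv ℝ (proj Ω) x e₁))).smulRight e₂

/-- The inverse of `Dp` on the tangent plane of the surface. -/
def projTangInv (Ω : Set E3) (e₁ e₂ x : E3) : Mat3 :=
  (projJac Ω e₁ e₂ x)⁻¹ • projCof Ω e₁ e₂ x

/-- The matrix of the Piola transform. -/
def piolaMat (Ω : Set E3) (e₁ e₂ x : E3) : Mat3 :=
  (projJac Ω e₁ e₂ x)⁻¹ • fderiv ℝ (proj Ω) x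

/-- The weak Jacobian of the Piola transform, pulled back to the flat piece. -/
def piolaGrad (Ω : Set E3) (e₁ e₂ : E3) (v : E3 → E3) (A : E3 → Mat3) (x : E3) : Mat3 :=
  (fderiv ℝ (piolaMat Ω e₁ e₂) x).flip (v x) ∘L projTangInv Ω e₁ e₂ x +
    piolaMat Ω e₁ e₂ x ∘L A x ∘L projTangInv Ω e₁ e₂ x

/-- The coefficients are the numerators in Cramer's rule for solving Dp(a e₁ + b e₂) = w in the
tangent plane of the surface. -/
theorem projCof_apply (Ω : Set E3) (e₁ e₂ x w : E3) : projCof Ω e₁ e₂ x w =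
    tri w (fderiv ℝ (proj Ω) x e₂) (nu Ω x) • e₁ + tri (fderiv ℝ (proj Ω) x e₁) w (nu Ω x) • e₂ := by
  rw [tri_rot (fderiv ℝ (proj Ω) x e₁) w, ← inner_cr_left, ← inner_cr_left]
  rfl

theorem piolaGrad_apply (Ω : Set E3) (e₁ e₂ : E3) (v : E3 → E3) (A : E3 → Mat3) (x w : E3) :
    piolaGrad Ω e₁ e₂ v A x w =
      fderiv ℝ (piolaMat Ω e₁ e₂) x (projTangInv Ω e₁ e₂ x w) (v x) +
        piolaMat Ω e₁ e₂ x (A x (projTangInv Ω e₁ e₂ x w)) := rfl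

theorem projTangInv_nu (Ω : Set E3) (e₁ e₂ x : E3) : projTangInv Ω e₁ e₂ x (nu Ω x) = 0 := by
  rw [projTangInv, smul_apply, projCof_apply]
  simp

theorem hasFDerivAt_tri_apply {f g h : E3 → E3} {f' g' h' : Mat3} {x : E3}
    (hf : HasFDerivAt f f' x) (hg : HasFDerivAt g g' x) (hh : HasFDerivAt h h' x) (w : E3) :
    fderiv ℝ (fun z => tri (f z) (g z) (h z)) x w =
      tri (f' w) (g x) (h x) + tri (f x) (g' w) (h x) + tri (f x) (g x) (h' w) := by
  have h1 : HasFDerivAt (fun z => crL (f z) (g z)) _ x :=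
    (crL.hasFDerivAt.comp x hf).clm_apply hg
  have h2 : HasFDerivAt (fun z => tri (f z) (g z) (h z)) _ x := h1.inner ℝ hh
  rw [h2.fderiv]
  simp [tri, inner_add_left]
  rw [add_comm, add_comm ⟪cr (f x) (g' w), h x⟫]

namespace TubeNbhd

variable {Ω N : Set E3} (hN : TubeNbhd Ω N) {x : E3} {e₁ e₂ m : E3}
include hN

theorem fderiv_proj_eq_shapeMap (hx : x ∈ N) (w : E3) :
    fderiv ℝ (proj Ω) x w = shapeMap Ω x w - ⟪nu Ω x, w⟫ • nu Ω x := by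
  rw [hN.fderiv_proj_apply hx, tangProj_apply, shapeMap, sub_apply, smul_apply,
    ContinuousLinearMap.id_apply]
  abel

theorem shapeMap_nu (hx : x ∈ N) : shapeMap Ω x (nu Ω x) = nu Ω x := by
  rw [shapeMap, sub_apply, smul_apply, hN.fderiv_nu_nu hx, smul_zero, sub_zero,
    ContinuousLinearMap.id_apply]

/-- Dp differs from I − d H by multiples of ν, which drop out of a determinant whose third column is
ν. As I − d H fixes ν, its determinant factors out and leaves det(e₁, e₂, ν). -/
theorem projJac_eq (hf : IsFrame e₁ e₂ m) (hx : x ∈ N) :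
    projJac Ω e₁ e₂ x = shapeDet Ω x * ⟪m, nu Ω x⟫ := by
  have : tri e₁ e₂ (nu Ω x) = ⟪m, nu Ω x⟫ := by rw [tri, hf.cr_eq]
  rw [← this, ← tri_shapeMap, hN.shapeMap_nu hx, projJac, hN.fderiv_proj_eq_shapeMap hx,
    hN.fderiv_proj_eq_shapeMap hx]
  simp [tri_sub_left, tri_sub_mid, tri_smul_left, tri_smul_mid]

theorem contDiffAt_fderiv_proj_apply (hx : x ∈ N) (w : E3) :
    ContDiffAt ℝ ∞ (fun z => fderiv ℝ (proj Ω) z w) x :=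
  (hN.contDiffAt_fderiv_proj hx).clm_apply contDiffAt_const

theorem contDiffAt_projJac (hx : x ∈ N) : ContDiffAt ℝ ∞ (projJac Ω e₁ e₂) x :=
  contDiffAt_tri (hN.contDiffAt_fderiv_proj_apply hx _) (hN.contDiffAt_fderiv_proj_apply hx _)
    (hN.contDiffAt_nu hx)

theorem contDiffAt_projCof (hx : x ∈ N) : ContDiffAt ℝ ∞ (projCof Ω e₁ e₂) x := by
  have h1 : ∀ {f g : E3 → E3}, ContDiffAt ℝ ∞ f x → ContDiffAt ℝ ∞ g x → ∀ e : E3,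
      ContDiffAt ℝ ∞ (fun z => (innerSL ℝ (cr (f z) (g z))).smulRight e) x := by
    intro f g hf hg e
    have h2 : ContDiffAt ℝ ∞ (fun z => crL (f z) (g z)) x :=
      (crL.contDiff.contDiffAt.comp x hf).clm_apply hg
    exact ContDiffAt.smulRight ((innerSL ℝ).contDiff.contDiffAt.comp x h2) contDiffAt_const
  exact (h1 (hN.contDiffAt_fderiv_proj_apply hx _) (hN.contDiffAt_nu hx) _).add
    (h1 (hN.contDiffAt_nu hx) (hN.contDiffAt_fderiv_proj_apply hx _) _)

theorem contDiffAt_piolaMat (hx : x ∈ N) (h0 : projJac Ω e₁ e₂ x ≠ 0) :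
    ContDiffAt ℝ ∞ (piolaMat Ω e₁ e₂) x :=
  ((hN.contDiffAt_projJac hx).inv h0).smul (hN.contDiffAt_fderiv_proj hx)

theorem contDiffAt_projTangInv (hx : x ∈ N) (h0 : projJac Ω e₁ e₂ x ≠ 0) :
    ContDiffAt ℝ ∞ (projTangInv Ω e₁ e₂) x :=
  ((hN.contDiffAt_projJac hx).inv h0).smul (hN.contDiffAt_projCof hx)

/-- The Piola identity. -/
theorem surfDiv_projCof (hf : IsFrame e₁ e₂ m) (hx : x ∈ N) {φ : E3 → E3}
    (hφ : DifferentiableAt ℝ φ (proj Ω x)) (hφn : ⟪φ (proj Ω x), nu Ω x⟫ = 0) :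
    surfDiv (fun _ => m) (fun z => projCof Ω e₁ e₂ z (φ (proj Ω z))) x =
      projJac Ω e₁ e₂ x * surfDiv (nu Ω) φ (proj Ω x) := by
  set p' := fderiv ℝ (proj Ω) x with hp'
  set n := nu Ω x with hn
  have hn1 : ‖n‖ = 1 := hN.norm_nu x hx
  have hX1 : ⟪n, p' e₁⟫ = 0 := hN.inner_nu_fderiv_proj hx e₁
  have hX2 : ⟪n, p' e₂⟫ = 0 := hN.inner_nu_fderiv_proj hx e₂
  have hpd : HasFDerivAt (proj Ω) p' x :=
    ((hN.contDiffAt_proj hx).differentiableAt (by simp)).hasFDerivAt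
  have hpp : HasFDerivAt (fderiv ℝ (proj Ω)) (fderiv ℝ (fderiv ℝ (proj Ω)) x) x :=
    ((hN.contDiffAt_fderiv_proj hx).differentiableAt (by simp)).hasFDerivAt
  have hD : ∀ e, HasFDerivAt (fun z => fderiv ℝ (proj Ω) z e)
      ((ContinuousLinearMap.apply ℝ E3 e).comp (fderiv ℝ (fderiv ℝ (proj Ω)) x)) x := fun e =>
    (ContinuousLinearMap.apply ℝ E3 e).hasFDerivAt.comp x hpp
  have hφp : HasFDerivAt (fun z => φ (proj Ω z)) ((fderiv ℝ φ (proj Ω x)).comp p') x :=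
    hφ.hasFDerivAt.comp x hpd
  -- The product rule produces three kinds of terms. Those with D²p cancel by symmetry of second
  -- derivatives and antisymmetry of the determinant. Those with Dν vanish, being determinants of
  -- three tangent vectors. Those with Dφ form the tangential trace.
  have hsymm : fderiv ℝ (fderiv ℝ (proj Ω)) x e₁ e₂ = fderiv ℝ (fderiv ℝ (proj Ω)) x e₂ e₁ :=
    ((hN.contDiffAt_proj hx).isSymmSndFDerivAt (by
      rw [minSmoothness_of_isRCLikeNormedField]
      exact WithTop.coe_le_coe.2 (le_top : (2 : ℕ∞) ≤ ⊤))).eq e₁ e₂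
  have ha := hasFDerivAt_tri_apply hφp (hD e₂) (hN.hasFDerivAt_nu hx) e₁
  have hb := hasFDerivAt_tri_apply (hD e₁) hφp (hN.hasFDerivAt_nu hx) e₂
  have hda : DifferentiableAt ℝ (fun z => tri (φ (proj Ω z)) (fderiv ℝ (proj Ω) z e₂) (nu Ω z)) x :=
    DifferentiableAt.inner ℝ
      (((crL.differentiableAt).comp x hφp.differentiableAt).clm_apply (hD e₂).differentiableAt)
      (hN.hasFDerivAt_nu hx).differentiableAt
  have hdb : DifferentiableAt ℝ (fun z => tri (fderiv ℝ (proj Ω) z e₁) (φ (proj Ω z)) (nu Ω z)) x :=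
    DifferentiableAt.inner ℝ
      (((crL.differentiableAt).comp x (hD e₁).differentiableAt).clm_apply hφp.differentiableAt)
      (hN.hasFDerivAt_nu hx).differentiableAt
  have hz1 : tri (φ (proj Ω x)) (p' e₂) (fderiv ℝ (nu Ω) x e₁) = 0 :=
    tri_eq_zero_of_inner (n := n) (by rw [← norm_ne_zero_iff, hn1]; exact one_ne_zero) hφn
      (by rw [real_inner_comm]; exact hX2) (by rw [real_inner_comm]; exact hN.inner_nu_fderiv_nu hx _)
  have hz2 : tri (p' e₁) (φ (proj Ω x)) (fderiv ℝ (nu Ω) x e₂) = 0 :=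
    tri_eq_zero_of_inner (n := n) (by rw [← norm_ne_zero_iff, hn1]; exact one_ne_zero)
      (by rw [real_inner_comm]; exact hX1) hφn (by rw [real_inner_comm]; exact hN.inner_nu_fderiv_nu hx _)
  simp only [projCof_apply]
  rw [surfDiv, covGrad, hf.trace_tang]
  have hder : HasFDerivAt (fun z => tri (φ (proj Ω z)) (fderiv ℝ (proj Ω) z e₂) (nu Ω z) • e₁ +
      tri (fderiv ℝ (proj Ω) z e₁) (φ (proj Ω z)) (nu Ω z) • e₂) _ x :=
    (hda.hasFDerivAt.smul_const e₁).add (hdb.hasFDerivAt.smul_const e₂)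
  rw [hder.fderiv]
  simp only [add_apply, ContinuousLinearMap.smulRight_apply, inner_add_right,
    real_inner_smul_right, real_inner_self_eq_norm_sq, hf.n1, hf.n2, hf.i12,
    real_inner_comm e₁ e₂, ha, hb]
  simp only [ContinuousLinearMap.comp_apply, ContinuousLinearMap.apply_apply, hsymm]
  rw [tri_swap (φ (proj Ω x)) _ _]
  have htr := tri_trace_tang (fderiv ℝ φ (proj Ω x)) hn1 hX1 hX2
  rw [surfDiv, covGrad, hN.nu_proj x hx, projJac]
  simp only [hp', hn] at htr hz1 hz2
  linear_combination htr + hz1 + hz2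

end TubeNbhd

end

noncomputable section

/-! ### Change of variables between a flat piece and the surface -/

/-- The isometric linear parametrization of the span of an orthonormal pair. -/
def planeLin (e₁ e₂ : E3) : E2 →L[ℝ] E3 :=
  (EuclideanSpace.proj (0 : Fin 2)).smulRight e₁ + (EuclideanSpace.proj (1 : Fin 2)).smulRight e₂

/-- The isometric parametrization of an affine plane. -/
def planeParam (q e₁ e₂ : E3) (s : E2) : E3 := q + planeLin e₁ e₂ s

theorem planeLin_apply (e₁ e₂ : E3) (s : E2) : planeLin e₁ e₂ s = s 0 • e₁ + s 1 • e₂ := rfl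

theorem IsFrame.isometry_planeParam {e₁ e₂ m : E3} (hf : IsFrame e₁ e₂ m) (q : E3) :
    Isometry (planeParam q e₁ e₂) := by
  refine Isometry.of_dist_eq fun s s' => ?_
  rw [dist_eq_norm, dist_eq_norm, planeParam, planeParam, add_sub_add_left_eq_sub, ← map_sub]
  refine (sq_eq_sq₀ (norm_nonneg _) (norm_nonneg _)).1 ?_
  rw [planeLin_apply, norm_add_sq_real, norm_smul, norm_smul, hf.n1, hf.n2, real_inner_smul_left,
    real_inner_smul_right, hf.i12, EuclideanSpace.norm_sq_eq, Fin.sum_univ_two]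
  simp

theorem IsFrame.mem_range_planeParam {e₁ e₂ m q x : E3} (hf : IsFrame e₁ e₂ m)
    (hx : ⟪m, x - q⟫ = 0) : x ∈ range (planeParam q e₁ e₂) := by
  refine ⟨!₂[⟪e₁, x - q⟫, ⟪e₂, x - q⟫], ?_⟩
  have := hf.expand (x - q)
  rw [hx, zero_smul, add_zero] at this
  rw [planeParam, planeLin_apply]
  simp only [Matrix.cons_val_zero, Matrix.cons_val_one]
  rw [← this]
  abel

theorem IsFrame.setLIntegral_plane {e₁ e₂ m q : E3} (hf : IsFrame e₁ e₂ m) {A : Set E3}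
    (hA : MeasurableSet A) (hplane : ∀ x ∈ A, ⟪m, x - q⟫ = 0) (f : E3 → ENNReal) :
    ∫⁻ x in A, f x ∂μHE[2] = ∫⁻ s in planeParam q e₁ e₂ ⁻¹' A, f (planeParam q e₁ e₂ s) := by
  have hi := hf.isometry_planeParam q
  have hmap := hi.map_euclideanHausdorffMeasure (d := 2)
  rw [EuclideanSpace.euclideanHausdorffMeasure_eq_volume] at hmap
  have hsub : A ⊆ range (planeParam q e₁ e₂) := fun x hx => hf.mem_range_planeParam (hplane x hx)
  have he : MeasurableEmbedding (planeParam q e₁ e₂) := hi.isClosedEmbedding.measurableEmbedding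
  rw [← inter_eq_left.2 hsub, ← Measure.restrict_restrict hA, ← hmap, he.restrict_map,
    he.lintegral_map, inter_eq_left.2 hsub]

/-- A continuous map on a compact set sends relatively closed subsets to closed sets. -/
theorem continuousOn_leftInverse {C : Set E3} (hC : IsCompact C) {f Ψ : E3 → E3}
    (hf : ContinuousOn f C) (h : ∀ x ∈ C, Ψ (f x) = x) : ContinuousOn Ψ (f '' C) := by
  refine continuousOn_iff_isClosed.2 fun t ht => ⟨f '' (C ∩ t),
    ((hC.inter_right ht).image_of_continuousOn (hf.mono inter_subset_left)).isClosed, ?_⟩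
  ext y
  constructor
  · rintro ⟨hy, x, hx, rfl⟩
    rw [mem_preimage, h x hx] at hy
    exact ⟨⟨x, ⟨hx, hy⟩, rfl⟩, ⟨x, hx, rfl⟩⟩
  · rintro ⟨⟨x, ⟨hx, hxt⟩, rfl⟩, hy⟩
    exact ⟨by rwa [mem_preimage, h x hx], hy⟩

/-- A flat piece `S` of a polyhedral surface with compact closure contained in `Kc`, in the tubular
neighbourhood `N`. -/
structure FlatPiece (Ω N : Set E3) (e₁ e₂ m q : E3) (S Kc : Set E3) : Prop where
  frame : IsFrame e₁ e₂ m
  tube : TubeNbhd Ω N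
  shape : ∀ x ∈ N, 1 / 2 < shapeDet Ω x
  compact : IsCompact Kc
  subset_N : Kc ⊆ N
  plane : ∀ x ∈ Kc, ⟪m, x - q⟫ = 0
  inj : InjOn (proj Ω) Kc
  inner_pos : ∀ x ∈ Kc, 0 < ⟪m, nu Ω x⟫
  subset : S ⊆ Kc
  compact_bdry : IsCompact (Kc \ S)

namespace FlatPiece

variable {Ω N : Set E3} {e₁ e₂ m q : E3} {S Kc : Set E3} (hP : FlatPiece Ω N e₁ e₂ m q S Kc)
include hP

/-- S is the difference of two compact sets. -/
theorem measurableSet : MeasurableSet S := by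
  rw [← sdiff_sdiff_cancel_left hP.subset]
  exact hP.compact.measurableSet.diff hP.compact_bdry.measurableSet

theorem jac_pos {x : E3} (hx : x ∈ Kc) : 0 < projJac Ω e₁ e₂ x := by
  rw [hP.tube.projJac_eq hP.frame (hP.subset_N hx)]
  exact mul_pos (by linarith [hP.shape x (hP.subset_N hx)]) (hP.inner_pos x hx)

theorem continuousOn_proj : ContinuousOn (proj Ω) Kc := fun _ hx =>
  (hP.tube.contDiffAt_proj (hP.subset_N hx)).continuousAt.continuousWithinAt

theorem continuousOn_jac : ContinuousOn (projJac Ω e₁ e₂) Kc := fun _ hx =>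
  (hP.tube.contDiffAt_projJac (hP.subset_N hx)).continuousAt.continuousWithinAt

/-- The area formula for the closest point projection. -/
theorem area_image {A : Set E3} (hA : MeasurableSet A) (hAK : A ⊆ Kc) :
    μHE[2] (proj Ω '' A) = ∫⁻ x in A, ENNReal.ofReal (projJac Ω e₁ e₂ x) ∂μHE[2] := by
  have hi := hP.frame.isometry_planeParam q
  set ι := planeParam q e₁ e₂ with hι
  have himg : ι '' (ι ⁻¹' A) = A := image_preimage_eq_of_subset fun x hx =>
    hP.frame.mem_range_planeParam (hP.plane x (hAK hx))
  have hder : ∀ s ∈ ι ⁻¹' A, HasFDerivAt (proj Ω ∘ ι)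
      (fderiv ℝ (proj Ω) (ι s) ∘L planeLin e₁ e₂) s := fun s hs =>
    ((hP.tube.contDiffAt_proj (hP.subset_N (hAK hs))).differentiableAt (by simp)).hasFDerivAt.comp s
      ((planeLin e₁ e₂).hasFDerivAt.const_add q)
  have hb0 : planeLin e₁ e₂ (bas 0) = e₁ := by simp [planeLin_apply, bas]
  have hb1 : planeLin e₁ e₂ (bas 1) = e₂ := by simp [planeLin_apply, bas]
  have hJ : ∀ s ∈ ι ⁻¹' A, areaElem (proj Ω ∘ ι) (nu Ω ∘ ι) s = projJac Ω e₁ e₂ (ι s) := by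
    intro s hs
    rw [areaElem, (hder s hs).fderiv, ContinuousLinearMap.comp_apply,
      ContinuousLinearMap.comp_apply, hb0, hb1]
    rfl
  have hsm : ContDiff ℝ 1 ι := contDiff_const.add (planeLin e₁ e₂).contDiff
  have hreg : IsRegularParam (proj Ω ∘ ι) (nu Ω ∘ ι) (ι ⁻¹' A) := by
    refine ⟨fun s hs => ?_, fun s hs s' hs' h => ?_, fun s hs => ?_, fun s hs => ?_,
      fun s hs u => ?_, fun s hs => ?_⟩
    · exact ((hP.tube.contDiffAt_proj (hP.subset_N (hAK hs))).of_le (by exact_mod_cast le_top)).comp s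
        hsm.contDiffAt
    · exact hi.injective (hP.inj (hAK hs) (hAK hs') h)
    · exact hP.tube.norm_nu _ (hP.subset_N (hAK hs))
    · exact (ContinuousAt.comp (g := nu Ω)
        (hP.tube.contDiffAt_nu (hP.subset_N (hAK hs))).continuousAt
        hi.continuous.continuousAt).continuousWithinAt
    · rw [(hder s hs).fderiv]
      exact hP.tube.inner_nu_fderiv_proj (hP.subset_N (hAK hs)) _
    · rw [hJ s hs]; exact hP.jac_pos (hAK hs)
  have hm : MeasurableSet (ι ⁻¹' A) := hi.continuous.measurable hA
  have := hreg.area_formula hm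
  rw [image_comp, himg] at this
  rw [this, hP.frame.setLIntegral_plane hA (fun x hx => hP.plane x (hAK hx))]
  exact setLIntegral_congr_fun hm fun s hs => by rw [hJ s hs]

theorem measure_ne_top : μHE[2] Kc ≠ ⊤ := by
  have hi := hP.frame.isometry_planeParam q
  have := hP.frame.setLIntegral_plane hP.compact.measurableSet hP.plane (fun _ => 1)
  rw [setLIntegral_one, setLIntegral_one] at this
  rw [this]
  exact (hi.isClosedEmbedding.isCompact_preimage hP.compact).measure_lt_top.ne

theorem measure_piece_ne_top : μHE[2] S ≠ ⊤ :=
  ((measure_mono hP.subset).trans_lt hP.measure_ne_top.lt_top).ne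

theorem exists_jac_le : ∃ J : ℝ, ∀ x ∈ Kc, projJac Ω e₁ e₂ x ≤ J := by
  obtain ⟨J, hJ⟩ := hP.compact.exists_bound_of_continuousOn hP.continuousOn_jac
  exact ⟨J, fun x hx => (le_abs_self _).trans (hJ x hx)⟩

theorem measure_image_ne_top : μHE[2] (proj Ω '' Kc) ≠ ⊤ := by
  obtain ⟨J, hJ⟩ := hP.exists_jac_le
  rw [hP.area_image hP.compact.measurableSet Subset.rfl]
  refine (lt_of_le_of_lt (setLIntegral_mono' hP.compact.measurableSet
    fun x hx => ENNReal.ofReal_le_ofReal (hJ x hx)) ?_).ne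
  rw [setLIntegral_const]
  exact ENNReal.mul_lt_top ENNReal.ofReal_lt_top hP.measure_ne_top.lt_top

theorem measurableSet_image : MeasurableSet (proj Ω '' S) :=
  hP.measurableSet.image_of_continuousOn_injOn (hP.continuousOn_proj.mono hP.subset)
    (hP.inj.mono hP.subset)

theorem measure_image_piece_ne_top : μHE[2] (proj Ω '' S) ≠ ⊤ :=
  ((measure_mono (image_mono hP.subset)).trans_lt hP.measure_image_ne_top.lt_top).ne

theorem aemeasurable_jac :
    AEMeasurable (fun x => ENNReal.ofReal (projJac Ω e₁ e₂ x)) (μHE[2].restrict S) :=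
  ((hP.continuousOn_jac.mono hP.subset).aemeasurable hP.measurableSet).ennreal_ofReal

variable {Ψ : E3 → E3}

theorem aemeasurable_inv (hΨ : ∀ x ∈ Kc, Ψ (proj Ω x) = x) :
    AEMeasurable Ψ (μHE[2].restrict (proj Ω '' S)) :=
  ((continuousOn_leftInverse hP.compact hP.continuousOn_proj hΨ).mono
    (image_mono hP.subset)).aemeasurable hP.measurableSet_image

/-- The surface measure carried over to the flat piece. -/
theorem map_inv (hΨ : ∀ x ∈ Kc, Ψ (proj Ω x) = x) :
    Measure.map Ψ (μHE[2].restrict (proj Ω '' S)) =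
      (μHE[2].restrict S).withDensity fun x => ENNReal.ofReal (projJac Ω e₁ e₂ x) := by
  ext B hB
  rw [Measure.map_apply_of_aemeasurable (hP.aemeasurable_inv hΨ) hB,
    Measure.restrict_apply' hP.measurableSet_image, withDensity_apply _ hB,
    Measure.restrict_restrict hB,
    ← hP.area_image (hB.inter hP.measurableSet) (inter_subset_right.trans hP.subset)]
  congr 1
  ext y
  constructor
  · rintro ⟨hy, x, hx, rfl⟩
    rw [mem_preimage, hΨ x (hP.subset hx)] at hy
    exact ⟨x, ⟨hy, hx⟩, rfl⟩
  · rintro ⟨x, ⟨hxB, hx⟩, rfl⟩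
    exact ⟨by rwa [mem_preimage, hΨ x (hP.subset hx)], ⟨x, hx, rfl⟩⟩

/-- The area ratio is the area element of the closest point projection. -/
theorem areaRatio_eq {C : Set E3} (hC : IsCompact C) (hKC : Kc ⊆ C)
    (hcont : ContinuousOn (proj Ω) C) (hΨ : ∀ x ∈ C, Ψ (proj Ω x) = x)
    (hfin : μHE[2] C ≠ ⊤) (hfin' : μHE[2] (proj Ω '' C) ≠ ⊤) :
    ∀ᵐ x ∂(μHE[2].restrict S), areaRatio C (proj Ω '' C) Ψ x = projJac Ω e₁ e₂ x := by
  have hSC : S ⊆ C := hP.subset.trans hKC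
  have hpC : MeasurableSet (proj Ω '' C) := (hC.image_of_continuousOn hcont).measurableSet
  have hmeasΨ : AEMeasurable Ψ (μHE[2].restrict (proj Ω '' C)) :=
    (continuousOn_leftInverse hC hcont hΨ).aemeasurable hpC
  have hf1 : IsFiniteMeasure (μHE[2].restrict C : Measure E3) := ⟨by simpa using hfin.lt_top⟩
  have hf2 : IsFiniteMeasure (μHE[2].restrict (proj Ω '' C) : Measure E3) :=
    ⟨by simpa using hfin'.lt_top⟩
  set ν : Measure E3 := μHE[2].restrict C with hν
  set μ₁ : Measure E3 := Measure.map Ψ (μHE[2].restrict (proj Ω '' C)) with hμ₁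
  set f : E3 → ENNReal := fun x => ENNReal.ofReal (projJac Ω e₁ e₂ x) with hf
  have hνS : ν.restrict S = μHE[2].restrict S := by
    rw [hν, Measure.restrict_restrict hP.measurableSet, inter_eq_left.2 hSC]
  have hfm : AEMeasurable (S.indicator f) ν := by
    rw [aemeasurable_indicator_iff hP.measurableSet, hνS]
    exact hP.aemeasurable_jac
  -- The area ratio is a density on the whole surface, but Radon–Nikodym derivatives localize. It is
  -- enough to know the transported measure on S, and there the area formula gives it.
  have hrestr : μ₁.restrict S = ν.withDensity (S.indicator f) := by
    rw [withDensity_indicator hP.measurableSet, hνS]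
    ext B hB
    rw [Measure.restrict_apply hB, hμ₁,
      Measure.map_apply_of_aemeasurable hmeasΨ (hB.inter hP.measurableSet),
      Measure.restrict_apply' hpC, withDensity_apply _ hB, Measure.restrict_restrict hB,
      ← hP.area_image (hB.inter hP.measurableSet) (inter_subset_right.trans hP.subset)]
    congr 1
    ext y
    constructor
    · rintro ⟨hy, x, hx, rfl⟩
      rw [mem_preimage, hΨ x hx] at hy
      exact ⟨x, hy, rfl⟩
    · rintro ⟨x, hx, rfl⟩
      exact ⟨by rwa [mem_preimage, hΨ x (hSC hx.2)], ⟨x, hSC hx.2, rfl⟩⟩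
  have hf3 : IsFiniteMeasure μ₁ := Measure.isFiniteMeasure_map _ _
  have hf4 : IsFiniteMeasure ν := hf1
  have hf5 : μ₁.HaveLebesgueDecomposition ν :=
    Measure.haveLebesgueDecomposition_of_sigmaFinite μ₁ ν
  have h1 := Measure.rnDeriv_restrict μ₁ ν hP.measurableSet
  rw [hrestr] at h1
  have h2 := Measure.rnDeriv_withDensity₀ ν hfm
  have h3 : ∀ᵐ x ∂(μHE[2].restrict S), S.indicator (μ₁.rnDeriv ν) x = S.indicator f x := by
    rw [← hνS]
    refine ae_restrict_of_ae ?_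
    filter_upwards [h1, h2] with x hx hx'
    rw [← hx, hx']
  filter_upwards [h3, ae_restrict_mem hP.measurableSet] with x hx hxS
  rw [indicator_of_mem hxS, indicator_of_mem hxS] at hx
  rw [areaRatio, ← hν, ← hμ₁, hx, hf]
  exact ENNReal.toReal_ofReal (hP.jac_pos (hP.subset hxS)).le

theorem ae_inv (hΨ : ∀ x ∈ Kc, Ψ (proj Ω x) = x) {p : E3 → Prop}
    (h : ∀ᵐ x ∂(μHE[2].restrict S), p x) :
    ∀ᵐ y ∂(μHE[2].restrict (proj Ω '' S)), p (Ψ y) := by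
  refine ae_of_ae_map (hP.aemeasurable_inv hΨ) ?_
  rw [hP.map_inv hΨ]
  exact (withDensity_absolutelyContinuous _ _).ae_le h

theorem map_inv_le (hΨ : ∀ x ∈ Kc, Ψ (proj Ω x) = x) {J : ℝ}
    (hJ : ∀ x ∈ S, projJac Ω e₁ e₂ x ≤ J) :
    Measure.map Ψ (μHE[2].restrict (proj Ω '' S)) ≤ ENNReal.ofReal J • μHE[2].restrict S := by
  rw [hP.map_inv hΨ, ← withDensity_const]
  refine withDensity_mono ?_
  filter_upwards [ae_restrict_mem hP.measurableSet] with x hx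
  exact ENNReal.ofReal_le_ofReal (hJ x hx)

theorem aestronglyMeasurable_map {F : Type*} [NormedAddCommGroup F] (hΨ : ∀ x ∈ Kc, Ψ (proj Ω x) = x)
    {h : E3 → F} (hh : AEStronglyMeasurable h (μHE[2].restrict S)) :
    AEStronglyMeasurable h (Measure.map Ψ (μHE[2].restrict (proj Ω '' S))) := by
  rw [hP.map_inv hΨ]
  exact hh.mono_ac (withDensity_absolutelyContinuous _ _)

theorem integral_inv {F : Type*} [NormedAddCommGroup F] [NormedSpace ℝ F]
    (hΨ : ∀ x ∈ Kc, Ψ (proj Ω x) = x) {h : E3 → F}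
    (hh : AEStronglyMeasurable h (μHE[2].restrict S)) :
    ∫ y in proj Ω '' S, h (Ψ y) ∂μHE[2] = ∫ x in S, projJac Ω e₁ e₂ x • h x ∂μHE[2] := by
  rw [← integral_map (hP.aemeasurable_inv hΨ) (hP.aestronglyMeasurable_map hΨ hh), hP.map_inv hΨ,
    integral_withDensity_eq_integral_toReal_smul₀ hP.aemeasurable_jac
      (Filter.Eventually.of_forall fun x => ENNReal.ofReal_lt_top)]
  refine setIntegral_congr_fun hP.measurableSet fun x hx => ?_
  simp only [ENNReal.toReal_ofReal (hP.jac_pos (hP.subset hx)).le]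

theorem memLp_inv {F : Type*} [NormedAddCommGroup F] (hΨ : ∀ x ∈ Kc, Ψ (proj Ω x) = x)
    {h : E3 → F} (hh : MemLp h 2 (μHE[2].restrict S)) :
    MemLp (fun y => h (Ψ y)) 2 (μHE[2].restrict (proj Ω '' S)) := by
  obtain ⟨J, hJ⟩ := hP.exists_jac_le
  refine (memLp_map_measure_iff (hP.aestronglyMeasurable_map hΨ hh.aestronglyMeasurable)
    (hP.aemeasurable_inv hΨ)).1 ?_
  exact hh.of_measure_le_smul ENNReal.ofReal_ne_top
    (hP.map_inv_le hΨ fun x hx => hJ x (hP.subset hx))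

theorem eLpNorm_inv_le {F : Type*} [NormedAddCommGroup F] (hΨ : ∀ x ∈ Kc, Ψ (proj Ω x) = x)
    {J : ℝ} (hJ : ∀ x ∈ S, projJac Ω e₁ e₂ x ≤ J)
    {h : E3 → F} (hh : AEStronglyMeasurable h (μHE[2].restrict S)) :
    eLpNorm (fun y => h (Ψ y)) 2 (μHE[2].restrict (proj Ω '' S)) ≤
      ENNReal.ofReal J ^ (1 / 2 : ENNReal).toReal * eLpNorm h 2 (μHE[2].restrict S) := by
  have := eLpNorm_map_measure (p := 2) (hP.aestronglyMeasurable_map hΨ hh) (hP.aemeasurable_inv hΨ)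
  rw [Function.comp_def] at this
  rw [← this]
  exact eLpNorm_le_of_measure_le_smul (hP.map_inv_le hΨ hJ)

end FlatPiece

end

noncomputable section

/-! ### The Piola transform preserves `H¹` -/

/-- The cutoff equals 1 near K, not merely on K, so that it alters no derivative at points of K. It
turns fields that are smooth only near a face into globally smooth ones. -/
theorem exists_cutoff {K U : Set E3} (hK : IsCompact K) (hU : IsOpen U) (hKU : K ⊆ U) :
    ∃ χ : E3 → ℝ, ContDiff ℝ ∞ χ ∧ HasCompactSupport χ ∧ tsupport χ ⊆ U ∧
      ∀ x ∈ K, ∀ᶠ z in 𝓝 x, χ z = 1 := by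
  obtain ⟨L, hL, hKL, hLU⟩ := exists_compact_between hK hU hKU
  obtain ⟨f, hf1, hf0, -⟩ := exists_contMDiffMap_one_nhds_of_subset_interior (n := (⊤ : ℕ∞))
    (modelWithCornersSelf ℝ E3) hK.isClosed hKL
  have hsupp : tsupport f ⊆ L := closure_minimal (fun x hx => by
    by_contra hxL; exact hx (hf0 x hxL)) hL.isClosed
  refine ⟨f, f.contMDiff.contDiff, HasCompactSupport.of_support_subset_isCompact hL
    (subset_closure.trans hsupp), hsupp.trans hLU, fun x hx => ?_⟩
  exact (Filter.eventually_iff_exists_mem.2 ⟨_, hf1, fun _ h => h⟩ :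
    ∀ᶠ z in 𝓝ˢ K, f z = 1).filter_mono (nhds_le_nhdsSet hx)

theorem memLp_clm_apply {F G : Type*} [NormedAddCommGroup F] [NormedSpace ℝ F]
    [NormedAddCommGroup G] [NormedSpace ℝ G] {μ : Measure E3} {S Kc : Set E3}
    (hS : MeasurableSet S) (hSK : S ⊆ Kc) (hK : IsCompact Kc) {C : E3 → F →L[ℝ] G}
    (hC : ContinuousOn C Kc) {v : E3 → F} (hv : MemLp v 2 (μ.restrict S)) :
    MemLp (fun x => C x (v x)) 2 (μ.restrict S) := by
  obtain ⟨J, hJ⟩ := hK.exists_bound_of_continuousOn hC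
  have hCm : AEStronglyMeasurable C (μ.restrict S) :=
    (hC.mono hSK).aestronglyMeasurable hS
  refine hv.of_le_mul (c := J) ?_ ?_
  · exact (ContinuousLinearMap.id ℝ (F →L[ℝ] G)).aestronglyMeasurable_comp₂ hCm
      hv.aestronglyMeasurable
  · filter_upwards [ae_restrict_mem hS] with x hx
    exact ((C x).le_opNorm _).trans (by gcongr; exact hJ x (hSK hx))

theorem Filter.EventuallyEq.surfDiv_eq {n φ ψ : E3 → E3} {x : E3} (h : φ =ᶠ[𝓝 x] ψ) :
    surfDiv n φ x = surfDiv n ψ x := by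
  rw [surfDiv, surfDiv, covGrad, covGrad, h.fderiv_eq]

namespace FlatPiece

variable {Ω N : Set E3} {e₁ e₂ m q : E3} {S Kc : Set E3} (hP : FlatPiece Ω N e₁ e₂ m q S Kc)
  {Ψ : E3 → E3} {v : E3 → E3} {A : E3 → Mat3}
include hP

theorem contDiffAt_mat {x : E3} (hx : x ∈ Kc) : ContDiffAt ℝ ∞ (piolaMat Ω e₁ e₂) x :=
  hP.tube.contDiffAt_piolaMat (hP.subset_N hx) (hP.jac_pos hx).ne'

theorem continuousOn_mat : ContinuousOn (piolaMat Ω e₁ e₂) Kc := fun _ hx =>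
  (hP.contDiffAt_mat hx).continuousAt.continuousWithinAt

theorem continuousOn_fderiv_mat : ContinuousOn (fderiv ℝ (piolaMat Ω e₁ e₂)) Kc := fun _ hx =>
  ((hP.contDiffAt_mat hx).fderiv_right (m := 0) (by simp)).continuousAt.continuousWithinAt

theorem continuousOn_tangInv : ContinuousOn (projTangInv Ω e₁ e₂) Kc := fun _ hx =>
  (hP.tube.contDiffAt_projTangInv (hP.subset_N hx)
    (hP.jac_pos hx).ne').continuousAt.continuousWithinAt

theorem memLp_piolaGrad (hv : MemLp v 2 (μHE[2].restrict S)) (hA : MemLp A 2 (μHE[2].restrict S)) :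
    MemLp (piolaGrad Ω e₁ e₂ v A) 2 (μHE[2].restrict S) := by
  have hR : ContinuousOn (fun x => (ContinuousLinearMap.compL ℝ E3 E3 E3).flip
      (projTangInv Ω e₁ e₂ x)) Kc :=
    (ContinuousLinearMap.continuous _).comp_continuousOn hP.continuousOn_tangInv
  have hF : ContinuousOn (fun x => ContinuousLinearMap.compL ℝ E3 E3 E3
      (piolaMat Ω e₁ e₂ x)) Kc :=
    (ContinuousLinearMap.continuous _).comp_continuousOn hP.continuousOn_mat
  have hD : ContinuousOn (fun x => (fderiv ℝ (piolaMat Ω e₁ e₂) x).flip) Kc :=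
    (ContinuousLinearMap.flipₗᵢ ℝ E3 E3 E3).continuous.comp_continuousOn
      hP.continuousOn_fderiv_mat
  have h1 := memLp_clm_apply hP.measurableSet hP.subset hP.compact (hR.clm_comp hD) hv
  have h2 := memLp_clm_apply hP.measurableSet hP.subset hP.compact (hF.clm_comp hR) hA
  exact h1.add h2

theorem closure_subset : closure S ⊆ Kc := closure_minimal hP.subset hP.compact.isClosed

theorem isOpen_regular : IsOpen (N ∩ projJac Ω e₁ e₂ ⁻¹' {0}ᶜ) :=
  ContinuousOn.isOpen_inter_preimage (fun _ hx =>
    (hP.tube.contDiffAt_projJac hx).continuousAt.continuousWithinAt) hP.tube.isOpen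
    isOpen_compl_singleton

/-- The Piola pull-back of a test field is a test field. -/
theorem isTestField_pullback {φ : E3 → E3} {χ : E3 → ℝ} (hφ : IsTestField (proj Ω '' S) (nu Ω) φ)
    (hχ : ContDiff ℝ ∞ χ) (hχc : HasCompactSupport χ)
    (hχs : tsupport χ ⊆ N) :
    IsTestField S (fun _ => m) (fun z => χ z • projCof Ω e₁ e₂ z (φ (proj Ω z))) := by
  refine ⟨contDiff_smul_of_tsupport hχ fun x hx => ?_, hχc.smul_right, ?_, ?_⟩
  · exact (hP.tube.contDiffAt_projCof (hχs hx)).clm_apply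
      (hφ.smooth.contDiffAt.comp x (hP.tube.contDiffAt_proj (hχs hx)))
  -- Such an x is mapped into the support of φ and into the closure of p(S), hence into p(S).
  -- Injectivity of p on the compact piece brings x back to S.
  · rintro x ⟨hx, hxS⟩
    have hxK := hP.closure_subset hxS
    have hpc : ContinuousAt (proj Ω) x := (hP.tube.contDiffAt_proj (hP.subset_N hxK)).continuousAt
    have h1 : proj Ω x ∈ tsupport φ := by
      by_contra hcon
      refine (notMem_tsupport_iff_eventuallyEq.2 ?_) hx
      filter_upwards [hpc.eventually (notMem_tsupport_iff_eventuallyEq.1 hcon)] with z hz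
      rw [hz]; simp
    obtain ⟨x', hx', hxx⟩ := hφ.support ⟨h1, mem_closure_image hpc hxS⟩
    rwa [← hP.inj (hP.subset hx') hxK hxx]
  · intro x _
    simp only [projCof_apply, real_inner_smul_left, inner_add_left]
    rw [real_inner_comm, hP.frame.i1, real_inner_comm, hP.frame.i2]
    ring

/-- The Piola transform maps tangential `H¹` fields to tangential `H¹` fields. -/
theorem piola_h1 (hΨ : ∀ x ∈ Kc, Ψ (proj Ω x) = x) (hA : IsH1Tangential S (fun _ => m) v A)
    {w : E3 → E3}
    (hw : ∀ᵐ y ∂(μHE[2].restrict (proj Ω '' S)), w y = piolaMat Ω e₁ e₂ (Ψ y) (v (Ψ y))) :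
    IsH1Tangential (proj Ω '' S) (nu Ω) w (fun y => piolaGrad Ω e₁ e₂ v A (Ψ y)) := by
  have hSm := hP.measurableSet
  have hFv : MemLp (fun x => piolaMat Ω e₁ e₂ x (v x)) 2 (μHE[2].restrict S) :=
    memLp_clm_apply hSm hP.subset hP.compact hP.continuousOn_mat hA.memLp
  have hB := hP.memLp_piolaGrad hA.memLp hA.memLp_grad
  have hinv : ∀ y ∈ proj Ω '' S, Ψ y ∈ S ∧ proj Ω (Ψ y) = y := by
    rintro _ ⟨x, hx, rfl⟩
    rw [hΨ x (hP.subset hx)]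
    exact ⟨hx, rfl⟩
  have hnu : ∀ y ∈ proj Ω '' S, nu Ω y = nu Ω (Ψ y) := by
    intro y hy
    obtain ⟨h1, h2⟩ := hinv y hy
    rw [← hP.tube.nu_proj _ (hP.subset_N (hP.subset h1)), h2]
  refine ⟨?_, hP.memLp_inv hΨ hB, ?_, ?_, fun φ hφ => ?_⟩
  · exact (memLp_congr_ae hw).2 (hP.memLp_inv hΨ hFv)
  · filter_upwards [hw, ae_restrict_mem hP.measurableSet_image] with y hy hyS
    rw [hy, hnu y hyS, real_inner_comm, piolaMat, smul_apply, real_inner_smul_right,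
      hP.tube.inner_nu_fderiv_proj (hP.subset_N (hP.subset (hinv y hyS).1)), mul_zero]
  · filter_upwards [ae_restrict_mem hP.measurableSet_image] with y hyS
    rw [hnu y hyS, piolaGrad_apply, projTangInv_nu, map_zero, zero_apply, map_zero, map_zero,
      add_zero]
  · obtain ⟨χ, hχ, hχc, hχs, hχ1⟩ := exists_cutoff hP.compact hP.isOpen_regular
      fun x hx => ⟨hP.subset_N hx, (hP.jac_pos hx).ne'⟩
    set ψ : E3 → E3 := fun z => χ z • projCof Ω e₁ e₂ z (φ (proj Ω z)) with hψdef
    have hψ : IsTestField S (fun _ => m) ψ :=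
      hP.isTestField_pullback (χ := χ) (φ := φ) hφ hχ hχc fun x hx => (hχs hx).1
    have hG : ContDiff ℝ ∞ (fun z => χ z • piolaMat Ω e₁ e₂ z) :=
      contDiff_smul_of_tsupport hχ fun x hx =>
        hP.tube.contDiffAt_piolaMat (hχs hx).1 (hχs hx).2
    -- The heart of the proof: the product rule on the flat piece, with the Piola matrix as
    -- multiplier and the cofactor pull-back of φ as test field. The rest rewrites both sides as
    -- integrals over p(S).
    have hmul := hA.weak_mul hP.frame.n3 hSm hP.measure_piece_ne_top hψ hG
    have hdiv : ∀ x ∈ S, surfDiv (fun _ => m) ψ x =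
        projJac Ω e₁ e₂ x * surfDiv (nu Ω) φ (proj Ω x) := by
      intro x hx
      have hxK := hP.subset hx
      have hev : ψ =ᶠ[𝓝 x] fun z => projCof Ω e₁ e₂ z (φ (proj Ω z)) := by
        filter_upwards [hχ1 x hxK] with z hz
        rw [hψdef]
        simp only [hz, one_smul]
      rw [hev.surfDiv_eq, hP.tube.surfDiv_projCof hP.frame (hP.subset_N hxK)
        (hφ.smooth.differentiable (by simp) _)]
      have := hφ.tangential _ ⟨x, hx, rfl⟩
      rwa [hP.tube.nu_proj x (hP.subset_N hxK)] at this
    have hGeq : ∀ x ∈ S, χ x • piolaMat Ω e₁ e₂ x = piolaMat Ω e₁ e₂ x := fun x hx => by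
      rw [(hχ1 x (hP.subset hx)).self_of_nhds, one_smul]
    have hdG : ∀ x ∈ S, fderiv ℝ (fun z => χ z • piolaMat Ω e₁ e₂ z) x =
        fderiv ℝ (piolaMat Ω e₁ e₂) x := fun x hx => by
      refine Filter.EventuallyEq.fderiv_eq ?_
      filter_upwards [hχ1 x (hP.subset hx)] with z hz
      rw [hz, one_smul]
    have hψeq : ∀ x ∈ S, ψ x = projJac Ω e₁ e₂ x • projTangInv Ω e₁ e₂ x (φ (proj Ω x)) := by
      intro x hx
      rw [projTangInv, smul_apply, smul_smul, mul_inv_cancel₀ (hP.jac_pos (hP.subset hx)).ne',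
        one_smul, hψdef]
      simp only [(hχ1 x (hP.subset hx)).self_of_nhds, one_smul]
    -- Measurability of div φ ∘ p is read off from the Piola identity, which expresses it on S by
    -- J⁻¹ and the divergence of ψ, both continuous there.
    have hm1 : AEStronglyMeasurable
        (fun x => surfDiv (nu Ω) φ (proj Ω x) • piolaMat Ω e₁ e₂ x (v x)) (μHE[2].restrict S) := by
      have h1 : AEStronglyMeasurable (fun x => ((projJac Ω e₁ e₂ x)⁻¹ * surfDiv (fun _ => m) ψ x) •
          piolaMat Ω e₁ e₂ x (v x)) (μHE[2].restrict S) := by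
        refine AEStronglyMeasurable.fun_smul ?_ hFv.aestronglyMeasurable
        refine ContinuousOn.aestronglyMeasurable ?_ hSm
        exact ((hP.continuousOn_jac.mono hP.subset).inv₀
          fun x hx => (hP.jac_pos (hP.subset hx)).ne').mul
          (continuous_surfDiv_flat m hψ.smooth).continuousOn
      refine h1.congr ?_
      filter_upwards [ae_restrict_mem hSm] with x hx
      rw [hdiv x hx, inv_mul_cancel_left₀ (hP.jac_pos (hP.subset hx)).ne']
    have hm2 : AEStronglyMeasurable
        (fun x => piolaGrad Ω e₁ e₂ v A x (φ (proj Ω x))) (μHE[2].restrict S) := by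
      refine (ContinuousLinearMap.id ℝ Mat3).aestronglyMeasurable_comp₂ hB.aestronglyMeasurable ?_
      exact ContinuousOn.aestronglyMeasurable
        (hφ.smooth.continuous.comp_continuousOn (hP.continuousOn_proj.mono hP.subset)) hSm
    calc ∫ y in proj Ω '' S, surfDiv (nu Ω) φ y • w y ∂μHE[2]
        = ∫ y in proj Ω '' S, surfDiv (nu Ω) φ (proj Ω (Ψ y)) •
            piolaMat Ω e₁ e₂ (Ψ y) (v (Ψ y)) ∂μHE[2] := by
          refine integral_congr_ae ?_
          filter_upwards [hw, ae_restrict_mem hP.measurableSet_image] with y hy hyS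
          rw [hy, (hinv y hyS).2]
      _ = ∫ x in S, projJac Ω e₁ e₂ x • (surfDiv (nu Ω) φ (proj Ω x) •
            piolaMat Ω e₁ e₂ x (v x)) ∂μHE[2] := hP.integral_inv hΨ hm1
      _ = ∫ x in S, surfDiv (fun _ => m) ψ x • (χ x • piolaMat Ω e₁ e₂ x) (v x) ∂μHE[2] := by
          refine setIntegral_congr_fun hSm fun x hx => ?_
          simp only [hdiv x hx, hGeq x hx, mul_smul]
      _ = -∫ x in S, ((χ x • piolaMat Ω e₁ e₂ x) (A x (ψ x)) +
            fderiv ℝ (fun z => χ z • piolaMat Ω e₁ e₂ z) x (ψ x) (v x)) ∂μHE[2] := hmul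
      _ = -∫ x in S, projJac Ω e₁ e₂ x • piolaGrad Ω e₁ e₂ v A x (φ (proj Ω x)) ∂μHE[2] := by
          congr 1
          refine setIntegral_congr_fun hSm fun x hx => ?_
          simp only [hGeq x hx, hdG x hx, hψeq x hx, piolaGrad_apply, map_smul, smul_apply,
            smul_add]
          rw [add_comm]
      _ = -∫ y in proj Ω '' S, piolaGrad Ω e₁ e₂ v A (Ψ y) (φ (proj Ω (Ψ y))) ∂μHE[2] := by
          rw [hP.integral_inv hΨ hm2]
      _ = -∫ y in proj Ω '' S, piolaGrad Ω e₁ e₂ v A (Ψ y) (φ y) ∂μHE[2] := by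
          congr 1
          refine setIntegral_congr_fun hP.measurableSet_image fun y hy => ?_
          simp only [(hinv y hy).2]

end FlatPiece

end

noncomputable section

/-! ### The pointwise estimate -/

theorem tri_sub_right (a b c c' : E3) : tri a b (c - c') = tri a b c - tri a b c' :=
  inner_sub_right _ _ _

/-- The tangent plane of the surface at `x` is `ε`-close to the plane with the frame `e₁, e₂, m`. -/
structure NearFlat (Ω N : Set E3) (e₁ e₂ m : E3) (K ε : ℝ) (x : E3) : Prop where
  frame : IsFrame e₁ e₂ m
  tube : TubeNbhd Ω N
  mem : x ∈ N
  one_le : 1 ≤ K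
  nonneg : 0 ≤ ε
  le : ε ≤ K
  norm_fderiv : ‖fderiv ℝ (nu Ω) x‖ ≤ K
  norm_fderiv2 : ‖fderiv ℝ (fderiv ℝ (nu Ω)) x‖ ≤ K
  sdist_le : |sdist Ω x| ≤ ε
  normal_le : ‖nu Ω x - m‖ ≤ ε
  jac_pos : 0 < projJac Ω e₁ e₂ x
  jac_inv_le : (projJac Ω e₁ e₂ x)⁻¹ ≤ K

namespace NearFlat

variable {Ω N : Set E3} {e₁ e₂ m : E3} {K ε : ℝ} {x : E3} (h : NearFlat Ω N e₁ e₂ m K ε x)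
include h

theorem norm_nu : ‖nu Ω x‖ = 1 := h.tube.norm_nu x h.mem

theorem K_nonneg : 0 ≤ K := zero_le_one.trans h.one_le

theorem abs_inner_nu_le {w : E3} (hw : ⟪m, w⟫ = 0) : |⟪nu Ω x, w⟫| ≤ ε * ‖w‖ := by
  have : ⟪nu Ω x, w⟫ = ⟪nu Ω x - m, w⟫ := by rw [inner_sub_left, hw, sub_zero]
  rw [this]
  exact (abs_real_inner_le_norm _ _).trans (by gcongr; exact h.normal_le)

theorem norm_fderiv_apply (w : E3) : ‖fderiv ℝ (nu Ω) x w‖ ≤ K * ‖w‖ :=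
  (ContinuousLinearMap.le_opNorm _ _).trans (by gcongr; exact h.norm_fderiv)

theorem norm_sdist_smul_le (w : E3) :
    ‖sdist Ω x • fderiv ℝ (nu Ω) x w‖ ≤ ε * (K * ‖w‖) := by
  rw [norm_smul, Real.norm_eq_abs]
  exact mul_le_mul h.sdist_le (h.norm_fderiv_apply w) (norm_nonneg _) h.nonneg

/-- The difference is −⟪ν, w⟫ ν − d H w. Its first term is small as ν is near m ⊥ w, its second as d
is small. -/
theorem norm_fderiv_proj_sub_le {w : E3} (hw : ⟪m, w⟫ = 0) :
    ‖fderiv ℝ (proj Ω) x w - w‖ ≤ 2 * K * ε * ‖w‖ := by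
  have h1 : fderiv ℝ (proj Ω) x w - w =
      -(⟪nu Ω x, w⟫ • nu Ω x + sdist Ω x • fderiv ℝ (nu Ω) x w) := by
    rw [h.tube.fderiv_proj_apply h.mem, tangProj_apply]; abel
  rw [h1, norm_neg]
  have h2 : ‖⟪nu Ω x, w⟫ • nu Ω x‖ ≤ ε * ‖w‖ := by
    rw [norm_smul, h.norm_nu, mul_one]; exact h.abs_inner_nu_le hw
  have h3 := h.norm_sdist_smul_le w
  have h4 : ε * ‖w‖ ≤ K * (ε * ‖w‖) :=
    le_mul_of_one_le_left (mul_nonneg h.nonneg (norm_nonneg _)) h.one_le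
  linarith [norm_add_le (⟪nu Ω x, w⟫ • nu Ω x) (sdist Ω x • fderiv ℝ (nu Ω) x w)]

theorem norm_fderiv_proj_le (w : E3) : ‖fderiv ℝ (proj Ω) x w‖ ≤ 2 * K ^ 2 * ‖w‖ := by
  rw [h.tube.fderiv_proj_apply h.mem]
  have h1 := norm_tangProj_apply_le h.norm_nu w
  have h2 := h.norm_sdist_smul_le w
  have h3 : ε * (K * ‖w‖) ≤ K * (K * ‖w‖) := by
    have := h.K_nonneg
    gcongr
    exact h.le
  have h4 : 1 * ‖w‖ ≤ K ^ 2 * ‖w‖ := by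
    gcongr
    exact one_le_pow₀ h.one_le
  linarith [norm_sub_le (tangProj (nu Ω x) w) (sdist Ω x • fderiv ℝ (nu Ω) x w)]

/-- Replace the three columns of the determinant one at a time, starting from det(e₁, e₂, m) = 1. -/
theorem abs_projJac_sub_one_le : |projJac Ω e₁ e₂ x - 1| ≤ 7 * K ^ 3 * ε := by
  have hX1 := h.norm_fderiv_proj_sub_le h.frame.i1
  have hX2 := h.norm_fderiv_proj_sub_le h.frame.i2
  have hX2' := h.norm_fderiv_proj_le e₂
  rw [h.frame.n1, mul_one] at hX1
  rw [h.frame.n2, mul_one] at hX2 hX2'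
  set X₁ := fderiv ℝ (proj Ω) x e₁
  set X₂ := fderiv ℝ (proj Ω) x e₂
  have h1 : projJac Ω e₁ e₂ x - 1 = tri (X₁ - e₁) X₂ (nu Ω x) + tri e₁ (X₂ - e₂) (nu Ω x) +
      tri e₁ e₂ (nu Ω x - m) := by
    rw [tri_sub_left, tri_sub_mid, tri_sub_right, h.frame.tri_eq_one, projJac]; ring
  have a1 := abs_tri_le (X₁ - e₁) X₂ (nu Ω x)
  have a2 := abs_tri_le e₁ (X₂ - e₂) (nu Ω x)
  have a3 := abs_tri_le e₁ e₂ (nu Ω x - m)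
  rw [h.norm_nu, mul_one] at a1 a2
  rw [h.frame.n1, one_mul] at a2 a3
  rw [h.frame.n2, one_mul] at a3
  have b1 : ‖X₁ - e₁‖ * ‖X₂‖ ≤ 2 * K * ε * (2 * K ^ 2) :=
    mul_le_mul hX1 hX2' (norm_nonneg _)
      (mul_nonneg (mul_nonneg zero_le_two h.K_nonneg) h.nonneg)
  have c1 : K * ε ≤ K ^ 3 * ε :=
    mul_le_mul_of_nonneg_right (le_self_pow₀ h.one_le (by norm_num)) h.nonneg
  have c2 : 1 * ε ≤ K ^ 3 * ε := mul_le_mul_of_nonneg_right (one_le_pow₀ h.one_le) h.nonneg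
  rw [h1]
  refine (abs_add_three _ _ _).trans ?_
  linarith [h.normal_le]

theorem projJac_le : projJac Ω e₁ e₂ x ≤ 8 * K ^ 4 := by
  have h1 := (abs_le.1 h.abs_projJac_sub_one_le).2
  have h2 : 7 * K ^ 3 * ε ≤ 7 * K ^ 3 * K :=
    mul_le_mul_of_nonneg_left h.le (by have := h.K_nonneg; positivity)
  have h3 : 1 ≤ K ^ 4 := one_le_pow₀ h.one_le
  linarith

theorem jac_inv_pos : 0 < (projJac Ω e₁ e₂ x)⁻¹ := inv_pos.2 h.jac_pos

theorem abs_inv_sub_one_le : |(projJac Ω e₁ e₂ x)⁻¹ - 1| ≤ 7 * K ^ 4 * ε := by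
  have h1 : (projJac Ω e₁ e₂ x)⁻¹ - 1 =
      (projJac Ω e₁ e₂ x)⁻¹ * -(projJac Ω e₁ e₂ x - 1) := by
    rw [neg_sub, mul_sub, mul_one, inv_mul_cancel₀ h.jac_pos.ne']
  rw [h1, abs_mul, abs_neg, abs_of_pos h.jac_inv_pos]
  refine (mul_le_mul h.jac_inv_le h.abs_projJac_sub_one_le (abs_nonneg _) h.K_nonneg).trans
    (le_of_eq (by ring))

/-- If `a` is close to `w` then so is `a` divided by the area element. -/
theorem norm_inv_smul_sub_le {a w : E3} {B : ℝ} (ha : ‖a - w‖ ≤ B) :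
    ‖(projJac Ω e₁ e₂ x)⁻¹ • a - w‖ ≤ K * B + 7 * K ^ 4 * ε * ‖w‖ := by
  have h1 : (projJac Ω e₁ e₂ x)⁻¹ • a - w =
      (projJac Ω e₁ e₂ x)⁻¹ • (a - w) + ((projJac Ω e₁ e₂ x)⁻¹ - 1) • w := by
    rw [smul_sub, sub_smul, one_smul]; abel
  rw [h1]
  refine (norm_add_le _ _).trans ?_
  rw [norm_smul, norm_smul, Real.norm_eq_abs, Real.norm_eq_abs, abs_of_pos h.jac_inv_pos]
  have := h.K_nonneg
  gcongr
  · exact h.jac_inv_le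
  · exact h.abs_inv_sub_one_le

theorem pow_mul_le {i j : ℕ} (hij : i ≤ j) {r : ℝ} (hr : 0 ≤ r) : K ^ i * r ≤ K ^ j * r :=
  mul_le_mul_of_nonneg_right (pow_le_pow_right₀ h.one_le hij) hr

theorem norm_piolaMat_sub_le {w : E3} (hw : ⟪m, w⟫ = 0) :
    ‖piolaMat Ω e₁ e₂ x w - w‖ ≤ 9 * K ^ 4 * (ε * ‖w‖) := by
  have h1 := h.norm_inv_smul_sub_le (h.norm_fderiv_proj_sub_le hw)
  rw [piolaMat, smul_apply]
  have h2 := h.pow_mul_le (show 2 ≤ 4 by norm_num) (mul_nonneg h.nonneg (norm_nonneg w))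
  linarith

theorem norm_piolaMat_le (w : E3) : ‖piolaMat Ω e₁ e₂ x w‖ ≤ 2 * K ^ 3 * ‖w‖ := by
  rw [piolaMat, smul_apply, norm_smul, Real.norm_eq_abs, abs_of_pos h.jac_inv_pos]
  refine (mul_le_mul h.jac_inv_le (h.norm_fderiv_proj_le w) (norm_nonneg _) h.K_nonneg).trans
    (le_of_eq (by ring))

theorem norm_projCof_sub_le (w : E3) :
    ‖projCof Ω e₁ e₂ x w - tangProj m w‖ ≤ 6 * K * ε * ‖w‖ := by
  have hX1 := h.norm_fderiv_proj_sub_le h.frame.i1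
  have hX2 := h.norm_fderiv_proj_sub_le h.frame.i2
  rw [h.frame.n1, mul_one] at hX1
  rw [h.frame.n2, mul_one] at hX2
  have e1 : ⟪e₁, w⟫ = tri w e₂ m := by rw [← inner_cr_left, h.frame.cr2]
  have e2 : ⟪e₂, w⟫ = tri e₁ w m := by rw [tri_rot, ← inner_cr_left, h.frame.cr1]
  rw [projCof_apply, h.frame.tangProj_eq, e1, e2, add_sub_add_comm, ← sub_smul, ← sub_smul]
  set X₁ := fderiv ℝ (proj Ω) x e₁
  set X₂ := fderiv ℝ (proj Ω) x e₂
  have f1 : tri w X₂ (nu Ω x) - tri w e₂ m = tri w (X₂ - e₂) (nu Ω x) + tri w e₂ (nu Ω x - m) := by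
    rw [tri_sub_mid, tri_sub_right]; ring
  have f2 : tri X₁ w (nu Ω x) - tri e₁ w m = tri (X₁ - e₁) w (nu Ω x) + tri e₁ w (nu Ω x - m) := by
    rw [tri_sub_left, tri_sub_right]; ring
  have a1 := abs_tri_le w (X₂ - e₂) (nu Ω x)
  have a2 := abs_tri_le w e₂ (nu Ω x - m)
  have a3 := abs_tri_le (X₁ - e₁) w (nu Ω x)
  have a4 := abs_tri_le e₁ w (nu Ω x - m)
  rw [h.norm_nu, mul_one] at a1 a3
  rw [h.frame.n2, mul_one] at a2
  rw [h.frame.n1, one_mul] at a4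
  have b1 := mul_le_mul_of_nonneg_left hX2 (norm_nonneg w)
  have b2 := mul_le_mul_of_nonneg_left h.normal_le (norm_nonneg w)
  have b3 := mul_le_mul_of_nonneg_right hX1 (norm_nonneg w)
  have c1 := mul_le_mul_of_nonneg_right h.one_le (mul_nonneg h.nonneg (norm_nonneg w))
  refine (norm_add_le _ _).trans ?_
  rw [norm_smul, norm_smul, h.frame.n1, h.frame.n2, mul_one, mul_one, f1, f2, Real.norm_eq_abs,
    Real.norm_eq_abs]
  have d1 := abs_add_le (tri w (X₂ - e₂) (nu Ω x)) (tri w e₂ (nu Ω x - m))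
  have d2 := abs_add_le (tri (X₁ - e₁) w (nu Ω x)) (tri e₁ w (nu Ω x - m))
  linarith

theorem norm_projTangInv_sub_le (w : E3) :
    ‖projTangInv Ω e₁ e₂ x w - tangProj m w‖ ≤ 13 * K ^ 4 * (ε * ‖w‖) := by
  have h1 := h.norm_inv_smul_sub_le (h.norm_projCof_sub_le w)
  rw [projTangInv, smul_apply]
  have h2 := h.pow_mul_le (show 2 ≤ 4 by norm_num) (mul_nonneg h.nonneg (norm_nonneg w))
  have h3 : 7 * K ^ 4 * ε * ‖tangProj m w‖ ≤ 7 * K ^ 4 * ε * ‖w‖ :=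
    mul_le_mul_of_nonneg_left (norm_tangProj_apply_le h.frame.n3 w)
      (mul_nonneg (by have := h.K_nonneg; positivity) h.nonneg)
  linarith

theorem norm_projTangInv_le (w : E3) : ‖projTangInv Ω e₁ e₂ x w‖ ≤ 14 * K ^ 5 * ‖w‖ := by
  have h1 := h.norm_projTangInv_sub_le w
  have h2 := norm_tangProj_apply_le h.frame.n3 w
  have h3 : 13 * K ^ 4 * (ε * ‖w‖) ≤ 13 * K ^ 4 * (K * ‖w‖) := by
    have := h.K_nonneg
    gcongr
    exact h.le
  have h4 := h.pow_mul_le (show 0 ≤ 5 by norm_num) (norm_nonneg w)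
  have h5 := norm_add_le (projTangInv Ω e₁ e₂ x w - tangProj m w) (tangProj m w)
  rw [sub_add_cancel] at h5
  linarith

theorem inner_projTangInv (w : E3) : ⟪m, projTangInv Ω e₁ e₂ x w⟫ = 0 := by
  rw [projTangInv, smul_apply, projCof_apply, real_inner_smul_right, inner_add_right,
    real_inner_smul_right, real_inner_smul_right, h.frame.i1, h.frame.i2]
  ring

theorem tangProj_fderiv_proj (w : E3) :
    tangProj (nu Ω x) (fderiv ℝ (proj Ω) x w) = fderiv ℝ (proj Ω) x w :=
  tangProj_of_inner (h.tube.inner_nu_fderiv_proj h.mem w)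

theorem fderiv_fderiv_proj (t a : E3) : fderiv ℝ (fderiv ℝ (proj Ω)) x t a =
    -(⟪fderiv ℝ (nu Ω) x t, a⟫ • nu Ω x + ⟪nu Ω x, a⟫ • fderiv ℝ (nu Ω) x t +
      (⟪nu Ω x, t⟫ • fderiv ℝ (nu Ω) x a + sdist Ω x • fderiv ℝ (fderiv ℝ (nu Ω)) x t a)) := by
  have hpp : HasFDerivAt (fderiv ℝ (proj Ω)) (fderiv ℝ (fderiv ℝ (proj Ω)) x) x :=
    ((h.tube.contDiffAt_fderiv_proj h.mem).differentiableAt (by simp)).hasFDerivAt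
  have h1 := (ContinuousLinearMap.apply ℝ E3 a).hasFDerivAt.comp x hpp
  have hHd : HasFDerivAt (fderiv ℝ (nu Ω)) (fderiv ℝ (fderiv ℝ (nu Ω)) x) x :=
    ((h.tube.contDiffAt_fderiv_nu h.mem).differentiableAt (by simp)).hasFDerivAt
  have hH := (ContinuousLinearMap.apply ℝ E3 a).hasFDerivAt.comp x hHd
  have hn := h.tube.hasFDerivAt_nu h.mem
  have h2 : HasFDerivAt (fun z => a - ⟪nu Ω z, a⟫ • nu Ω z - sdist Ω z • fderiv ℝ (nu Ω) z a) _ x :=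
    (((hasFDerivAt_const a x).sub ((hn.inner ℝ (hasFDerivAt_const a x)).smul hn)).sub
      ((h.tube.hasFDerivAt_sdist h.mem).smul hH))
  have h3 : (fun z => fderiv ℝ (proj Ω) z a) =ᶠ[𝓝 x]
      fun z => a - ⟪nu Ω z, a⟫ • nu Ω z - sdist Ω z • fderiv ℝ (nu Ω) z a := by
    filter_upwards [h.tube.mem_nhds h.mem] with z hz
    rw [h.tube.fderiv_proj_apply hz, tangProj_apply]
  have h4 := congrArg (fun L => L t) (h1.unique (h2.congr_of_eventuallyEq h3))
  simp only [ContinuousLinearMap.comp_apply, ContinuousLinearMap.apply_apply] at h4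
  rw [h4]
  simp
  abel

/-- The decisive cancellation: the only term of D²p(t, a) of order one is −⟪H t, a⟫ ν, and the
projection removes it. Every other term carries ⟪ν, a⟫, ⟪ν, t⟫ or d. -/
theorem norm_tangProj_fderiv_fderiv_proj_le {t a : E3} (ht : ⟪m, t⟫ = 0) (ha : ⟪m, a⟫ = 0) :
    ‖tangProj (nu Ω x) (fderiv ℝ (fderiv ℝ (proj Ω)) x t a)‖ ≤ 3 * K * ε * (‖t‖ * ‖a‖) := by
  rw [h.fderiv_fderiv_proj, map_neg, norm_neg, map_add, map_add, map_smul, tangProj_self h.norm_nu,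
    smul_zero, zero_add, ← map_add]
  refine (norm_tangProj_apply_le h.norm_nu _).trans ?_
  have h1 : ‖⟪nu Ω x, a⟫ • fderiv ℝ (nu Ω) x t‖ ≤ ε * ‖a‖ * (K * ‖t‖) := by
    rw [norm_smul]
    exact mul_le_mul (h.abs_inner_nu_le ha) (h.norm_fderiv_apply t) (norm_nonneg _)
      (mul_nonneg h.nonneg (norm_nonneg _))
  have h2 : ‖⟪nu Ω x, t⟫ • fderiv ℝ (nu Ω) x a‖ ≤ ε * ‖t‖ * (K * ‖a‖) := by
    rw [norm_smul]
    exact mul_le_mul (h.abs_inner_nu_le ht) (h.norm_fderiv_apply a) (norm_nonneg _)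
      (mul_nonneg h.nonneg (norm_nonneg _))
  have h3 : ‖sdist Ω x • fderiv ℝ (fderiv ℝ (nu Ω)) x t a‖ ≤ ε * (K * ‖t‖ * ‖a‖) := by
    rw [norm_smul]
    refine mul_le_mul h.sdist_le ?_ (norm_nonneg _) h.nonneg
    exact (ContinuousLinearMap.le_opNorm₂ _ _ _).trans (by gcongr; exact h.norm_fderiv2)
  refine (norm_add_le _ _).trans ?_
  have h4 := norm_add_le (⟪nu Ω x, t⟫ • fderiv ℝ (nu Ω) x a)
    (sdist Ω x • fderiv ℝ (fderiv ℝ (nu Ω)) x t a)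
  linarith

theorem abs_tri_tangProj_le {a b : E3} : |tri a b (nu Ω x)| ≤ ‖tangProj (nu Ω x) a‖ * ‖b‖ := by
  have h1 : tri a b (nu Ω x) = tri (tangProj (nu Ω x) a) b (nu Ω x) := by
    rw [tangProj_apply, tri_sub_left, tri_smul_left, tri_self_outer]; ring
  rw [h1]
  simpa [h.norm_nu] using abs_tri_le (tangProj (nu Ω x) a) b (nu Ω x)

/-- With ν in the third slot only the tangential part of D²p contributes, and it is small. The term
with Dν is a determinant of three tangent vectors, hence zero. Each of the two remaining terms is at
most 3Kε · 2K² |t|. -/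
theorem abs_fderiv_projJac_le {t : E3} (ht : ⟪m, t⟫ = 0) :
    |fderiv ℝ (projJac Ω e₁ e₂) x t| ≤ 12 * K ^ 3 * ε * ‖t‖ := by
  have hpp : HasFDerivAt (fderiv ℝ (proj Ω)) (fderiv ℝ (fderiv ℝ (proj Ω)) x) x :=
    ((h.tube.contDiffAt_fderiv_proj h.mem).differentiableAt (by simp)).hasFDerivAt
  have hD : ∀ e, HasFDerivAt (fun z => fderiv ℝ (proj Ω) z e)
      ((ContinuousLinearMap.apply ℝ E3 e).comp (fderiv ℝ (fderiv ℝ (proj Ω)) x)) x := fun e =>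
    (ContinuousLinearMap.apply ℝ E3 e).hasFDerivAt.comp x hpp
  have h1 := hasFDerivAt_tri_apply (hD e₁) (hD e₂) (h.tube.hasFDerivAt_nu h.mem) t
  have hz : tri (fderiv ℝ (proj Ω) x e₁) (fderiv ℝ (proj Ω) x e₂) (fderiv ℝ (nu Ω) x t) = 0 :=
    tri_eq_zero_of_inner (n := nu Ω x) (by rw [← norm_ne_zero_iff, h.norm_nu]; exact one_ne_zero)
      (by rw [real_inner_comm]; exact h.tube.inner_nu_fderiv_proj h.mem _)
      (by rw [real_inner_comm]; exact h.tube.inner_nu_fderiv_proj h.mem _)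
      (by rw [real_inner_comm]; exact h.tube.inner_nu_fderiv_nu h.mem _)
  simp only [ContinuousLinearMap.comp_apply, ContinuousLinearMap.apply_apply] at h1
  rw [hz, add_zero, tri_swap (fderiv ℝ (proj Ω) x e₁)] at h1
  have h2 : fderiv ℝ (projJac Ω e₁ e₂) x t = _ := h1
  rw [h2]
  refine (abs_add_le _ _).trans ?_
  rw [abs_neg]
  have hX1 := h.norm_fderiv_proj_le e₁
  have hX2 := h.norm_fderiv_proj_le e₂
  have hY1 := h.norm_tangProj_fderiv_fderiv_proj_le ht h.frame.i1
  have hY2 := h.norm_tangProj_fderiv_fderiv_proj_le ht h.frame.i2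
  rw [h.frame.n1, mul_one] at hX1 hY1
  rw [h.frame.n2, mul_one] at hX2 hY2
  have hpos : 0 ≤ 3 * K * ε * ‖t‖ :=
    mul_nonneg (mul_nonneg (by linarith [h.K_nonneg]) h.nonneg) (norm_nonneg _)
  have a1 := h.abs_tri_tangProj_le.trans (mul_le_mul hY1 hX2 (norm_nonneg _) hpos)
  have a2 := h.abs_tri_tangProj_le.trans (mul_le_mul hY2 hX1 (norm_nonneg _) hpos)
  linarith

/-- The derivative of J⁻¹ Dp is J⁻¹ D²p − J⁻² (DJ) Dp. The tangential part of D²p and the derivative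
of J are both O(ε), with constants 3K² and 24K⁷. -/
theorem norm_tangProj_fderiv_piolaMat_le {t v : E3} (ht : ⟪m, t⟫ = 0) (hv : ⟪m, v⟫ = 0) :
    ‖tangProj (nu Ω x) (fderiv ℝ (piolaMat Ω e₁ e₂) x t v)‖ ≤
      27 * K ^ 7 * ε * (‖t‖ * ‖v‖) := by
  have hpp : HasFDerivAt (fderiv ℝ (proj Ω)) (fderiv ℝ (fderiv ℝ (proj Ω)) x) x :=
    ((h.tube.contDiffAt_fderiv_proj h.mem).differentiableAt (by simp)).hasFDerivAt
  have hj : HasFDerivAt (projJac Ω e₁ e₂) (fderiv ℝ (projJac Ω e₁ e₂) x) x :=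
    ((h.tube.contDiffAt_projJac h.mem).differentiableAt (by simp)).hasFDerivAt
  have h1 : HasFDerivAt (piolaMat Ω e₁ e₂) _ x :=
    ((hasDerivAt_inv h.jac_pos.ne').comp_hasFDerivAt x hj).smul hpp
  have h2 : fderiv ℝ (piolaMat Ω e₁ e₂) x t v =
      (projJac Ω e₁ e₂ x)⁻¹ • fderiv ℝ (fderiv ℝ (proj Ω)) x t v -
      ((projJac Ω e₁ e₂ x)⁻¹ ^ 2 * fderiv ℝ (projJac Ω e₁ e₂) x t) • fderiv ℝ (proj Ω) x v := by
    rw [h1.fderiv]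
    simp [sub_eq_add_neg]
  rw [h2, map_sub, map_smul, map_smul, h.tangProj_fderiv_proj]
  refine (norm_sub_le _ _).trans ?_
  rw [norm_smul, norm_smul, norm_mul, norm_pow, Real.norm_eq_abs, Real.norm_eq_abs,
    abs_of_pos h.jac_inv_pos]
  have hK := h.K_nonneg
  have he := h.nonneg
  have a1 : (projJac Ω e₁ e₂ x)⁻¹ * ‖tangProj (nu Ω x) (fderiv ℝ (fderiv ℝ (proj Ω)) x t v)‖ ≤
      K * (3 * K * ε * (‖t‖ * ‖v‖)) :=
    mul_le_mul h.jac_inv_le (h.norm_tangProj_fderiv_fderiv_proj_le ht hv) (norm_nonneg _) hK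
  have a2 : (projJac Ω e₁ e₂ x)⁻¹ ^ 2 * |fderiv ℝ (projJac Ω e₁ e₂) x t| *
      ‖fderiv ℝ (proj Ω) x v‖ ≤ K ^ 2 * (12 * K ^ 3 * ε * ‖t‖) * (2 * K ^ 2 * ‖v‖) := by
    have hip := h.jac_inv_pos.le
    gcongr
    · exact h.jac_inv_le
    · exact h.abs_fderiv_projJac_le ht
    · exact h.norm_fderiv_proj_le v
  have a3 := h.pow_mul_le (show 2 ≤ 7 by norm_num)
    (mul_nonneg h.nonneg (mul_nonneg (norm_nonneg t) (norm_nonneg v)))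
  linarith

/-- The covariant derivative of the Piola transform differs little from the one of the field. -/
theorem norm_covGrad_sub_le {v : E3 → E3} {A : E3 → Mat3} (hv : ⟪m, v x⟫ = 0)
    (hA : covGrad (fun _ => m) A x = A x) :
    ‖tangProj (nu Ω x) ∘L piolaGrad Ω e₁ e₂ v A x ∘L tangProj (nu Ω x) - A x‖ ≤
      378 * K ^ 12 * ε * (‖A x‖ + ‖v x‖) := by
  have hK := h.K_nonneg
  have he := h.nonneg
  refine ContinuousLinearMap.opNorm_le_bound _ (by positivity) fun w => ?_
  have hAm : ∀ w, ⟪m, A x w⟫ = 0 := fun w => by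
    rw [← hA, covGrad]
    exact inner_tangProj h.frame.n3 _
  have hAP : ∀ w, A x (tangProj m w) = A x w := fun w => by
    have hPP : tangProj m (tangProj m w) = tangProj m w :=
      tangProj_of_inner (inner_tangProj h.frame.n3 w)
    rw [← hA, covGrad]
    simp only [ContinuousLinearMap.comp_apply, hPP]
  set R := projTangInv Ω e₁ e₂ x with hR
  set F := piolaMat Ω e₁ e₂ x with hF
  have hRP : R (tangProj (nu Ω x) w) = R w := by
    rw [tangProj_apply, map_sub, map_smul, hR, projTangInv_nu, smul_zero, sub_zero]
  have hFP : ∀ w, tangProj (nu Ω x) (F w) = F w := fun w => by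
    rw [hF, piolaMat, smul_apply, map_smul, h.tangProj_fderiv_proj]
  -- Three errors: the derivative of F, the deviation of R from the flat projection, and the
  -- deviation of F from the identity on the range of A. The first gives the factor 27 · 14 = 378 on
  -- |v|; the other two give at most 26 + 9 on |A|.
  have heq : (tangProj (nu Ω x) ∘L piolaGrad Ω e₁ e₂ v A x ∘L tangProj (nu Ω x) - A x) w =
      tangProj (nu Ω x) (fderiv ℝ (piolaMat Ω e₁ e₂) x (R w) (v x)) +
        (F (A x (R w - tangProj m w)) + (F (A x w) - A x w)) := by
    rw [sub_apply, ContinuousLinearMap.comp_apply, ContinuousLinearMap.comp_apply,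
      piolaGrad_apply, hRP, map_add, hFP, map_sub, hAP, map_sub]
    abel
  rw [heq]
  have a1 := h.norm_tangProj_fderiv_piolaMat_le (h.inner_projTangInv w) hv
  have a2 : 27 * K ^ 7 * ε * (‖R w‖ * ‖v x‖) ≤
      27 * K ^ 7 * ε * (14 * K ^ 5 * ‖w‖ * ‖v x‖) := by
    gcongr
    exact h.norm_projTangInv_le w
  have a3 : ‖F (A x (R w - tangProj m w))‖ ≤
      2 * K ^ 3 * (‖A x‖ * (13 * K ^ 4 * (ε * ‖w‖))) := by
    refine (h.norm_piolaMat_le _).trans ?_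
    gcongr
    refine ((A x).le_opNorm _).trans ?_
    gcongr
    exact h.norm_projTangInv_sub_le w
  have a4 : ‖F (A x w) - A x w‖ ≤ 9 * K ^ 4 * (ε * (‖A x‖ * ‖w‖)) := by
    refine (h.norm_piolaMat_sub_le (hAm w)).trans ?_
    gcongr
    exact (A x).le_opNorm _
  have hr : 0 ≤ ε * (‖A x‖ * ‖w‖) := by positivity
  have a5 := h.pow_mul_le (show 7 ≤ 12 by norm_num) hr
  have a6 := h.pow_mul_le (show 4 ≤ 12 by norm_num) hr
  have a7 : 0 ≤ K ^ 12 * (ε * (‖A x‖ * ‖w‖)) := by positivity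
  refine (norm_add_le _ _).trans ?_
  have a8 := norm_add_le (F (A x (R w - tangProj m w))) (F (A x w) - A x w)
  linarith

end NearFlat

/-- The symmetric part of a matrix is not larger than the matrix. -/
theorem norm_symm_part_le (D : Mat3) :
    ‖(1 / 2 : ℝ) • (D + ContinuousLinearMap.adjoint D)‖ ≤ ‖D‖ := by
  rw [norm_smul]
  have h1 := norm_add_le D (ContinuousLinearMap.adjoint D)
  rw [LinearIsometryEquiv.norm_map] at h1
  norm_num
  linarith

theorem norm_deform_sub_le (n n' : E3 → E3) (A B : E3 → Mat3) (x y : E3) :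
    ‖deform n B y - deform n' A x‖ ≤ ‖covGrad n B y - covGrad n' A x‖ := by
  refine le_trans (le_of_eq ?_) (norm_symm_part_le _)
  rw [deform, deform, map_sub]
  congr 1
  module

end

noncomputable section

/-! ### The estimate on a flat piece -/

theorem continuous_tangProj_conj (m : E3) :
    Continuous fun T : Mat3 => tangProj m ∘L T ∘L tangProj m :=
  continuous_const.clm_comp (continuous_id.clm_comp continuous_const)

theorem aestronglyMeasurable_covGrad {μ : Measure E3} {m : E3} {A : E3 → Mat3}
    (hA : AEStronglyMeasurable A μ) : AEStronglyMeasurable (covGrad (fun _ => m) A) μ :=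
  (continuous_tangProj_conj m).comp_aestronglyMeasurable hA

theorem aestronglyMeasurable_deform {μ : Measure E3} {m : E3} {A : E3 → Mat3}
    (hA : AEStronglyMeasurable A μ) : AEStronglyMeasurable (deform (fun _ => m) A) μ := by
  have h : Continuous fun T : Mat3 => (1 / 2 : ℝ) • (T + ContinuousLinearMap.adjoint T) :=
    (continuous_id.add (ContinuousLinearMap.adjoint (𝕜 := ℝ) (E := E3) (F := E3)).continuous).const_smul
      (1 / 2 : ℝ)
  exact h.comp_aestronglyMeasurable (aestronglyMeasurable_covGrad hA)

namespace FlatPiece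

variable {Ω N : Set E3} {e₁ e₂ m q : E3} {S Kc : Set E3} (hP : FlatPiece Ω N e₁ e₂ m q S Kc)
  {Ψ : E3 → E3} {v w : E3 → E3} {A B : E3 → Mat3}
include hP

theorem covGrad_eq (hA : IsH1Tangential S (fun _ => m) v A) :
    ∀ᵐ x ∂(μHE[2].restrict S), covGrad (fun _ => m) A x = A x :=
  hA.covGrad_flat hP.frame.n3 hP.measure_piece_ne_top hP.measurableSet
    hP.compact_bdry.isClosed.isOpen_compl (fun _ hx hx' => hx'.2 hx) fun x hx => by
      by_contra hxS
      exact hx.1 ⟨hP.closure_subset hx.2, hxS⟩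

/-- The weak Jacobian of the Piola transform. -/
theorem weak_jacobian_eq (hΨ : ∀ x ∈ Kc, Ψ (proj Ω x) = x)
    (hA : IsH1Tangential S (fun _ => m) v A)
    (hw : ∀ᵐ y ∂(μHE[2].restrict (proj Ω '' S)), w y = piolaMat Ω e₁ e₂ (Ψ y) (v (Ψ y)))
    (hB : IsH1Tangential (proj Ω '' S) (nu Ω) w B) :
    ∀ᵐ y ∂(μHE[2].restrict (proj Ω '' S)), B y = piolaGrad Ω e₁ e₂ v A (Ψ y) := by
  have himg : ∀ x ∈ Kc, proj Ω x ∈ N := fun x hx =>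
    hP.tube.frontier_subset (hP.tube.proj_mem x (hP.subset_N hx))
  have hbd : IsCompact (proj Ω '' (Kc \ S)) :=
    hP.compact_bdry.image_of_continuousOn (hP.continuousOn_proj.mono sdiff_subset)
  have hcl : closure (proj Ω '' S) ⊆ proj Ω '' Kc :=
    closure_minimal (image_mono hP.subset)
      (hP.compact.image_of_continuousOn hP.continuousOn_proj).isClosed
  -- The open set for uniqueness is the tube minus the image of the boundary of the face; in it p(S)
  -- is relatively closed.
  refine hB.unique (hP.piola_h1 hΨ hA hw) hP.measure_image_piece_ne_top hP.measurableSet_image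
    (hP.tube.isOpen.inter hbd.isClosed.isOpen_compl) ?_ ?_
    (fun y hy => hP.tube.contDiffAt_nu hy.1) ?_
  · rintro _ ⟨x, hx, rfl⟩
    refine ⟨himg x (hP.subset hx), ?_⟩
    rintro ⟨x', hx', he⟩
    rw [hP.inj hx'.1 (hP.subset hx) he] at hx'
    exact hx'.2 hx
  · rintro y ⟨hy, hyc⟩
    obtain ⟨x, hx, rfl⟩ := hcl hyc
    by_contra hcon
    exact hy.2 ⟨x, ⟨hx, fun hxS => hcon ⟨x, hxS, rfl⟩⟩, rfl⟩
  · rintro _ ⟨x, hx, rfl⟩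
    exact hP.tube.norm_nu _ (himg x (hP.subset hx))

variable {K ε : ℝ} (hnear : ∀ x ∈ Kc, NearFlat Ω N e₁ e₂ m K ε x)
include hnear

/-- The pointwise estimate for the deformation tensor of the Piola transform. -/
theorem ae_norm_deform_sub_le (hΨ : ∀ x ∈ Kc, Ψ (proj Ω x) = x)
    (hA : IsH1Tangential S (fun _ => m) v A)
    (hw : ∀ᵐ y ∂(μHE[2].restrict (proj Ω '' S)), w y = piolaMat Ω e₁ e₂ (Ψ y) (v (Ψ y)))
    (hB : IsH1Tangential (proj Ω '' S) (nu Ω) w B) :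
    ∀ᵐ y ∂(μHE[2].restrict (proj Ω '' S)),
      ‖deform (nu Ω) B y - deform (fun _ => m) A (Ψ y)‖ ≤
        378 * K ^ 12 * ε * (‖covGrad (fun _ => m) A (Ψ y)‖ + ‖v (Ψ y)‖) := by
  filter_upwards [hP.weak_jacobian_eq hΨ hA hw hB, hP.ae_inv hΨ (hP.covGrad_eq hA),
    hP.ae_inv hΨ hA.tangential, ae_restrict_mem hP.measurableSet_image] with y hBy hAy hvy hy
  obtain ⟨x, hx, rfl⟩ := hy
  have hxK := hP.subset hx
  rw [hΨ x hxK] at hBy hAy hvy ⊢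
  refine (norm_deform_sub_le _ _ _ _ _ _).trans ?_
  rw [hAy, covGrad, hBy, hP.tube.nu_proj x (hP.subset_N hxK)]
  exact (hnear x hxK).norm_covGrad_sub_le (by rw [real_inner_comm]; exact hvy) hAy

/-- The `L²` estimate for the deformation tensor of the Piola transform. -/
theorem eLpNorm_deform_le (hK : 1 ≤ K) (hε : 0 ≤ ε) (hΨ : ∀ x ∈ Kc, Ψ (proj Ω x) = x)
    (hA : IsH1Tangential S (fun _ => m) v A)
    (hw : ∀ᵐ y ∂(μHE[2].restrict (proj Ω '' S)), w y = piolaMat Ω e₁ e₂ (Ψ y) (v (Ψ y)))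
    (hB : IsH1Tangential (proj Ω '' S) (nu Ω) w B) :
    eLpNorm (deform (nu Ω) B) 2 (μHE[2].restrict (proj Ω '' S)) ≤
      ENNReal.ofReal (8 * K ^ 4) * (eLpNorm (deform (fun _ => m) A) 2 (μHE[2].restrict S) +
        ENNReal.ofReal (378 * K ^ 12 * ε) * (eLpNorm (covGrad (fun _ => m) A) 2
          (μHE[2].restrict S) + eLpNorm v 2 (μHE[2].restrict S))) := by
  have hAm := hA.memLp_grad.aestronglyMeasurable
  have hcm := aestronglyMeasurable_covGrad (m := m) hAm
  have hdm := aestronglyMeasurable_deform (m := m) hAm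
  have hvm := hA.memLp.aestronglyMeasurable
  set c : ℝ := 378 * K ^ 12 * ε with hc
  have hc0 : 0 ≤ c := by positivity
  have hJ1 : (1 : ℝ) ≤ 8 * K ^ 4 := by
    have : (1 : ℝ) ≤ K ^ 4 := one_le_pow₀ hK
    linarith
  set g : E3 → ℝ := fun x => ‖deform (fun _ => m) A x‖ + c * (‖covGrad (fun _ => m) A x‖ + ‖v x‖)
    with hg
  have hgm : AEStronglyMeasurable g (μHE[2].restrict S) :=
    hdm.norm.add ((hcm.norm.add hvm.norm).const_mul c)
  have h1 : eLpNorm (deform (nu Ω) B) 2 (μHE[2].restrict (proj Ω '' S)) ≤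
      eLpNorm (fun y => g (Ψ y)) 2 (μHE[2].restrict (proj Ω '' S)) := by
    refine eLpNorm_mono_ae_real ?_
    filter_upwards [hP.ae_norm_deform_sub_le hnear hΨ hA hw hB] with y hy
    have := norm_le_norm_add_norm_sub' (deform (nu Ω) B y) (deform (fun _ => m) A (Ψ y))
    exact this.trans (add_le_add_right hy _)
  have h2 := hP.eLpNorm_inv_le hΨ (J := 8 * K ^ 4)
    (fun x hx => (hnear x (hP.subset hx)).projJac_le) hgm
  -- The change of variables costs the square root of the bound on J, which is at most the bound
  -- itself because the latter is at least 1.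
  have h3 : ENNReal.ofReal (8 * K ^ 4) ^ (1 / 2 : ENNReal).toReal ≤
      ENNReal.ofReal (8 * K ^ 4) := by
    refine (ENNReal.rpow_le_rpow_of_exponent_le (ENNReal.one_le_ofReal.2 hJ1)
      (?_ : (1 / 2 : ENNReal).toReal ≤ 1)).trans (ENNReal.rpow_one _).le
    norm_num
  refine h1.trans (h2.trans (mul_le_mul' h3 ?_))
  have h4 : eLpNorm g 2 (μHE[2].restrict S) ≤ _ :=
    eLpNorm_add_le hdm.norm ((hcm.norm.add hvm.norm).const_mul c) one_le_two
  refine h4.trans ?_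
  rw [eLpNorm_norm]
  refine add_le_add_right ?_ _
  have h5 : eLpNorm (fun x => c * (‖covGrad (fun _ => m) A x‖ + ‖v x‖)) 2
      (μHE[2].restrict S) = _ := eLpNorm_const_smul c
        ((fun x => ‖covGrad (fun _ => m) A x‖) + fun x => ‖v x‖) 2 (μHE[2].restrict S)
  rw [h5, Real.enorm_of_nonneg hc0]
  refine mul_le_mul_right ?_ _
  refine (eLpNorm_add_le hcm.norm hvm.norm one_le_two).trans ?_
  rw [eLpNorm_norm, eLpNorm_norm]

end FlatPiece

/-! ### Polyhedral surfaces -/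

namespace PolyhedralSurface

variable (Γ : PolyhedralSurface)

theorem closedInterior_subset_carrier (i : Fin Γ.numFaces) :
    (Γ.face i).closedInterior ⊆ Γ.carrier :=
  subset_iUnion (fun i => (Γ.face i).closedInterior) i

theorem isCompact_carrier : IsCompact Γ.carrier :=
  isCompact_iUnion fun i => (Γ.face i).isCompact_closedInterior

theorem inner_normal_sub (i : Fin Γ.numFaces) {x : E3} (hx : x ∈ (Γ.face i).closedInterior) :
    ⟪Γ.normal i, x - (Γ.face i).points 0⟫ = 0 := by
  have hconv : Convex ℝ {x : E3 | ⟪Γ.normal i, x⟫ = ⟪Γ.normal i, (Γ.face i).points 0⟫} :=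
    convex_hyperplane ⟨fun _ _ => inner_add_right _ _ _, fun _ _ => real_inner_smul_right _ _ _⟩ _
  rw [← Affine.Simplex.convexHull_eq_closedInterior] at hx
  have := convexHull_min (by
    rintro _ ⟨j, rfl⟩
    have := Γ.normal_orth i j 0
    rwa [inner_sub_right, sub_eq_zero] at this) hconv hx
  rw [inner_sub_right, sub_eq_zero]
  exact this

theorem meshSize_nonneg : 0 ≤ Γ.meshSize := Real.iSup_nonneg fun _ => Metric.diam_nonneg

/-- Applied to the tube, this bounds h independently of the triangulation, so that h² can be
absorbed into h. -/
theorem meshSize_le (i : Fin Γ.numFaces) {T : Set E3} (hT : Bornology.IsBounded T)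
    (h : Γ.carrier ⊆ T) : Γ.meshSize ≤ Metric.diam T := by
  have : Nonempty (Fin Γ.numFaces) := ⟨i⟩
  exact ciSup_le fun j => Metric.diam_mono ((Γ.closedInterior_subset_carrier j).trans h) hT

end PolyhedralSurface

/-! ### Faces of a polyhedral approximation as flat pieces -/

section

variable {Ω N : Set E3} {δ M c : ℝ} {Γ : PolyhedralSurface}

theorem IsPolyhedralApprox.flatPiece (hΓ : IsPolyhedralApprox Ω δ M c Γ) (hN : TubeNbhd Ω N)
    (hsub : tube Ω δ ⊆ N) (hshape : ∀ x ∈ N, 1 / 2 < shapeDet Ω x) (hc : 0 < c)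
    (i : Fin Γ.numFaces) {e₁ e₂ : E3} (hf : IsFrame e₁ e₂ (Γ.normal i)) :
    FlatPiece Ω N e₁ e₂ (Γ.normal i) ((Γ.face i).points 0) (Γ.face i).interior
      (Γ.face i).closedInterior where
  frame := hf
  tube := hN
  shape := hshape
  compact := (Γ.face i).isCompact_closedInterior
  subset_N := (Γ.closedInterior_subset_carrier i).trans (hΓ.subset_tube.trans hsub)
  plane _ hx := Γ.inner_normal_sub i hx
  inj := hΓ.bijOn_proj.injOn.mono (Γ.closedInterior_subset_carrier i)
  inner_pos x hx := by
    rw [real_inner_comm]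
    exact hc.trans_le (hΓ.le_inner_normal i x hx)
  subset := (Γ.face i).interior_subset_closedInterior
  compact_bdry := by
    rw [Affine.Simplex.closedInterior_sdiff_interior]
    exact isCompact_iUnion fun j => ((Γ.face i).faceOpposite j).isCompact_closedInterior

theorem IsPolyhedralApprox.projInv_proj (hΓ : IsPolyhedralApprox Ω δ M c Γ) {x : E3}
    (hx : x ∈ Γ.carrier) : projInv Ω Γ (proj Ω x) = x :=
  hΓ.bijOn_proj.injOn.leftInvOn_invFunOn hx

/-- The Piola transform is given by the matrix `jac⁻¹ Dp`. -/
theorem IsPolyhedralApprox.liftPiola_eq (hΓ : IsPolyhedralApprox Ω δ M c Γ) (hN : TubeNbhd Ω N)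
    (hsub : tube Ω δ ⊆ N) (hshape : ∀ x ∈ N, 1 / 2 < shapeDet Ω x) (hc : 0 < c)
    (i : Fin Γ.numFaces) {e₁ e₂ : E3} (hf : IsFrame e₁ e₂ (Γ.normal i)) (v : E3 → E3) :
    ∀ᵐ y ∂(μHE[2].restrict (proj Ω '' (Γ.face i).interior)),
      liftPiola Ω Γ v y = piolaMat Ω e₁ e₂ (projInv Ω Γ y) (v (projInv Ω Γ y)) := by
  have hP := hΓ.flatPiece hN hsub hshape hc i hf
  have hcont : ContinuousOn (proj Ω) Γ.carrier := fun x hx =>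
    (hN.contDiffAt_proj (hsub (hΓ.subset_tube hx))).continuousAt.continuousWithinAt
  -- Finiteness of both surface measures, summed over the faces, is what the Radon–Nikodym argument
  -- for the area ratio requires.
  have hfin : μHE[2] Γ.carrier ≠ ⊤ := by
    refine (lt_of_le_of_lt (measure_iUnion_le _) ?_).ne
    rw [tsum_fintype]
    refine ENNReal.sum_lt_top.2 fun j _ => ?_
    obtain ⟨e₁, e₂, hf⟩ := exists_frame (Γ.norm_normal j)
    exact (hΓ.flatPiece hN hsub hshape hc j hf).measure_ne_top.lt_top
  have hfin' : μHE[2] (proj Ω '' Γ.carrier) ≠ ⊤ := by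
    rw [PolyhedralSurface.carrier, image_iUnion]
    refine (lt_of_le_of_lt (measure_iUnion_le _) ?_).ne
    rw [tsum_fintype]
    refine ENNReal.sum_lt_top.2 fun j _ => ?_
    obtain ⟨e₁, e₂, hf⟩ := exists_frame (Γ.norm_normal j)
    exact (hΓ.flatPiece hN hsub hshape hc j hf).measure_image_ne_top.lt_top
  have h1 := hP.areaRatio_eq Γ.isCompact_carrier (Γ.closedInterior_subset_carrier i) hcont
    (fun x hx => hΓ.projInv_proj hx) hfin hfin'
  rw [hΓ.bijOn_proj.image_eq] at h1
  filter_upwards [hP.ae_inv (fun x hx =>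
    hΓ.projInv_proj (Γ.closedInterior_subset_carrier i hx)) h1] with y hy
  rw [liftPiola, piola, hy]
  rfl

/-- With h ≤ D, the number ε = M (1 + D) h dominates both M h² and M h. The area element det(I − d
H) ⟪m, ν⟫ is at least c/2, because the determinant exceeds 1/2 in the tube. -/
theorem IsPolyhedralApprox.nearFlat (hΓ : IsPolyhedralApprox Ω δ M c Γ) (hN : TubeNbhd Ω N)
    (hsub : tube Ω δ ⊆ N) (hshape : ∀ x ∈ N, 1 / 2 < shapeDet Ω x) (hM : 0 < M) (hc : 0 < c)
    {D K : ℝ} (hD : Γ.meshSize ≤ D) (hK1 : 1 ≤ K)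
    (hH : ∀ x ∈ tube Ω δ, ‖fderiv ℝ (nu Ω) x‖ ≤ K)
    (hL : ∀ x ∈ tube Ω δ, ‖fderiv ℝ (fderiv ℝ (nu Ω)) x‖ ≤ K)
    (hKD : M * (1 + D) * D ≤ K) (hKc : 2 / c ≤ K)
    (i : Fin Γ.numFaces) {e₁ e₂ : E3} (hf : IsFrame e₁ e₂ (Γ.normal i)) {x : E3}
    (hx : x ∈ (Γ.face i).closedInterior) :
    NearFlat Ω N e₁ e₂ (Γ.normal i) K (M * (1 + D) * Γ.meshSize) x := by
  have hP := hΓ.flatPiece hN hsub hshape hc i hf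
  have hxC := Γ.closedInterior_subset_carrier i hx
  have hxT := hΓ.subset_tube hxC
  have hxN := hsub hxT
  have hh := Γ.meshSize_nonneg
  have hD0 := hh.trans hD
  have hMh : 0 ≤ M * Γ.meshSize := by positivity
  have hle := mul_le_mul_of_nonneg_left hD hMh
  refine ⟨hf, hN, hxN, hK1, by positivity, ?_, hH x hxT, hL x hxT, ?_, ?_, hP.jac_pos hx, ?_⟩
  · refine le_trans ?_ hKD
    gcongr
  · refine (hΓ.abs_sdist_le x hxC).trans ?_
    nlinarith
  · have := hΓ.normal_close i x hx
    rw [hN.nu_proj x hxN] at this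
    nlinarith [mul_nonneg hMh hD0]
  · have h1 : c / 2 ≤ projJac Ω e₁ e₂ x := by
      rw [hN.projJac_eq hf hxN]
      have h2 := hΓ.le_inner_normal i x hx
      rw [real_inner_comm] at h2
      nlinarith [hshape x hxN]
    calc (projJac Ω e₁ e₂ x)⁻¹ ≤ (c / 2)⁻¹ := inv_anti₀ (by positivity) h1
      _ = 2 / c := inv_div _ _
      _ ≤ K := hKc

end

/-- Covariant derivatives enter through a weak Jacobian, so membership in H¹ is the existence of
some B, while the estimates are asserted for every B; these agree almost everywhere. -/
theorem mainTheorem8 (Ω : Set E3) (hΩ : BoundsSmoothSurface Ω) :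
    ∃ δ : ℝ, IsTubularWidth Ω δ ∧
      ∀ M c : ℝ, 0 < M → 0 < c →
        ∃ C : ℝ, 0 < C ∧
          ∀ Γ : PolyhedralSurface, IsPolyhedralApprox Ω δ M c Γ →
            ∀ (i : Fin Γ.numFaces) (v : E3 → E3) (A : E3 → Mat3),
              IsH1Tangential (Γ.face i).interior (fun _ => Γ.normal i) v A →
              (∃ B : E3 → Mat3, IsH1Tangential (proj Ω '' (Γ.face i).interior) (nu Ω)
                (liftPiola Ω Γ v) B) ∧
              ∀ B : E3 → Mat3,
                IsH1Tangential (proj Ω '' (Γ.face i).interior) (nu Ω) (liftPiola Ω Γ v) B →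
                (∀ᵐ y ∂(μHE[2].restrict (proj Ω '' (Γ.face i).interior)),
                  ‖deform (nu Ω) B y - deform (fun _ => Γ.normal i) A (projInv Ω Γ y)‖ ≤
                    C * Γ.meshSize *
                      (‖covGrad (fun _ => Γ.normal i) A (projInv Ω Γ y)‖ +
                        ‖v (projInv Ω Γ y)‖)) ∧
                eLpNorm (deform (nu Ω) B) 2
                    (μHE[2].restrict (proj Ω '' (Γ.face i).interior)) ≤
                  ENNReal.ofReal C *
                    (eLpNorm (deform (fun _ => Γ.normal i) A) 2
                        (μHE[2].restrict (Γ.face i).interior) +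
                      ENNReal.ofReal Γ.meshSize *
                        (eLpNorm (covGrad (fun _ => Γ.normal i) A) 2
                            (μHE[2].restrict (Γ.face i).interior) +
                          eLpNorm v 2 (μHE[2].restrict (Γ.face i).interior))) := by
  obtain ⟨N, δ, hN, hδ, hsub, hshape⟩ := exists_tubeNbhd hΩ
  refine ⟨δ, hN.mono_tube hδ hsub, fun M c hM hc => ?_⟩
  have hT := isCompact_tube hΩ δ
  obtain ⟨K₁, hK₁⟩ := hT.exists_bound_of_continuousOn (f := fderiv ℝ (nu Ω)) fun x hx =>
    (hN.contDiffAt_fderiv_nu (hsub hx)).continuousAt.continuousWithinAt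
  obtain ⟨K₂, hK₂⟩ := hT.exists_bound_of_continuousOn (f := fderiv ℝ (fderiv ℝ (nu Ω)))
    fun x hx => ((hN.contDiffAt_fderiv_nu (hsub hx)).fderiv_right
      (m := 0) (by simp)).continuousAt.continuousWithinAt
  set D := Metric.diam (tube Ω δ) with hD
  have hD0 : 0 ≤ D := Metric.diam_nonneg
  have hMD : 0 ≤ M * (1 + D) * D := by positivity
  have hc2 : 0 < 2 / c := by positivity
  -- A sum dominating each quantity that `nearFlat` must bound: 1, the first two derivatives of ν,
  -- ε, and J⁻¹. It depends only on γ, δ, M and c.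
  obtain ⟨K, hK⟩ : ∃ K, K = 1 + |K₁| + |K₂| + M * (1 + D) * D + 2 / c := ⟨_, rfl⟩
  have hK1 : 1 ≤ K := by linarith [abs_nonneg K₁, abs_nonneg K₂]
  obtain ⟨C₀, hC₀⟩ : ∃ C₀, C₀ = 378 * K ^ 12 * (M * (1 + D)) := ⟨_, rfl⟩
  have hC₀0 : 0 ≤ C₀ := by rw [hC₀]; positivity
  have hJ1 : (1 : ℝ) ≤ 8 * K ^ 4 := by
    have : (1 : ℝ) ≤ K ^ 4 := one_le_pow₀ hK1
    linarith
  -- The factor 8K⁴ bounds the area ratio in the L² estimate; 1 + C₀ covers both the coefficient 1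
  -- of the deformation and the coefficient C₀ of the terms of order h.
  refine ⟨8 * K ^ 4 * (1 + C₀), by positivity, fun Γ hΓ i v A hA => ?_⟩
  obtain ⟨e₁, e₂, hf⟩ := exists_frame (Γ.norm_normal i)
  have hP := hΓ.flatPiece hN hsub hshape hc i hf
  have hh := Γ.meshSize_nonneg
  have hΨ : ∀ x ∈ (Γ.face i).closedInterior, projInv Ω Γ (proj Ω x) = x := fun x hx =>
    hΓ.projInv_proj (Γ.closedInterior_subset_carrier i hx)
  have hw := hΓ.liftPiola_eq hN hsub hshape hc i hf v
  have hnear : ∀ x ∈ (Γ.face i).closedInterior,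
      NearFlat Ω N e₁ e₂ (Γ.normal i) K (M * (1 + D) * Γ.meshSize) x := fun x hx =>
    hΓ.nearFlat hN hsub hshape hM hc (Γ.meshSize_le i hT.isBounded hΓ.subset_tube) hK1
      (fun x hx => (hK₁ x hx).trans (by linarith [le_abs_self K₁, abs_nonneg K₂]))
      (fun x hx => (hK₂ x hx).trans (by linarith [le_abs_self K₂, abs_nonneg K₁]))
      (by linarith [abs_nonneg K₁, abs_nonneg K₂]) (by linarith [abs_nonneg K₁, abs_nonneg K₂])
      i hf hx
  have hε : 378 * K ^ 12 * (M * (1 + D) * Γ.meshSize) = C₀ * Γ.meshSize := by rw [hC₀]; ring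
  refine ⟨⟨_, hP.piola_h1 hΨ hA hw⟩, fun B hB => ⟨?_, ?_⟩⟩
  · filter_upwards [hP.ae_norm_deform_sub_le hnear hΨ hA hw hB] with y hy
    refine hy.trans ?_
    rw [hε]
    gcongr
    nlinarith
  · refine (hP.eLpNorm_deform_le hnear hK1 (by positivity) hΨ hA hw hB).trans ?_
    rw [hε, ENNReal.ofReal_mul hC₀0, ENNReal.ofReal_mul (by positivity : (0 : ℝ) ≤ 8 * K ^ 4),
      mul_assoc, mul_assoc, mul_add (ENNReal.ofReal (1 + C₀))]
    refine mul_le_mul_right (add_le_add ?_ ?_) _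
    · exact le_mul_of_one_le_left' (ENNReal.one_le_ofReal.2 (by linarith))
    · exact mul_le_mul_left (ENNReal.ofReal_le_ofReal (by linarith)) _

end
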